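/- Let $\mathcal K=(\Sigma,\to,\ell)$ be a Kripke structure over a set $AP$ of atoms, with $\Sigma$ finite and nonempty, $\to$ total and $\ell:\Sigma\to\wp(AP)$. A relation $R\subseteq\Sigma\times\Sigma$ is a simulation if $s\,R\,s'$ implies $\ell(s')=\ell(s)$ and, for every $t$ with $s\to t$, there is $t'$ with $s'\to t'$ and $t\,R\,t'$. States $s,s'$ are simulation equivalent if $s\,R_1\,s'$ and $s'\,R_2\,s$ for some simulations $R_1,R_2$; $P_{\mathrm{sim}}$ is the partition into equivalence classes. (If $\ell(s')\subseteq\ell(s)$ always implies $\ell(s')=\ell(s)$, e.g. if every state satisfies exactly one atom, the condition $\ell(s')\subseteq\ell(s)$ defines the same partition.) Put $\mathrm{pre}(Y)=\{a\mid\exists b\in Y.\,a\to b\}$ and $\mathrm{Atoms}=\{\{s\mid p\in\ell(s)\}\mid p\in AP\}$. An abstract domain $A$ of $\wp(\Sigma)$ is given by its closure operator $\mu_A=\gamma\circ\alpha$, or equivalently by the family $\gamma(A)$ of the sets fixed by $\mu_A$, which is closed under intersections; it is disjunctive if $\gamma(A)$ is also closed under unions. $A'$ refines $A$ if $\gamma(A)\subseteq\gamma(A')$.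 The partition $\mathrm{pr}(A)$ identifies $s$ and $s'$ iff $\mu_A(\{s\})=\mu_A(\{s'\})$; for $B,C\in\mathrm{pr}(A)$ put $B\unlhd_A C$ iff $\mu_A(B)\subseteq\mu_A(C)$, a partial order. For $A$ disjunctive and $S\in\gamma(A)$, let $\mathrm{refine}(S,A)$ be the most abstract disjunctive domain that refines $A$ and contains $\mathrm{pre}(S)$; $S$ is a refiner of $A$ if $\mathrm{refine}(S,A)\ne A$. The nondeterministic scheme $\mathrm{GPT}$ (for $\{\mathrm{pre}\}$ on disjunctive domains) starts from the most abstract disjunctive domain $A_0$ that contains all the classes $\{s'\mid\ell(s')=\ell(s)\}$, and replaces the current $A$ by $\mathrm{refine}(S,A)$ for some refiner $S$ until there are no refiners. The algorithm keeps a partition as a doubly linked list $P$ of blocks; each block $B$ has a list $\mathit{less}(B)$ of blocks, a pointer $\mathit{intersection}$ (initially null) and a flag $\mathit{changedImage}$ (initially false); each state points to its block. * $\mathit{split}(S)$: every $s\in S$ is moved from its block $B$ to the block $\mathit{intersection}(B)$; if that pointer is null, a new block $D$ is first created and appended to $P$, with $\mathit{intersection}(B)=\mathit{intersection}(D)=D$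 and $\mathit{less}(D)$ a copy of $\mathit{less}(B)$. If $B$ becomes empty, it takes its states back from $D$, $D$ is removed and deleted, and $\mathit{intersection}(B)=B$. * $\mathit{orderUpdate}()$: for every $B\in P$ and $C\in\mathit{less}(B)$: if $B\cap S=\varnothing$ and $C$ was split, append $\mathit{intersection}(C)$ to $\mathit{less}(B)$; if $B\subseteq S$ and $C\not\subseteq S$, remove $C$ from $\mathit{less}(B)$, append $\mathit{intersection}(C)$ if it is not null, and set $\mathit{changedImage}(B)$. * Main program: start with $P=(\Sigma)$ and $\mathit{less}(\Sigma)=(\Sigma)$. For every $S\in\mathrm{Atoms}$: $\mathit{split}(S)$, $\mathit{orderUpdate}()$, reset all pointers $\mathit{intersection}$, and the same for $\Sigma\smallsetminus S$. Then scan $P$: for the current block $B$, let $X$ be the union of the blocks in $\mathit{less}(B)$ and $S=\mathrm{pre}(X)$ (without repetitions); execute $\mathit{split}(S)$ and $\mathit{orderUpdate}()$; reset all pointers $\mathit{intersection}$; clear each set flag $\mathit{changedImage}$ and move its block to the end of $P$. The scan goes on with the next block not yet scanned since it was created or last moved, until none is left. Time is the number of elementary pointer and list operations. Space is the peak number of memory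 words used, apart from the read-only input (the lists of predecessors of the states and the list $\mathrm{Atoms}$). **Theorem.** There is a universal constant $C$ such that on every such $\mathcal K$, for every order of the input lists: 1. The algorithm terminates and its final partition is $P_{\mathrm{sim}}$. 2. It is an instance of $\mathrm{GPT}$: there are disjunctive domains $A_0,\dots,A_n$, with $A_0$ as above and $n$ the number of blocks scanned, such that after $i$ scans the memory represents the poset $\langle\mathrm{pr}(A_i),\unlhd_{A_i}\rangle$ (the blocks in $P$ are those of $\mathrm{pr}(A_i)$, and $\mathit{less}(B)$ lists the $C\unlhd_{A_i}B$). If $B$ is the next block scanned and $S=\mu_{A_i}(B)$, then $A_{i+1}=\mathrm{refine}(S,A_i)$ if $S$ is a refiner of $A_i$, and $A_{i+1}=A_i$ otherwise; and $A_n$ has no refiners. So $A_n$ is the output of a run of $\mathrm{GPT}$. 3. It uses at most $C\,(|\Sigma|+|P_{\mathrm{sim}}|^2)$ space. 4. It uses at most $C\,(|\mathrm{Atoms}|+|P_{\mathrm{sim}}|^2)\,(|P_{\mathrm{sim}}|^2+|{\to}|)$ time. In particular, it runs in time $O(|P_{\mathrm{sim}}|^2\cdot(|P_{\mathrm{sim}}|^2+|{\to}|))$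 if $|\mathrm{Atoms}|\le|P_{\mathrm{sim}}|^2$, for example if the sets in $\mathrm{Atoms}$ form a partition of $\Sigma$ (and likewise for any fixed finite $AP$, with a constant that depends on $|AP|$). -/

import Mathlib

universe u v w

/-! ### Kripke structures and simulation equivalence -/

/-- A Kripke structure over `AP`: a total transition relation together with a state labelling. -/
structure Kripke (σ : Type u) (AP : Type v) where
  trans : σ → σ → Prop
  total : ∀ s, ∃ t, trans s t
  label : σ → Set AP

namespace Kripke

variable {σ : Type u} {AP : Type v} (K : Kripke σ AP)

/-- The predecessor transformer `pre(Y) = {a | ∃ b ∈ Y, a → b}`. -/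
def pre (Y : Set σ) : Set σ := {a | ∃ b ∈ Y, K.trans a b}

/-- The set `{[p] | p ∈ AP}` of the interpretations of the atoms. -/
def atomSets : Set (Set σ) := {T | ∃ p : AP, T = {s | p ∈ K.label s}}

/-- The block `[s]_ℓ` of the states that carry the same label as `s`. -/
def labelClass (s : σ) : Set σ := {s' | K.label s = K.label s'}

/-- The number of transitions. -/
noncomputable def numTrans : ℕ := Set.ncard {e : σ × σ | K.trans e.1 e.2}

/-- `R` is a simulation, with the labels of related states `s R s'` compared by
`cmp (ℓ s') (ℓ s)`. -/
def IsSimulation (cmp : Set AP → Set AP → Prop) (R : σ → σ → Prop) : Prop :=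
  ∀ s s', R s s' → cmp (K.label s') (K.label s) ∧
    ∀ t, K.trans s t → ∃ t', K.trans s' t' ∧ R t t'

/-- `s` and `s'` simulate each other, through two possibly different simulations. -/
def SimEquiv (cmp : Set AP → Set AP → Prop) (s s' : σ) : Prop :=
  (∃ R, K.IsSimulation cmp R ∧ R s s') ∧ (∃ R, K.IsSimulation cmp R ∧ R s' s)

theorem isSimulation_comp {cmp : Set AP → Set AP → Prop}
    (htrans : ∀ a b c, cmp a b → cmp b c → cmp a c) {R Q : σ → σ → Prop}
    (hR : K.IsSimulation cmp R) (hQ : K.IsSimulation cmp Q) :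
    K.IsSimulation cmp (fun x z => ∃ y, R x y ∧ Q y z) := by
  rintro x z ⟨y, hxy, hyz⟩
  refine ⟨htrans _ _ _ (hQ y z hyz).1 (hR x y hxy).1, fun t ht => ?_⟩
  obtain ⟨t', ht', hr⟩ := (hR x y hxy).2 t ht
  obtain ⟨t'', ht'', hq⟩ := (hQ y z hyz).2 t' ht'
  exact ⟨t'', ht'', t', hr, hq⟩

theorem simEquiv_equivalence {cmp : Set AP → Set AP → Prop} (hrefl : ∀ a, cmp a a)
    (htrans : ∀ a b c, cmp a b → cmp b c → cmp a c) :
    Equivalence (K.SimEquiv cmp) where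
  refl s := by
    have h : K.IsSimulation cmp (fun x y => x = y) := by
      rintro x y rfl
      exact ⟨hrefl _, fun t ht => ⟨t, ht, rfl⟩⟩
    exact ⟨⟨_, h, rfl⟩, ⟨_, h, rfl⟩⟩
  symm h := ⟨h.2, h.1⟩
  trans := by
    rintro x y z ⟨⟨R, hR, hxy⟩, ⟨R', hR', hyx⟩⟩ ⟨⟨Q, hQ, hyz⟩, ⟨Q', hQ', hzy⟩⟩
    exact ⟨⟨_, K.isSimulation_comp htrans hR hQ, y, hxy, hyz⟩,
      ⟨_, K.isSimulation_comp htrans hQ' hR', y, hzy, hyx⟩⟩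

/-- Simulation equivalence, where `s R s'` requires `ℓ s' = ℓ s`. -/
def simSetoid : Setoid σ :=
  ⟨K.SimEquiv (fun a b => a = b),
    K.simEquiv_equivalence (fun _ => rfl) (fun _ _ _ h h' => h.trans h')⟩

/-- Simulation equivalence, where `s R s'` only requires `ℓ s' ⊆ ℓ s`. -/
def simSetoidIncl : Setoid σ :=
  ⟨K.SimEquiv (fun a b => a ⊆ b),
    K.simEquiv_equivalence (fun _ => subset_rfl) (fun _ _ _ h h' => h.trans h')⟩

/-- The partition `P_sim` of simulation equivalence (for equality of labels). -/
def Psim : Set (Set σ) := K.simSetoid.classes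

/-- The partition of simulation equivalence for inclusion of labels. -/
def PsimIncl : Set (Set σ) := K.simSetoidIncl.classes

end Kripke

/-! ### Abstract domains of the powerset of the states -/

/-- An abstract domain of `℘(σ)` up to equivalence, given by the Moore family `γ(A)`,
i.e. by the image of the upper closure operator `γ ∘ α`. -/
@[ext] structure AbsDom (σ : Type u) where
  img : Set (Set σ)
  sInter_mem : ∀ 𝒮 : Set (Set σ), 𝒮 ⊆ img → ⋂₀ 𝒮 ∈ img

namespace AbsDom

variable {σ : Type u}

/-- `A ⊑ B`: the domain `A` is more precise than `B`. -/
instance : PartialOrder (AbsDom σ) where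
  le A B := B.img ⊆ A.img
  le_refl _ := subset_rfl
  le_trans _ _ _ h h' := h'.trans h
  le_antisymm _ _ h h' := AbsDom.ext (Set.Subset.antisymm h' h)

/-- The closure operator `γ ∘ α` of `A`. -/
def cl (A : AbsDom σ) (S : Set σ) : Set σ := ⋂₀ {T | T ∈ A.img ∧ S ⊆ T}

/-- The Moore closure `ℳ(𝒳)`. -/
def moore (𝒳 : Set (Set σ)) : AbsDom σ where
  img := {T | ∃ 𝒮 : Set (Set σ), 𝒮 ⊆ 𝒳 ∧ T = ⋂₀ 𝒮}
  sInter_mem 𝒯 h𝒯 := by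
    refine ⟨{S | S ∈ 𝒳 ∧ ⋂₀ 𝒯 ⊆ S}, fun S hS => hS.1, ?_⟩
    apply Set.Subset.antisymm
    · exact fun x hx S hS => hS.2 hx
    · intro x hx T hT
      obtain ⟨𝒮, h𝒮, rfl⟩ := h𝒯 hT
      exact fun S hS => hx S ⟨h𝒮 hS, fun y hy => hy _ hT S hS⟩

/-- The reduced product `A ⊓ B`, i.e. the most abstract domain that refines both. -/
def meet (A B : AbsDom σ) : AbsDom σ := moore (A.img ∪ B.img)

/-- The state equivalence `pr(A)`: `α({s}) = α({s'})`. -/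
def pr (A : AbsDom σ) : Setoid σ := Setoid.ker (fun s => A.cl {s})

/-- `A` is disjunctive: `γ(A)` is closed under arbitrary unions. -/
def IsDisjunctive (A : AbsDom σ) : Prop :=
  ∀ 𝒮 : Set (Set σ), 𝒮 ⊆ A.img → ⋃₀ 𝒮 ∈ A.img

end AbsDom

/-- The disjunctive abstract domains, with the precision order. -/
abbrev DisjDom (σ : Type u) := {A : AbsDom σ // A.IsDisjunctive}

/-- The disjunctive shell: the least upper bound of the disjunctive domains that refine `A`. -/
def disjShell {σ : Type u} (A : AbsDom σ) : DisjDom σ :=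
  ⟨{ img := {T | ∀ X : AbsDom σ, X ≤ A → X.IsDisjunctive → T ∈ X.img}
     sInter_mem := fun _ h𝒮 X hX hd => X.sInter_mem _ fun _ hS => h𝒮 hS X hX hd },
   fun _ h𝒮 X hX hd => hd _ fun _ hS => h𝒮 hS X hX hd⟩

/-! ### The algorithm scheme GPT -/

/-- A Galois insertion `(α, Abs(℘(σ))_⊒, 𝒜_≥, γ)` of a poset `𝒜` into the dual of the lattice of
abstract domains. -/
structure AbsGI (σ : Type u) (𝒜 : Type w) [PartialOrder 𝒜] where
  α : AbsDom σ → 𝒜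
  γ : 𝒜 → AbsDom σ
  gc : ∀ A a, a ≤ α A ↔ γ a ≤ A
  α_γ : ∀ a, α (γ a) = a

/-- The Galois insertion of the disjunctive abstract domains: the disjunctive shell and the
inclusion. -/
def disjGI (σ : Type u) : AbsGI σ (DisjDom σ) where
  α := disjShell
  γ := Subtype.val
  gc A a := by
    constructor
    · intro h T hT
      exact h (fun X hX _ => hX hT)
    · intro h T hT
      exact hT a.1 h a.2
  α_γ a := by
    apply Subtype.ext
    apply AbsDom.ext
    apply Set.Subset.antisymm
    · exact fun T hT => hT a.1 le_rfl a.2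
    · exact fun T hT X hX _ => hX hT

/-- Functions on `℘(σ)` of some finite arity. -/
abbrev SetFun (σ : Type u) := Σ n : ℕ, (Fin n → Set σ) → Set σ

namespace AbsGI

variable {σ : Type u} {𝒜 : Type w} [PartialOrder 𝒜] (G : AbsGI σ 𝒜)

/-- The best correct approximation `α(γ(a) ⊓ ℳ({f(S)}))` of the refinement of domains by `f(S)`. -/
def refine (f : SetFun σ) (S : Fin f.1 → Set σ) (a : 𝒜) : 𝒜 :=
  G.α ((G.γ a).meet (AbsDom.moore {f.2 S}))

/-- The `f`-refiners of `a`. -/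
def refiners (f : SetFun σ) (a : 𝒜) : Set (Fin f.1 → Set σ) :=
  {S | (∀ i, S i ∈ (G.γ a).img) ∧ G.refine f S a < a}

/-- One iteration of the while loop of GPT for the set `F` of functions. -/
def GPTStep (F : Set (SetFun σ)) (a a' : 𝒜) : Prop :=
  ∃ f ∈ F, ∃ S ∈ G.refiners f a, a' = G.refine f S a

/-- Some run of GPT for `F` on the input `a` stops with the output `a'`. -/
def GPTOutput (F : Set (SetFun σ)) (a a' : 𝒜) : Prop :=
  Relation.ReflTransGen (G.GPTStep F) a a' ∧ ∀ f ∈ F, G.refiners f a' = ∅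

end AbsGI

namespace Kripke

variable {σ : Type u} {AP : Type v} (K : Kripke σ AP)

/-- `pre` as a function of arity 1. -/
def preFun : SetFun σ := ⟨1, fun S => K.pre (S 0)⟩

/-- The disjunctive abstract domain on which GPT starts: the disjunctive shell of the domain
generated by the blocks `[s]_ℓ`. -/
def initDom : DisjDom σ := disjShell (AbsDom.moore (Set.range K.labelClass))

end Kripke

/-! ### The imperative algorithm

The memory is that of a pointer machine whose doubly linked lists support appending, unlinking the
item at hand and moving to the next item in one unit of time.  Pointers to `Block` records are
natural numbers, and `none` is `NULL`.  The unit of time is charged by `tick`: every assignment,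
allocation, deletion and list operation below costs one unit, and so does every test for the end of
a `for all` loop (only a bounded number of other tests and dereferences, which are absorbed in the
constants, lies between two charges); loops, copies and unions of lists are spelled out item by item.
After each unit of time the number of words in use is compared with the peak recorded so far. -/

namespace SimAlg

/-- A record `Block`.  `members` are the states in the interval `[first, last]` of the list of all
the states. -/
structure Block (σ : Type u) where
  members : List σ := []
  less : List ℕ := []
  intersection : Option ℕ := none
  changedImage : Bool := false

/-- The working memory.  The list `P` of blocks is `scanned ++ pending`, split at the position that
the main loop has reached; `X` and `S` are lists of pointers to states, and `block` and `mark` are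
fields of the records of the states (`mark` makes it possible to append a state to `S` only once).
`time` and `peak` are counters of the resources used. -/
structure Mem (σ : Type u) where
  block : σ → ℕ
  mark : σ → Bool
  heap : ℕ → Block σ
  fresh : ℕ
  scanned : List ℕ
  pending : List ℕ
  X : List σ
  S : List σ
  time : ℕ
  peak : ℕ

variable {σ : Type u} [Fintype σ] [DecidableEq σ]

/-- The list of the blocks of the current partition. -/
def Mem.P (m : Mem σ) : List ℕ := m.scanned ++ m.pending

/-- The number of words in use: five for each state (its fields `block`, `mark`, `pre` and the two
links of the list of states), seven for each block (`first`, `last`, `less`, `intersection`,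
`changedImage` and the two links of `P`), three for each item of a list `less`, two for each item of
`X` and `S`, and a fixed number of variables. -/
def Mem.words (m : Mem σ) : ℕ :=
  5 * Fintype.card σ + (m.P.map fun b => 7 + 3 * (m.heap b).less.length).sum
    + 2 * m.X.length + 2 * m.S.length + 16

/-- Charge one unit of time. -/
def tick (m : Mem σ) : Mem σ := { m with time := m.time + 1, peak := max m.peak m.words }

/-- `for all a in l do body`, for the items that are in the list when the loop is entered. -/
def forAll {α : Type*} : List α → (α → Mem σ → Mem σ) → Mem σ → Mem σ
  | [], _, m => tick m
  | a :: l, body, m => forAll l body (body a (tick m))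

/-- An assignment to a field of the block `b`. -/
def assign (b : ℕ) (f : Block σ → Block σ) (m : Mem σ) : Mem σ :=
  tick { m with heap := Function.update m.heap b (f (m.heap b)) }

def setIntersection (b : ℕ) (i : Option ℕ) : Mem σ → Mem σ :=
  assign b fun r => { r with intersection := i }

def setChangedImage (b : ℕ) (c : Bool) : Mem σ → Mem σ :=
  assign b fun r => { r with changedImage := c }

def appendLess (b c : ℕ) : Mem σ → Mem σ :=
  assign b fun r => { r with less := r.less ++ [c] }

def removeLess (b c : ℕ) : Mem σ → Mem σ :=
  assign b fun r => { r with less := r.less.erase c }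

def setBlock (s : σ) (b : ℕ) (m : Mem σ) : Mem σ :=
  tick { m with block := Function.update m.block s b }

def setMark (s : σ) (c : Bool) (m : Mem σ) : Mem σ :=
  tick { m with mark := Function.update m.mark s c }

def appendX (s : σ) (m : Mem σ) : Mem σ := tick { m with X := m.X ++ [s] }

def appendS (s : σ) (m : Mem σ) : Mem σ := tick { m with S := m.S ++ [s] }

def clearX (m : Mem σ) : Mem σ := tick { m with X := [] }

def clearS (m : Mem σ) : Mem σ := tick { m with S := [] }

/-- Allocate `b->intersection`, append it to `P` and initialize its fields. -/
def newIntersection (b : ℕ) (m : Mem σ) : Mem σ :=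
  let d := m.fresh
  let m := tick { m with fresh := d + 1, heap := Function.update m.heap d {} }
  let m := setIntersection b (some d) m
  let m := tick { m with pending := m.pending ++ [d] }
  let m := setIntersection d (some d) m
  let m := forAll (m.heap b).less (fun c m => appendLess d c m) m
  setChangedImage d false m

/-- `move(s, b, d)`: move the state `s` from the block `b` to the block `d`. -/
def move (s : σ) (b d : ℕ) (m : Mem σ) : Mem σ :=
  let m := assign b (fun r => { r with members := r.members.erase s }) m
  let m := assign d (fun r => { r with members := r.members ++ [s] }) m
  setBlock s d m

/-- The case in which all the states of `b` have been moved to `d = b->intersection`: `b` takes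
them back, `d` is removed from `P` and deleted, and `b->intersection = b`. -/
def takeBack (b d : ℕ) (m : Mem σ) : Mem σ :=
  let m := assign b (fun r => { r with members := (m.heap d).members }) m
  let m := forAll (m.heap b).members (fun s m => setBlock s b m) m
  let m := tick { m with scanned := m.scanned.erase d, pending := m.pending.erase d }
  let m := assign d (fun _ => {}) m
  setIntersection b (some b) m

/-- The procedure `split(S)`. -/
def split (m : Mem σ) : Mem σ :=
  forAll m.S (fun s m =>
    let b := m.block s
    let m := if (m.heap b).intersection = none then newIntersection b m else m
    let d := (m.heap b).intersection.getD b
    let m := move s b d m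
    if (m.heap b).members = [] then takeBack b d m else m) m

/-- The procedure `orderUpdate()`.  After `split(S)`, the block `B` is contained in `S` iff
`B->intersection = B`, it has been split by `S` and is the part outside `S` iff `B->intersection`
is another block, which then is the part inside `S`, and otherwise `B->intersection = NULL`. -/
def orderUpdate (m : Mem σ) : Mem σ :=
  forAll m.P (fun b m =>
    if (m.heap b).intersection ≠ some b then
      forAll (m.heap b).less (fun c m =>
        match (m.heap c).intersection with
        | none => m
        | some d => if d = c then m else appendLess b d m) m
    else
      forAll (m.heap b).less (fun c m =>
        if (m.heap c).intersection = some c then m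
        else
          let m := removeLess b c m
          let m := match (m.heap c).intersection with
            | none => m
            | some d => appendLess b d m
          setChangedImage b true m) m) m

/-- Reset the fields `intersection` to `NULL`. -/
def resetIntersections (m : Mem σ) : Mem σ :=
  forAll m.P (fun b m => setIntersection b none m) m

/-- Replace `S` by its complement. -/
def complementS (states : List σ) (m : Mem σ) : Mem σ :=
  let m := forAll m.S (fun s m => setMark s true m) m
  let m := clearS m
  let m := forAll states (fun s m => if m.mark s then m else appendS s m) m
  forAll states (fun s m => setMark s false m) m

/-- `X = image(b)`: the states of the blocks in the list `b->less`. -/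
def image (b : ℕ) (m : Mem σ) : Mem σ :=
  forAll (m.heap b).less (fun c m =>
    forAll (m.heap c).members (fun s m => appendX s m) m) m

/-- `for all s in X do S.append(s->pre)`, as a union of sets of states. -/
def preImage (pre : σ → List σ) (m : Mem σ) : Mem σ :=
  let m := forAll m.X (fun s m =>
    forAll (pre s) (fun t m => if m.mark t then m else appendS t (setMark t true m)) m) m
  let m := forAll m.S (fun t m => setMark t false m) m
  clearX m

/-- The last loop of an iteration: reset `intersection`, and move the blocks whose image has changed
to the end of `P`. -/
def resetAndMove (m : Mem σ) : Mem σ :=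
  forAll m.P (fun b m =>
    let m := setIntersection b none m
    if (m.heap b).changedImage then
      let m := setChangedImage b false m
      tick { m with scanned := m.scanned.erase b, pending := m.pending.erase b ++ [b] }
    else m) m

/-- The input of the algorithm for `K`: the list of the states, the lists of the predecessors of
the states, and the list `Atoms` of the sets `[p]`, each of them without repetitions. -/
structure Input {AP : Type v} (K : Kripke σ AP) where
  states : List σ
  states_nodup : states.Nodup
  mem_states : ∀ s, s ∈ states
  pre : σ → List σ
  pre_nodup : ∀ s, (pre s).Nodup
  mem_pre : ∀ s t, t ∈ pre s ↔ K.trans t s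
  atoms : List (List σ)
  atoms_nodup : ∀ a ∈ atoms, a.Nodup
  atoms_distinct : (atoms.map fun a => {s : σ | s ∈ a}).Nodup
  mem_atoms : ∀ T : Set σ, (∃ a ∈ atoms, {s : σ | s ∈ a} = T) ↔ T ∈ K.atomSets

namespace Input

variable {AP : Type v} {K : Kripke σ AP} (I : Input K)

/-- The first part: build the single block partition and split it by each atom and by its
complement. -/
def setup : Mem σ :=
  let m : Mem σ :=
    { block := fun _ => 0, mark := fun _ => false,
      heap := fun b => if b = 0 then { members := I.states, less := [0] } else {},
      fresh := 1, scanned := [], pending := [0], X := [], S := [], time := 0, peak := 0 }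
  let m := forAll I.states (fun s m => setMark s false (setBlock s 0 m)) m
  forAll I.atoms (fun a m =>
    let m := forAll a (fun s m => appendS s m) m
    let m := resetIntersections (orderUpdate (split m))
    let m := complementS I.states m
    let m := resetIntersections (orderUpdate (split m))
    clearS m) m

/-- The body of the main loop for the block `b` at the head of `pending`. -/
def body (b : ℕ) (m : Mem σ) : Mem σ :=
  let m := tick { m with scanned := m.scanned ++ [b], pending := m.pending.tail }
  let m := image b m
  let m := preImage I.pre m
  let m := split m
  let m := orderUpdate m
  let m := clearS m
  resetAndMove m

/-- One step of the main loop `for all B in P`, which has ended when no block is pending. -/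
def loopStep (m : Mem σ) : Mem σ :=
  match m.pending with
  | [] => m
  | b :: _ => I.body b m

/-- The memory after `i` iterations of the main loop. -/
def run (i : ℕ) : Mem σ := I.loopStep^[i] I.setup

/-- The algorithm halts after exactly `n` iterations of the main loop. -/
def HaltsAt (n : ℕ) : Prop :=
  (∀ i < n, (I.run i).pending ≠ []) ∧ (I.run n).pending = []

end Input

/-- The set of states of the block `b`. -/
def Mem.states (m : Mem σ) (b : ℕ) : Set σ := {s | s ∈ (m.heap b).members}

/-- The partition that is stored in the memory. -/
def Mem.partition (m : Mem σ) : Set (Set σ) := {B | ∃ b ∈ m.P, B = m.states b}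

/-- The memory represents the poset `⟨pr(A), ⊴_A⟩`, where `B ⊴_A C` iff `γ(α(B)) ⊆ γ(α(C))`. -/
structure Represents (m : Mem σ) (A : AbsDom σ) : Prop where
  nodup : m.P.Nodup
  blocks : Set.BijOn m.states {b | b ∈ m.P} A.pr.classes
  members_nodup : ∀ b ∈ m.P, (m.heap b).members.Nodup
  block_eq : ∀ b ∈ m.P, ∀ s, m.block s = b ↔ s ∈ m.states b
  less_nodup : ∀ b ∈ m.P, (m.heap b).less.Nodup
  mem_less : ∀ b ∈ m.P, ∀ c, c ∈ (m.heap b).less ↔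
    c ∈ m.P ∧ A.cl (m.states c) ⊆ A.cl (m.states b)

end SimAlg

/-! A disjunctive domain is the family of sets closed under the preorder `rel`, in which `t` lies
above `s` when `t` is in the closure of `{s}` (`IsDisjunctive.mem_img_iff`). In these terms `pr` is
the symmetric part of the preorder, and adding `U = pre(S)` and taking the disjunctive shell deletes
exactly the pairs that lead from `U` to a state outside `U` (`rel_refinePre`). A partition with
lists `less` is therefore a stored preorder (`Rep`), and `split` followed by `orderUpdate` turns the
stored `r` into `splitRel r S` (`orderUpdate_split_spec`).

Correctness. The simulation preorder `Sim` lies inside every preorder that is reached: it lies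
inside equality of labels, and if `S` is closed under `Sim`, so is `pre(S)`. Conversely, once `pre`
of the closure of each singleton is closed, the current preorder is itself a simulation, hence
equals `Sim`, and no refiner is left (`PreComplete`). The main loop maintains this closedness for
the states of scanned blocks: fixed sets are never lost, and a block whose closure shrinks is
flagged and becomes pending again.

Termination. Let `k` be the number of simulation classes. Every block is a union of such classes, so
there are at most `k` blocks. A scan uses up a pending block; a block becomes pending only by being
created or by being flagged. A newly flagged block has a pair `s ∈ S`, `t ∉ S` that is deleted; as
`S` is closed under `Sim`, a pair of whole classes is lost, and different blocks lose different
pairs. This bounds the scans by `2k + k²` (`loopPotential`, `body_spec`).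

Resources. Loops are analysed by `forAll_rule` and `forAll_exact`. Within one `split`, a block gets
a partner at most once and takes its states back at most once, so a scan costs `O(|Σ| + k² + |→|)`,
where `|Σ| ≤ |→|` by totality. All lists of blocks have length at most `3k` at every moment, which
gives the space bound. -/

set_option linter.unusedSectionVars false

/-! ### Disjunctive domains as preorders on the states -/

namespace AbsDom

variable {σ : Type u}

theorem mem_cl_self (A : AbsDom σ) (s : σ) : s ∈ A.cl {s} := fun _ hT => hT.2 rfl

theorem cl_mem_img (A : AbsDom σ) (S : Set σ) : A.cl S ∈ A.img :=
  A.sInter_mem _ fun _ hT => hT.1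

theorem cl_subset (A : AbsDom σ) {S T : Set σ} (hT : T ∈ A.img) (h : S ⊆ T) : A.cl S ⊆ T :=
  fun _ hx => hx T ⟨hT, h⟩

theorem subset_cl (A : AbsDom σ) (S : Set σ) : S ⊆ A.cl S := fun _ hx _ hT => hT.2 hx

theorem cl_mono (A : AbsDom σ) {S T : Set σ} (h : S ⊆ T) : A.cl S ⊆ A.cl T :=
  A.cl_subset (A.cl_mem_img T) (h.trans (A.subset_cl T))

/-- The preorder on states induced by an abstract domain: `t` lies in the closure of `{s}`. -/
def rel (A : AbsDom σ) (s t : σ) : Prop := t ∈ A.cl {s}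

theorem rel_iff (A : AbsDom σ) {s t : σ} : A.rel s t ↔ A.cl {t} ⊆ A.cl {s} :=
  ⟨fun h => A.cl_subset (A.cl_mem_img _) (Set.singleton_subset_iff.2 h),
    fun h => h (A.mem_cl_self t)⟩

theorem rel_trans (A : AbsDom σ) {s t u : σ} (h : A.rel s t) (h' : A.rel t u) : A.rel s u :=
  A.rel_iff.1 h h'

theorem pr_iff (A : AbsDom σ) {s t : σ} : A.pr s t ↔ A.rel s t ∧ A.rel t s := by
  rw [A.rel_iff, A.rel_iff]
  change A.cl {s} = A.cl {t} ↔ _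
  exact ⟨fun h => ⟨h.ge, h.le⟩, fun h => Set.Subset.antisymm h.2 h.1⟩

theorem cl_eq_of_pr_class (A : AbsDom σ) {B : Set σ} {s : σ} (hs : s ∈ B)
    (hB : ∀ t ∈ B, A.rel s t) : A.cl B = A.cl {s} :=
  Set.Subset.antisymm (A.cl_subset (A.cl_mem_img _) hB)
    (A.cl_mono (Set.singleton_subset_iff.2 hs))

/-- The disjunctive domain of the sets that are closed under a relation. -/
def ofRel (r : σ → σ → Prop) : AbsDom σ where
  img := {T | ∀ s ∈ T, ∀ t, r s t → t ∈ T}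
  sInter_mem _ h𝒮 s hs t hst T hT := h𝒮 hT s (hs T hT) t hst

theorem ofRel_isDisjunctive (r : σ → σ → Prop) : (ofRel r).IsDisjunctive := by
  rintro 𝒮 h𝒮 s ⟨T, hT, hs⟩ t hst
  exact ⟨T, hT, h𝒮 hT s hs t hst⟩

/-- A set closed under `rel` is the union of the closures of its singletons, and a disjunctive
domain contains such unions. So the domain is determined by its preorder. -/
theorem IsDisjunctive.mem_img_iff {A : AbsDom σ} (hA : A.IsDisjunctive) {T : Set σ} :
    T ∈ A.img ↔ ∀ s ∈ T, ∀ t, A.rel s t → t ∈ T := by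
  constructor
  · intro hT s hs t hst
    exact A.cl_subset hT (Set.singleton_subset_iff.2 hs) hst
  · intro h
    have : T = ⋃₀ {U | ∃ s ∈ T, U = A.cl {s}} := by
      ext x
      constructor
      · exact fun hx => ⟨_, ⟨x, hx, rfl⟩, A.mem_cl_self x⟩
      · rintro ⟨_, ⟨s, hs, rfl⟩, hx⟩
        exact h s hs x hx
    rw [this]
    apply hA
    rintro _ ⟨s, _, rfl⟩
    exact A.cl_mem_img _

/-- The shell adds only sets closed under `A.rel`, because `ofRel A.rel` is a disjunctive refinement
of `A`; such sets do not separate a related pair. -/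
theorem rel_disjShell (A : AbsDom σ) (s t : σ) : (disjShell A).1.rel s t ↔ A.rel s t := by
  constructor
  · intro h T hT
    exact h T ⟨fun X hX _ => hX hT.1, hT.2⟩
  · rintro h T ⟨hT, hs⟩
    exact hT (ofRel A.rel) (fun U hU x hx y hxy => A.cl_subset hU (Set.singleton_subset_iff.2 hx) hxy)
      (ofRel_isDisjunctive _) s (hs rfl) t h

theorem rel_moore (𝒳 : Set (Set σ)) (s t : σ) :
    (moore 𝒳).rel s t ↔ ∀ T ∈ 𝒳, s ∈ T → t ∈ T := by
  constructor
  · intro h T hT hs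
    exact h T ⟨⟨{T}, by simpa using hT, by simp⟩, by simpa using hs⟩
  · rintro h _ ⟨⟨𝒮, h𝒮, rfl⟩, hs⟩ T hT
    exact h T (h𝒮 hT) (hs rfl T hT)

/-- A Moore closure orders the states by membership in its generators, and here `U` is the only new
generator. -/
theorem rel_meet_moore_singleton (A : AbsDom σ) (U : Set σ) (s t : σ) :
    (A.meet (moore {U})).rel s t ↔ A.rel s t ∧ (s ∈ U → t ∈ U) := by
  rw [meet, rel_moore]
  constructor
  · intro h
    refine ⟨fun T hT => h T (Or.inl hT.1) (hT.2 rfl), h U (Or.inr ⟨{U}, subset_rfl, by simp⟩)⟩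
  · rintro ⟨h, h'⟩ T (hT | ⟨𝒮, h𝒮, rfl⟩) hs
    · exact A.cl_subset hT (Set.singleton_subset_iff.2 hs) h
    · intro V hV
      obtain rfl : V = U := h𝒮 hV
      exact h' (hs _ hV)

end AbsDom

/-! ### Simulations, and refinement by `pre` as an operation on preorders -/

namespace Kripke

variable {σ : Type u} {AP : Type v} (K : Kripke σ AP)

theorem rel_initDom (s t : σ) : K.initDom.1.rel s t ↔ K.label s = K.label t := by
  rw [initDom, AbsDom.rel_disjShell, AbsDom.rel_moore]
  constructor
  · exact fun h => h (K.labelClass s) ⟨s, rfl⟩ rfl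
  · rintro h _ ⟨u, rfl⟩ hs
    exact Eq.trans hs h

/-- The largest simulation that compares labels by equality. -/
def Sim (s t : σ) : Prop := ∃ R, K.IsSimulation (fun a b => a = b) R ∧ R s t

variable {K}

theorem Sim.label_eq {s t : σ} (h : K.Sim s t) : K.label s = K.label t :=
  let ⟨_, hR, hst⟩ := h
  (hR s t hst).1.symm

theorem Sim.trans {s t u : σ} (h : K.Sim s t) (h' : K.Sim t u) : K.Sim s u :=
  let ⟨_, hR, hst⟩ := h
  let ⟨_, hQ, htu⟩ := h'
  ⟨_, K.isSimulation_comp (fun _ _ _ h h' => h.trans h') hR hQ, t, hst, htu⟩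

theorem Sim.exists_trans {s t s' : σ} (h : K.Sim s t) (hs : K.trans s s') :
    ∃ t', K.trans t t' ∧ K.Sim s' t' :=
  let ⟨R, hR, hst⟩ := h
  let ⟨t', ht, hr⟩ := (hR s t hst).2 s' hs
  ⟨t', ht, R, hR, hr⟩

variable (K)

theorem simSetoid_iff {s t : σ} : K.simSetoid s t ↔ K.Sim s t ∧ K.Sim t s := Iff.rfl

theorem PsimIncl_eq (h : ∀ s s', K.label s' ⊆ K.label s → K.label s' = K.label s) :
    K.PsimIncl = K.Psim := by
  have : K.simSetoidIncl = K.simSetoid := by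
    have key : ∀ R, K.IsSimulation (fun a b => a ⊆ b) R ↔ K.IsSimulation (fun a b => a = b) R := by
      intro R
      constructor
      · exact fun hR s s' hs => ⟨h _ _ (hR s s' hs).1, (hR s s' hs).2⟩
      · exact fun hR s s' hs => ⟨(hR s s' hs).1.subset, (hR s s' hs).2⟩
    refine Setoid.ext fun s t => ?_
    change K.SimEquiv _ s t ↔ K.SimEquiv _ s t
    simp only [SimEquiv, key]
  rw [PsimIncl, Psim, this]

/-- Refinement of a disjunctive domain by `pre(S)`. -/
def refinePre (S : Set σ) (A : DisjDom σ) : DisjDom σ :=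
  (disjGI σ).refine K.preFun (fun _ => S) A

theorem rel_refinePre (S : Set σ) (A : DisjDom σ) (s t : σ) :
    (K.refinePre S A).1.rel s t ↔ A.1.rel s t ∧ (s ∈ K.pre S → t ∈ K.pre S) :=
  (AbsDom.rel_disjShell _ _ _).trans (AbsDom.rel_meet_moore_singleton _ _ _ _)

theorem img_subset_refinePre (S : Set σ) (A : DisjDom σ) : A.1.img ⊆ (K.refinePre S A).1.img := by
  intro T hT
  rw [(K.refinePre S A).2.mem_img_iff]
  exact fun s hs t hst => A.2.mem_img_iff.1 hT s hs t ((K.rel_refinePre S A s t).1 hst).1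

theorem refinePre_le (S : Set σ) (A : DisjDom σ) : K.refinePre S A ≤ A :=
  K.img_subset_refinePre S A

theorem pre_mem_refinePre (S : Set σ) (A : DisjDom σ) : K.pre S ∈ (K.refinePre S A).1.img := by
  rw [(K.refinePre S A).2.mem_img_iff]
  exact fun s hs t hst => ((K.rel_refinePre S A s t).1 hst).2 hs

/-- A simulated state is related by every domain that GPT reaches. -/
theorem Sim.rel_refinePre {S : Set σ} {A : DisjDom σ} (hS : S ∈ A.1.img)
    (hA : ∀ s t, K.Sim s t → A.1.rel s t) (s t : σ) (h : K.Sim s t) :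
    (K.refinePre S A).1.rel s t := by
  refine (K.rel_refinePre S A s t).2 ⟨hA s t h, ?_⟩
  rintro ⟨s', hs', hss'⟩
  obtain ⟨t', ht', hst'⟩ := h.exists_trans hss'
  exact ⟨t', A.2.mem_img_iff.1 hS s' hs' t' (hA _ _ hst'), ht'⟩

/-- `A` is forward complete for `pre`. -/
def PreComplete (A : DisjDom σ) : Prop := ∀ s, K.pre (A.1.cl {s}) ∈ A.1.img

variable {K}

/-- Completeness is only assumed for closures of singletons. This suffices because a fixed set is
the union of the closures of its points and `pre` commutes with unions. -/
theorem PreComplete.refiners_eq_empty {A : DisjDom σ} (h : K.PreComplete A) :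
    (disjGI σ).refiners K.preFun A = ∅ := by
  rw [Set.eq_empty_iff_forall_notMem]
  rintro (S : Fin 1 → Set σ) ⟨(hS : ∀ i : Fin 1, S i ∈ A.1.img), hlt⟩
  refine hlt.not_ge fun T hT => ?_
  have hT' : T ∈ (K.refinePre (S 0) A).1.img := by
    have : S = fun _ => S 0 := by funext i; rw [Subsingleton.elim i 0]
    rw [this] at hT
    exact hT
  change T ∈ A.1.img
  rw [(K.refinePre (S 0) A).2.mem_img_iff] at hT'
  rw [A.2.mem_img_iff]
  refine fun s hs t hst => hT' s hs t ((K.rel_refinePre _ _ _ _).2 ⟨hst, ?_⟩)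
  rintro ⟨s', hs', hss'⟩
  have hsub : A.1.cl {s'} ⊆ S 0 := A.1.cl_subset (hS 0) (Set.singleton_subset_iff.2 hs')
  obtain ⟨t', ht', htt'⟩ := A.2.mem_img_iff.1 (h s') s ⟨s', A.1.mem_cl_self s', hss'⟩ t hst
  exact ⟨t', hsub ht', htt'⟩

/-- The preorder of a complete domain is itself a simulation: if `s → s'`, then `s` lies in `pre` of
the closure of `{s'}`; this set is closed, so it contains `t`, which means that `t` has a successor
above `s'`. -/
theorem PreComplete.rel_iff {A : DisjDom σ} (h : K.PreComplete A) (hle : A ≤ K.initDom)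
    (hA : ∀ s t, K.Sim s t → A.1.rel s t) (s t : σ) : A.1.rel s t ↔ K.Sim s t := by
  refine ⟨fun hst => ⟨A.1.rel, ?_, hst⟩, hA s t⟩
  intro s t hst
  constructor
  · refine ((K.rel_initDom s t).1 fun T hT => hst T ⟨hle hT.1, hT.2⟩).symm
  · intro s' hs'
    obtain ⟨t', ht', htt'⟩ := A.2.mem_img_iff.1 (h s') s ⟨s', A.1.mem_cl_self s', hs'⟩ t hst
    exact ⟨t', htt', ht'⟩

theorem PreComplete.classes_eq {A : DisjDom σ} (h : K.PreComplete A) (hle : A ≤ K.initDom)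
    (hA : ∀ s t, K.Sim s t → A.1.rel s t) : A.1.pr.classes = K.Psim := by
  have : A.1.pr = K.simSetoid := by
    ext s t
    rw [A.1.pr_iff, h.rel_iff hle hA, h.rel_iff hle hA]
    rfl
  rw [this, Psim]

end Kripke

namespace SimAlg

variable {σ : Type u} [Fintype σ] [DecidableEq σ]

/-! ### Accounting for time and space -/

/-- The memory `m` with the counters reset to `t` and `p`. -/
def Mem.withCounters (m : Mem σ) (t p : ℕ) : Mem σ := { m with time := t, peak := p }

/-- The memory without its counters. -/
def Mem.data (m : Mem σ) : Mem σ := m.withCounters 0 0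

theorem Mem.exists_withCounters {m d : Mem σ} (h : m.data = d.data) :
    ∃ t p, m = d.withCounters t p := by
  refine ⟨m.time, m.peak, ?_⟩
  have : m = m.data.withCounters m.time m.peak := rfl
  rw [this, h]
  rfl

/-- Going from `m` to `m'` takes at most `T` units of time, and at most `W` words are in use. -/
def Spends (W T : ℕ) (m m' : Mem σ) : Prop := m'.time ≤ m.time + T ∧ m'.peak ≤ max m.peak W

theorem Spends.refl (W : ℕ) (m : Mem σ) : Spends W 0 m m := ⟨le_rfl, le_max_left _ _⟩

theorem Spends.trans {W T T' : ℕ} {m m' m'' : Mem σ} (h : Spends W T m m')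
    (h' : Spends W T' m' m'') : Spends W (T + T') m m'' := by
  unfold Spends at *
  omega

theorem Spends.mono {W T T' : ℕ} {m m' : Mem σ} (h : Spends W T m m') (hT : T ≤ T') :
    Spends W T' m m' := by
  unfold Spends at *
  omega

/-- An elementary operation changes the data of `m` to get `m'` and then ticks, so only the words of
`m'` are compared with the peak, and the counters of `m` and `m'` agree by `rfl`. -/
theorem spends_tick {W : ℕ} {m m' : Mem σ} (hw : m'.words ≤ W) (ht : m'.time = m.time := by rfl)
    (hp : m'.peak = m.peak := by rfl) : Spends W 1 m (tick m') := by
  refine ⟨?_, ?_⟩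
  · rw [← ht]; exact le_rfl
  · rw [← hp]; exact max_le_max le_rfl hw

/-- This is a loop rule with amortized cost. The potential `Φ` pays in each round for the body and
for the test of the loop, and the final `+ 1` is the test that fails. Invariant and potential must
ignore the counters, since `tick` precedes each body. -/
theorem forAll_rule {α : Type*} {body : α → Mem σ → Mem σ} {W : ℕ}
    (I : List α → Mem σ → Prop) (Φ : List α → Mem σ → ℕ)
    (hI : ∀ l m, I l m → I l (tick m)) (hΦ : ∀ l m, Φ l (tick m) = Φ l m)
    (hW : ∀ l m, I l m → m.words ≤ W)
    (step : ∀ a l m, I (a :: l) m → I l (body a m) ∧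
      ∃ T, Spends W T m (body a m) ∧ T + 1 + Φ l (body a m) ≤ Φ (a :: l) m) :
    ∀ l m, I l m → I [] (forAll l body m) ∧ Spends W (Φ l m + 1) m (forAll l body m) := by
  suffices ∀ l m, I l m → I [] (forAll l body m) ∧
      ∃ T, Spends W T m (forAll l body m) ∧ T ≤ Φ l m + 1 from
    fun l m h => ⟨(this l m h).1, let ⟨_, h1, h2⟩ := (this l m h).2; h1.mono h2⟩
  intro l
  induction l with
  | nil => exact fun m h => ⟨hI _ _ h, 1, spends_tick (hW _ _ h), by omega⟩
  | cons a l ih =>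
    intro m h
    obtain ⟨h1, T, h2, h3⟩ := step a l (tick m) (hI _ _ h)
    obtain ⟨h4, T', h5, h6⟩ := ih _ h1
    refine ⟨h4, _, ((spends_tick (hW _ _ h)).trans h2).trans h5, ?_⟩
    rw [hΦ] at h3
    omega

/-- The effect of a loop whose intermediate memories are known exactly. -/
theorem forAll_exact {α : Type*} {body : α → Mem σ → Mem σ} {W : ℕ} (L : List α)
    (F : List α → Mem σ) (cost : α → ℕ) (hW : ∀ l, l <+: L → (F l).words ≤ W)
    (step : ∀ l a t p, l ++ [a] <+: L →
      (body a ((F l).withCounters t p)).data = (F (l ++ [a])).data ∧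
        Spends W (cost a) ((F l).withCounters t p) (body a ((F l).withCounters t p)))
    (m : Mem σ) (h0 : m.data = (F []).data) :
    (forAll L body m).data = (F L).data ∧
      Spends W ((L.map fun a => cost a + 1).sum + 1) m (forAll L body m) := by
  have := forAll_rule (body := body) (W := W)
    (fun l m => ∃ l', l' ++ l = L ∧ m.data = (F l').data)
    (fun l _ => (l.map fun a => cost a + 1).sum) (fun _ _ h => h) (fun _ _ => rfl)
    (by
      rintro l m ⟨l', rfl, h⟩
      obtain ⟨t, p, rfl⟩ := Mem.exists_withCounters h
      exact hW l' (List.prefix_append _ _))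
    (by
      rintro a l m ⟨l', hl, h⟩
      obtain ⟨t, p, rfl⟩ := Mem.exists_withCounters h
      have hs := step l' a t p ⟨l, by simpa using hl⟩
      exact ⟨⟨l' ++ [a], by simpa using hl, hs.1⟩, _, hs.2, by simp [add_assoc]⟩)
    L m ⟨[], rfl, h0⟩
  obtain ⟨⟨l', hl, h⟩, h'⟩ := this
  rw [List.append_nil] at hl
  subst hl
  exact ⟨h, h'⟩

theorem sum_map_const_add_one {α : Type*} (L : List α) (c : ℕ) :
    (L.map fun _ => c + 1).sum = L.length * (c + 1) := by simp

/-- Bounds on the sizes of the lists in memory. -/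
structure Fits (N : ℕ) (m : Mem σ) : Prop where
  blocks : m.P.length ≤ N
  less : ∀ b, (m.heap b).less.length ≤ N
  X : m.X.length ≤ Fintype.card σ
  S : m.S.length ≤ Fintype.card σ

/-- The number of words that suffice for memories with lists of length at most `N`. -/
def wordBound (σ : Type u) [Fintype σ] (N : ℕ) : ℕ := 9 * Fintype.card σ + N * (7 + 3 * N) + 16

theorem Fits.words_le {N : ℕ} {m : Mem σ} (h : Fits N m) : m.words ≤ wordBound σ N := by
  have h1 : (m.P.map fun b => 7 + 3 * (m.heap b).less.length).sum ≤ m.P.length * (7 + 3 * N) := by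
    have := List.sum_le_card_nsmul (m.P.map fun b => 7 + 3 * (m.heap b).less.length) (7 + 3 * N)
      (by
        intro x hx
        obtain ⟨b, _, rfl⟩ := List.mem_map.1 hx
        have := h.less b
        omega)
    simpa using this
  have h2 := Nat.mul_le_mul_right (7 + 3 * N) h.blocks
  have := h.X
  have := h.S
  unfold Mem.words wordBound
  omega

theorem Fits.congr {N : ℕ} {m m' : Mem σ} (h : Fits N m) (hP : m'.P = m.P) (hh : m'.heap = m.heap)
    (hX : m'.X = m.X) (hS : m'.S = m.S) : Fits N m' :=
  ⟨hP ▸ h.blocks, hh ▸ h.less, hX ▸ h.X, hS ▸ h.S⟩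

/-! ### The elementary loops -/

theorem image_spec {N : ℕ} {m : Mem σ} (b : ℕ) (hF : Fits N m)
    (hX : (m.X ++ (m.heap b).less.flatMap fun c => (m.heap c).members).length ≤ Fintype.card σ) :
    (image b m).data =
        ({ m with X := m.X ++ (m.heap b).less.flatMap fun c => (m.heap c).members } : Mem σ).data ∧
      Spends (wordBound σ N) (2 * Fintype.card σ + 2 * N + 1) m (image b m) := by
  -- Every intermediate `X` is a prefix of the final one, so a single length bound serves both
  -- nested loops.
  have fits : ∀ X : List σ, X <+: m.X ++ (m.heap b).less.flatMap (fun c => (m.heap c).members) →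
      ∀ t p, (({ m with X := X } : Mem σ).withCounters t p).words ≤ wordBound σ N := by
    intro X hX' t p
    exact Fits.words_le ⟨hF.blocks, hF.less, hX'.length_le.trans hX, hF.S⟩
  have hpre : ∀ l, l <+: (m.heap b).less → m.X ++ l.flatMap (fun c => (m.heap c).members) <+:
      m.X ++ (m.heap b).less.flatMap (fun c => (m.heap c).members) := by
    rintro l ⟨l', hl⟩
    rw [← hl, List.flatMap_append, ← List.append_assoc]
    exact List.prefix_append _ _
  have := forAll_exact (W := wordBound σ N) (m.heap b).less
    (body := fun c m => forAll (m.heap c).members (fun s m => appendX s m) m)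
    (fun l => { m with X := m.X ++ l.flatMap fun c => (m.heap c).members })
    (fun c => 2 * (m.heap c).members.length + 1)
    (fun l hl => fits _ (hpre l hl) m.time m.peak)
    (by
      intro l c t p hl
      have hl' := hpre _ hl
      rw [List.flatMap_append, List.flatMap_singleton, ← List.append_assoc] at hl'
      have := forAll_exact (W := wordBound σ N) (m.heap c).members
        (body := fun s m => appendX s m)
        (fun l' => { m with X := m.X ++ l.flatMap (fun c => (m.heap c).members) ++ l' })
        (fun _ => 1)
        (fun l' h' => fits _ (((List.prefix_append_right_inj _).2 h').trans hl') m.time m.peak)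
        (by
          intro l' s t p h'
          refine ⟨?_, spends_tick ?_⟩
          · simp only [appendX, tick, Mem.data, Mem.withCounters, List.append_assoc]
          · refine Fits.words_le ⟨hF.blocks, hF.less, ?_, hF.S⟩
            refine le_trans (le_of_eq ?_)
              ((((List.prefix_append_right_inj _).2 h').trans hl').length_le.trans hX)
            simp [Mem.withCounters])
        ((({ m with X := m.X ++ l.flatMap fun c => (m.heap c).members } : Mem σ)).withCounters t p)
        (by simp only [Mem.data, Mem.withCounters, List.append_nil])
      rw [sum_map_const_add_one] at this
      refine ⟨this.1.trans ?_, this.2.mono (by omega)⟩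
      simp only [List.flatMap_append, List.flatMap_singleton, List.append_assoc])
    m (by simp only [Mem.data, Mem.withCounters, List.flatMap_nil, List.append_nil])
  refine ⟨this.1, this.2.mono ?_⟩
  have h1 : ∀ l : List ℕ, (l.map fun c => 2 * (m.heap c).members.length + 1 + 1).sum =
      2 * (l.flatMap fun c => (m.heap c).members).length + 2 * l.length := by
    intro l
    induction l with
    | nil => rfl
    | cons a l ih => simp only [List.map_cons, List.sum_cons, List.flatMap_cons, List.length_append,
        List.length_cons, ih]; ring
  rw [h1]
  have := hF.less b
  rw [List.length_append] at hX
  omega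

/-- Append the items of a list that do not occur yet. -/
def appendNew (S l : List σ) : List σ := l.foldl (fun S t => if t ∈ S then S else S ++ [t]) S

omit [Fintype σ] in
theorem appendNew_append (S l l' : List σ) :
    appendNew S (l ++ l') = appendNew (appendNew S l) l' := List.foldl_append ..

omit [Fintype σ] in
theorem mem_appendNew {S l : List σ} {t : σ} : t ∈ appendNew S l ↔ t ∈ S ∨ t ∈ l := by
  induction l generalizing S with
  | nil => simp [appendNew]
  | cons a l ih =>
    rw [show a :: l = [a] ++ l from rfl, appendNew_append, ih]
    have : t ∈ appendNew S [a] ↔ t ∈ S ∨ t = a := by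
      by_cases ha : a ∈ S <;> simp [appendNew, ha]
      rintro rfl; exact ha
    simp [this, or_assoc]

omit [Fintype σ] in
theorem nodup_appendNew {S : List σ} (hS : S.Nodup) (l : List σ) : (appendNew S l).Nodup := by
  induction l generalizing S with
  | nil => exact hS
  | cons a l ih =>
    rw [show a :: l = [a] ++ l from rfl, appendNew_append]
    apply ih
    by_cases ha : a ∈ S
    · simpa [appendNew, ha] using hS
    · simpa [appendNew, ha, List.nodup_append] using ⟨hS, fun b hb h => ha (h ▸ hb)⟩

theorem setMark_false_spec {N : ℕ} {m : Mem σ} (L : List σ) (hF : Fits N m) :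
    (forAll L (fun t m => setMark t false m) m).data =
        ({ m with mark := fun t => m.mark t && !decide (t ∈ L) } : Mem σ).data ∧
      Spends (wordBound σ N) (2 * L.length + 1) m (forAll L (fun t m => setMark t false m) m) := by
  have := forAll_exact (W := wordBound σ N) L (body := fun t m => setMark t false m)
    (fun l => { m with mark := fun t => m.mark t && !decide (t ∈ l) }) (fun _ => 1)
    (fun l _ => (hF.congr rfl rfl rfl rfl).words_le)
    (by
      intro l s t p h'
      refine ⟨?_, spends_tick (hF.congr rfl rfl rfl rfl).words_le⟩
      simp only [setMark, tick, Mem.data, Mem.withCounters]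
      congr 1
      funext x
      by_cases hx : x = s
      · subst hx; simp
      · simp [hx])
    m (by simp [Mem.data, Mem.withCounters])
  rw [sum_map_const_add_one] at this
  exact ⟨this.1, this.2.mono (by omega)⟩

theorem preImage_spec {N E : ℕ} {m : Mem σ} {pre : σ → List σ} (hF : Fits N m) (hS : m.S = [])
    (hmark : ∀ s, m.mark s = false) (hE : (m.X.map fun s => (pre s).length).sum ≤ E) :
    (preImage pre m).data =
        ({ m with X := [], S := appendNew [] (m.X.flatMap pre) } : Mem σ).data ∧
      Spends (wordBound σ N) (3 * E + 4 * Fintype.card σ + 3) m (preImage pre m) := by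
  have fits : ∀ (l : List σ) (k : σ → Bool) t p,
      Fits N (({ m with S := appendNew [] l, mark := k } : Mem σ).withCounters t p) := by
    intro l k t p
    exact ⟨hF.blocks, hF.less, hF.X, (nodup_appendNew List.nodup_nil l).length_le_card⟩
  -- While `S` is being built, `mark` is its characteristic function; testing the mark therefore
  -- decides membership in constant time and keeps `S` free of repetitions.
  obtain ⟨h1, h1'⟩ := forAll_exact (W := wordBound σ N) m.X
    (body := fun s m => forAll (pre s)
      (fun t m => if m.mark t then m else appendS t (setMark t true m)) m)
    (fun l => { m with
      S := appendNew [] (l.flatMap pre), mark := fun t => decide (t ∈ appendNew [] (l.flatMap pre)) })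
    (fun s => 3 * (pre s).length + 1)
    (fun l hl => (fits _ _ m.time m.peak).words_le)
    (by
      intro l s t p hl
      have := forAll_exact (W := wordBound σ N) (pre s)
        (body := fun t m => if m.mark t then m else appendS t (setMark t true m))
        (fun l' => { m with
          S := appendNew [] (l.flatMap pre ++ l'),
          mark := fun t => decide (t ∈ appendNew [] (l.flatMap pre ++ l')) })
        (fun _ => 2)
        (fun l' h' => (fits _ _ m.time m.peak).words_le)
        (by
          intro l' x t p h'
          by_cases hx : x ∈ appendNew [] (l.flatMap pre ++ l')
          · have hx' : appendNew [] (l.flatMap pre ++ (l' ++ [x])) =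
                appendNew [] (l.flatMap pre ++ l') := by
              rw [← List.append_assoc, appendNew_append]
              simp [appendNew] at hx ⊢
              simp [hx]
            simp only [Mem.withCounters, hx, decide_true, if_true, hx']
            exact ⟨rfl, (Spends.refl _ _).mono (by omega)⟩
          · have hx' : appendNew [] (l.flatMap pre ++ (l' ++ [x])) =
                appendNew [] (l.flatMap pre ++ l') ++ [x] := by
              rw [← List.append_assoc, appendNew_append]
              simp [appendNew] at hx ⊢
              simp [hx]
            simp only [Mem.withCounters, hx, decide_false, Bool.false_eq_true, if_false]
            refine ⟨?_, (spends_tick (m' := _) ?_).trans (spends_tick ?_)⟩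
            · simp only [Mem.data, Mem.withCounters, appendS, setMark, tick, hx']
              congr 1
              funext y
              by_cases hy : y = x
              · subst hy; simp
              · simp [hy]
            · exact (fits _ _ t p).words_le
            · refine Fits.words_le ⟨hF.blocks, hF.less, hF.X, ?_⟩
              have := (nodup_appendNew List.nodup_nil (l.flatMap pre ++ (l' ++ [x]))).length_le_card
              rwa [hx'] at this)
        (({ m with
            S := appendNew [] (l.flatMap pre)
            mark := fun t => decide (t ∈ appendNew [] (l.flatMap pre)) } : Mem σ).withCounters t p)
        (by simp only [Mem.data, Mem.withCounters, List.append_nil])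
      rw [sum_map_const_add_one] at this
      refine ⟨this.1.trans ?_, this.2.mono (by omega)⟩
      simp only [List.flatMap_append, List.flatMap_singleton])
    m (by
      simp only [Mem.data, Mem.withCounters, List.flatMap_nil]
      congr 1
      funext x
      simp [appendNew, hmark])
  have h0 : preImage pre m = clearX (forAll (forAll m.X (fun s m => forAll (pre s)
      (fun t m => if m.mark t then m else appendS t (setMark t true m)) m) m).S
      (fun t m => setMark t false m) (forAll m.X (fun s m => forAll (pre s)
      (fun t m => if m.mark t then m else appendS t (setMark t true m)) m) m)) := rfl
  rw [h0]
  set m1 := forAll m.X (fun s m => forAll (pre s)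
      (fun t m => if m.mark t then m else appendS t (setMark t true m)) m) m
  obtain ⟨t, p, h2⟩ := Mem.exists_withCounters h1
  have hF1 : Fits N m1 := by rw [h2]; exact fits _ _ _ _
  -- The marked states are exactly those of `S`, so running through `S` clears all the marks.
  obtain ⟨h3, h3'⟩ := setMark_false_spec m1.S hF1
  set m2 := forAll m1.S (fun t m => setMark t false m) m1
  obtain ⟨t', p', h4⟩ := Mem.exists_withCounters h3
  constructor
  · rw [h4, h2]
    simp only [Mem.data, Mem.withCounters, clearX, tick]
    congr 1
    funext x
    rw [hmark]
    by_cases hx : x ∈ appendNew [] (m.X.flatMap pre) <;> simp [hx]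
  · have hlen := hF1.S
    refine ((h1'.trans h3').trans (spends_tick ?_)).mono ?_
    · rw [h4, h2]
      have := fits (m.X.flatMap pre) (fun _ => false) 0 0
      exact Fits.words_le ⟨this.blocks, this.less, by simp, this.S⟩
    · have : ∀ l : List σ, (l.map fun s => 3 * (pre s).length + 1 + 1).sum =
          3 * (l.map fun s => (pre s).length).sum + 2 * l.length := by
        intro l
        induction l with
        | nil => rfl
        | cons a l ih => simp only [List.map_cons, List.sum_cons, List.length_cons, ih]; ring
      rw [this]
      have := hF.X
      omega

/-- The marks remember the old `S` after it has been cleared. They are false before and after, so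
only `S` changes. -/
theorem complementS_spec {N : ℕ} {m : Mem σ} {states : List σ} (hF : Fits N m)
    (hmark : ∀ s, m.mark s = false) (hst : states.Nodup) (hmem : ∀ s, s ∈ states) :
    (complementS states m).data =
        ({ m with S := states.filter (· ∉ m.S) } : Mem σ).data ∧
      Spends (wordBound σ N) (6 * Fintype.card σ + 4) m (complementS states m) := by
  have hcard : states.length ≤ Fintype.card σ := hst.length_le_card
  obtain ⟨h1, h1'⟩ := forAll_exact (W := wordBound σ N) m.S
    (body := fun s m => setMark s true m)
    (fun l => { m with mark := fun t => decide (t ∈ l) }) (fun _ => 1)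
    (fun l _ => (hF.congr rfl rfl rfl rfl).words_le)
    (by
      intro l s t p h'
      refine ⟨?_, spends_tick (hF.congr rfl rfl rfl rfl).words_le⟩
      simp only [setMark, tick, Mem.data, Mem.withCounters]
      congr 1
      funext x
      by_cases hx : x = s
      · subst hx; simp
      · simp [hx])
    m (by
      have hm : m.mark = fun _ => false := funext hmark
      simp [Mem.data, Mem.withCounters, ← hm])
  set m1 := forAll m.S (fun s m => setMark s true m) m
  obtain ⟨t, p, h2⟩ := Mem.exists_withCounters h1
  have hS : ∀ (S : List σ) (k : σ → Bool) t p, S.length ≤ Fintype.card σ →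
      Fits N (({ m with S := S, mark := k } : Mem σ).withCounters t p) :=
    fun S k t p h => ⟨hF.blocks, hF.less, hF.X, h⟩
  have h3' : Spends (wordBound σ N) 1 m1 (clearS m1) := by
    refine spends_tick ?_
    rw [h2]
    exact (hS [] (fun _ => false) 0 0 (by simp)).words_le
  have h3 : (clearS m1).data =
      ({ m with S := [], mark := fun t => decide (t ∈ m.S) } : Mem σ).data := by rw [h2]; rfl
  obtain ⟨h4, h4'⟩ := forAll_exact (W := wordBound σ N) states
    (body := fun s m => if m.mark s then m else appendS s m)
    (fun l => { m with mark := fun t => decide (t ∈ m.S), S := l.filter (· ∉ m.S) }) (fun _ => 1)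
    (fun l hl => (hS _ _ m.time m.peak ((List.length_filter_le _ _).trans
      (hl.length_le.trans hcard))).words_le)
    (by
      intro l s t p hl
      by_cases hs : s ∈ m.S
      · simp only [Mem.withCounters, hs, decide_true, if_true]
        exact ⟨by simp [Mem.data, Mem.withCounters, hs], (Spends.refl _ _).mono (by omega)⟩
      · simp only [Mem.withCounters, hs, decide_false, Bool.false_eq_true, if_false]
        refine ⟨by simp [Mem.data, Mem.withCounters, hs, appendS, tick], spends_tick ?_⟩
        refine (hS _ (fun t => decide (t ∈ m.S)) t p ?_).words_le
        have h1 := hl.length_le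
        have h2 := List.length_filter_le (fun x => decide (x ∉ m.S)) l
        simp only [List.length_append, List.length_singleton] at h1 ⊢
        omega)
    (clearS m1) h3
  set m2 := forAll states (fun s m => if m.mark s then m else appendS s m) (clearS m1)
  obtain ⟨t', p', h5⟩ := Mem.exists_withCounters h4
  have hF2 : Fits N m2 := by
    rw [h5]
    exact hS _ _ _ _ ((List.length_filter_le _ _).trans hcard)
  obtain ⟨h6, h6'⟩ := setMark_false_spec (N := N) states (m := m2) hF2
  have h7 : complementS states m = forAll states (fun s m => setMark s false m) m2 := rfl
  rw [h7]
  constructor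
  · rw [h6, h5]
    simp only [Mem.data, Mem.withCounters]
    congr 1
    funext x
    simp [hmark, hmem]
  · rw [sum_map_const_add_one] at h1' h4'
    refine (((h1'.trans h3').trans h4').trans h6').mono ?_
    have := hF.S
    omega

theorem resetIntersections_spec {N : ℕ} {m : Mem σ} (hF : Fits N m) :
    (resetIntersections m).data = ({ m with heap := fun b =>
        if b ∈ m.P then { m.heap b with intersection := none } else m.heap b } : Mem σ).data ∧
      Spends (wordBound σ N) (2 * N + 1) m (resetIntersections m) := by
  have fits : ∀ (l : List ℕ) t p, Fits N (({ m with heap := fun b =>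
        if b ∈ l then { m.heap b with intersection := none } else m.heap b } :
        Mem σ).withCounters t p) := by
    intro l t p
    refine ⟨hF.blocks, fun b => ?_, hF.X, hF.S⟩
    have := hF.less b
    by_cases hb : b ∈ l <;> simpa [Mem.withCounters, hb] using this
  have upd : ∀ (l : List ℕ) a, Function.update (fun b =>
        if b ∈ l then { m.heap b with intersection := none } else m.heap b) a
        { (if a ∈ l then { m.heap a with intersection := none } else m.heap a) with
          intersection := none } = fun b =>
        if b ∈ l ++ [a] then { m.heap b with intersection := none } else m.heap b := by
    intro l a
    funext b
    by_cases hb : b = a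
    · subst hb; by_cases hbl : b ∈ l <;> simp [hbl]
    · simp [hb]
  have := forAll_exact (W := wordBound σ N) m.P
    (body := fun b m => setIntersection b none m)
    (fun l => { m with heap := fun b =>
        if b ∈ l then { m.heap b with intersection := none } else m.heap b }) (fun _ => 1)
    (fun l _ => (fits l m.time m.peak).words_le)
    (by
      intro l a t p _
      refine ⟨?_, spends_tick ?_⟩
      · simp only [setIntersection, assign, tick, Mem.data, Mem.withCounters]
        rw [upd]
      · have := (fits (l ++ [a]) t p).words_le
        rw [← upd] at this
        exact this)
    m (by simp [Mem.data, Mem.withCounters])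
  rw [sum_map_const_add_one] at this
  have hb := hF.blocks
  exact ⟨this.1, this.2.mono (by omega)⟩

end SimAlg

namespace SimAlg

variable {σ : Type u} [Fintype σ] [DecidableEq σ]

theorem spends_assign {N : ℕ} {m : Mem σ} {b : ℕ} {f : Block σ → Block σ} (hF : Fits N m)
    (hf : (f (m.heap b)).less.length ≤ N) :
    Fits N (assign b f m) ∧ Spends (wordBound σ N) 1 m (assign b f m) := by
  have : Fits N ({ m with heap := Function.update m.heap b (f (m.heap b)) } : Mem σ) := by
    refine ⟨hF.blocks, fun c => ?_, hF.X, hF.S⟩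
    by_cases hc : c = b
    · subst hc; simpa using hf
    · simpa [hc] using hF.less c
  exact ⟨this.congr rfl rfl rfl rfl, spends_tick this.words_le⟩

/-! ### The procedure `orderUpdate` -/

/-- The part of the block `c` that has been split off, if it is not the whole block. -/
def splitOff (h : ℕ → Block σ) (c : ℕ) : Option ℕ :=
  match (h c).intersection with
  | none => none
  | some d => if d = c then none else some d

omit [DecidableEq σ] [Fintype σ] in
theorem splitOff_eq_some {h : ℕ → Block σ} {c d : ℕ} :
    splitOff h c = some d ↔ (h c).intersection = some d ∧ d ≠ c := by
  unfold splitOff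
  cases (h c).intersection with
  | none => simp
  | some e =>
    by_cases he : e = c
    · simp only [he, if_true, Option.some.injEq, reduceCtorEq, false_iff]
      rintro ⟨rfl, h⟩; exact h rfl
    · simp only [he, if_false, Option.some.injEq]
      exact ⟨fun h => ⟨h, h ▸ he⟩, fun h => h.1⟩

/-- The effect of `orderUpdate` on the block `b`. -/
def updatedBlock (h : ℕ → Block σ) (b : ℕ) : Block σ :=
  if (h b).intersection ≠ some b then
    { h b with less := (h b).less ++ (h b).less.filterMap (splitOff h) }
  else
    { h b with
      less := (h b).less.filter (fun c => (h c).intersection = some c) ++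
        (h b).less.filterMap (splitOff h)
      changedImage := (h b).changedImage || (h b).less.any fun c => (h c).intersection ≠ some c }

omit [DecidableEq σ] [Fintype σ] in
theorem splitOff_congr {h h' : ℕ → Block σ}
    (hi : ∀ c, (h' c).intersection = (h c).intersection) : splitOff h' = splitOff h := by
  funext c
  unfold splitOff
  rw [hi]

-- The update of a block reads only the `intersection` fields of the other blocks, which
-- `orderUpdate` never writes. Hence all the new lists can be computed from the memory on entry,
-- whatever the order of the blocks.
omit [DecidableEq σ] [Fintype σ] in
theorem updatedBlock_congr {h h' : ℕ → Block σ} {b : ℕ} (hb : h' b = h b)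
    (hi : ∀ c, (h' c).intersection = (h c).intersection) :
    updatedBlock h' b = updatedBlock h b := by
  unfold updatedBlock
  simp only [hb, hi, splitOff_congr hi]

omit [DecidableEq σ] [Fintype σ] in
theorem updatedBlock_intersection (h : ℕ → Block σ) (b : ℕ) :
    (updatedBlock h b).intersection = (h b).intersection := by
  unfold updatedBlock; split_ifs <;> rfl

omit [DecidableEq σ] [Fintype σ] in
theorem updatedBlock_members (h : ℕ → Block σ) (b : ℕ) :
    (updatedBlock h b).members = (h b).members := by
  unfold updatedBlock; split_ifs <;> rfl

omit [DecidableEq σ] [Fintype σ] in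
theorem length_updatedBlock_less (h : ℕ → Block σ) (b : ℕ) :
    (updatedBlock h b).less.length ≤ 2 * (h b).less.length := by
  have h1 := List.length_filterMap_le (splitOff h) (h b).less
  have h2 := List.length_filter_le (fun c => decide ((h c).intersection = some c)) (h b).less
  unfold updatedBlock
  split_ifs <;> simp only [List.length_append] <;> omega

-- A block can occur in its own list `less`, so the inner loops may read the record that they are
-- rewriting; the field they read stays the same.
omit [DecidableEq σ] [Fintype σ] in
theorem intersection_update {h : ℕ → Block σ} {b : ℕ} {r : Block σ}
    (hr : r.intersection = (h b).intersection) (c : ℕ) :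
    (Function.update h b r c).intersection = (h c).intersection := by
  by_cases hc : c = b
  · subst hc; simpa using hr
  · simp [hc]

/-- The list that is traversed is also edited. For a block inside `S`, after the prefix `l` it
consists of the kept items of `l`, the items not yet visited, and the parts split off from items of
`l`. A round costs at most four units with its test, whence `4 |L| + 1 ≤ 2 N + 1`. -/
theorem orderUpdate_body_spec {N : ℕ} {m : Mem σ} (b : ℕ) (hF : Fits N m)
    (hN : 2 * (m.heap b).less.length ≤ N) (hnd : (m.heap b).less.Nodup) :
    let f : Mem σ → Mem σ := fun m =>
      if (m.heap b).intersection ≠ some b then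
        forAll (m.heap b).less (fun c m =>
          match (m.heap c).intersection with
          | none => m
          | some d => if d = c then m else appendLess b d m) m
      else
        forAll (m.heap b).less (fun c m =>
          if (m.heap c).intersection = some c then m
          else
            let m := removeLess b c m
            let m := match (m.heap c).intersection with
              | none => m
              | some d => appendLess b d m
            setChangedImage b true m) m
    (f m).data = ({ m with heap := Function.update m.heap b (updatedBlock m.heap b) } : Mem σ).data ∧
      Spends (wordBound σ N) (2 * N + 1) m (f m) := by
  intro f
  set L := (m.heap b).less with hL
  have fits : ∀ (r : Block σ) t p, r.less.length ≤ N →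
      Fits N (({ m with heap := Function.update m.heap b r } : Mem σ).withCounters t p) := by
    intro r t p hr
    refine ⟨hF.blocks, fun c => ?_, hF.X, hF.S⟩
    by_cases hc : c = b
    · subst hc; simpa [Mem.withCounters] using hr
    · simpa [Mem.withCounters, hc] using hF.less c
  by_cases hb : (m.heap b).intersection ≠ some b
  · have hlen : ∀ l, l <+: L → (L ++ l.filterMap (splitOff m.heap)).length ≤ N := by
      intro l hl
      have h1 := List.length_filterMap_le (splitOff m.heap) l
      have h2 := hl.length_le
      rw [List.length_append]
      omega
    have := forAll_exact (W := wordBound σ N) L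
      (body := fun c m =>
        match (m.heap c).intersection with
        | none => m
        | some d => if d = c then m else appendLess b d m)
      (fun l => { m with
        heap := Function.update m.heap b
          { m.heap b with less := L ++ l.filterMap (splitOff m.heap) } })
      (fun _ => 1) (fun l hl => (fits _ m.time m.peak (hlen l hl)).words_le)
      (by
        intro l c t p hl
        have hi := intersection_update (h := m.heap) (b := b)
          (r := { m.heap b with less := L ++ l.filterMap (splitOff m.heap) }) rfl c
        have same : splitOff m.heap c = none → L ++ (l ++ [c]).filterMap (splitOff m.heap) =
            L ++ l.filterMap (splitOff m.heap) := by
          intro h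
          simp [h]
        simp only [Mem.withCounters, hi]
        rcases hc : (m.heap c).intersection with _ | d
        · have h' : splitOff m.heap c = none := by simp [splitOff, hc]
          rw [same h']
          exact ⟨rfl, (Spends.refl _ _).mono (by omega)⟩
        · by_cases hd : d = c
          · have h' : splitOff m.heap c = none := by simp [splitOff, hc, hd]
            rw [same h']
            simp only [hd, if_true]
            exact ⟨rfl, (Spends.refl _ _).mono (by omega)⟩
          · have h' : splitOff m.heap c = some d := by simp [splitOff, hc, hd]
            have hl1 := hlen _ hl
            have hl2 : (l ++ [c]).filterMap (splitOff m.heap) =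
                l.filterMap (splitOff m.heap) ++ [d] := by simp [h']
            rw [hl2] at hl1 ⊢
            simp only [hd, if_false]
            refine ⟨?_, (spends_assign (fits _ t p ?_) ?_).2⟩
            · simp [appendLess, assign, tick, Mem.data, Mem.withCounters]
            · simp only [List.length_append, List.length_singleton] at hl1 ⊢
              omega
            · simpa [Mem.withCounters, ← add_assoc] using hl1)
      m (by simp [Mem.data, Mem.withCounters, hL])
    rw [sum_map_const_add_one] at this
    have hf : f m = _ := if_pos hb
    rw [hf]
    refine ⟨this.1.trans ?_, this.2.mono (by omega)⟩
    rw [updatedBlock, if_pos hb]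
  · push Not at hb
    set keep : ℕ → Bool := fun c => (m.heap c).intersection = some c with hkeep
    have hlen : ∀ l, l <+: L → ((l.filter keep ++ L.drop l.length) ++
        l.filterMap (splitOff m.heap)).length ≤ N := by
      rintro l ⟨l', hl⟩
      have h1 := List.length_filterMap_le (splitOff m.heap) l
      have h2 := List.length_filter_le keep l
      rw [← hl] at hN
      simp only [← hl, List.drop_left, List.length_append] at hN ⊢
      omega
    have := forAll_exact (W := wordBound σ N) L
      (body := fun c m =>
          if (m.heap c).intersection = some c then m
          else
            let m := removeLess b c m
            let m := match (m.heap c).intersection with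
              | none => m
              | some d => appendLess b d m
            setChangedImage b true m)
      (fun l => { m with
        heap := Function.update m.heap b
          { m.heap b with
            less := (l.filter keep ++ L.drop l.length) ++ l.filterMap (splitOff m.heap)
            changedImage := (m.heap b).changedImage || l.any fun c => !keep c } })
      (fun _ => 3) (fun l hl => (fits _ m.time m.peak (hlen l hl)).words_le)
      (by
        intro l c t p hl
        have hl1 := hlen _ hl
        obtain ⟨l', hl'⟩ := hl
        have hd1 : L.drop l.length = c :: l' := by rw [← hl']; simp
        have hd2 : L.drop (l ++ [c]).length = l' := by rw [← hl']; simp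
        have hcl : c ∉ l := by
          intro h
          rw [← hl', List.append_assoc, List.nodup_append] at hnd
          exact hnd.2.2 c h c (by simp) rfl
        have hi := intersection_update (h := m.heap) (b := b)
          (r := { m.heap b with
            less := (l.filter keep ++ c :: l') ++ l.filterMap (splitOff m.heap)
            changedImage := (m.heap b).changedImage || l.any fun c => !keep c }) rfl c
        rw [hd2] at hl1 ⊢
        rw [hd1]
        by_cases hk : (m.heap c).intersection = some c
        · have h1 : splitOff m.heap c = none := by simp [splitOff, hk]
          have h2 : keep c = true := by simp [hkeep, hk]
          simp only [Mem.withCounters, hi, hk, if_true]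
          refine ⟨?_, (Spends.refl _ _).mono (by omega)⟩
          simp [Mem.data, Mem.withCounters, h1, h2]
        · have h2 : keep c = false := by simp [hkeep, hk]
          -- Since the original list has no repetitions, the first occurrence of `c` is the one
          -- being visited.
          have he : ((l.filter keep ++ c :: l') ++ l.filterMap (splitOff m.heap)).erase c =
              (l.filter keep ++ l') ++ l.filterMap (splitOff m.heap) := by
            rw [List.append_assoc, List.erase_append_right _ (by simp [hcl]), List.cons_append,
              List.erase_cons_head, List.append_assoc]
          simp only [Mem.withCounters, hi, hk, if_false]
          have hlen0 : ((l.filter keep ++ c :: l') ++ l.filterMap (splitOff m.heap)).length ≤ N := by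
            rw [← hd1]; exact hlen l ⟨c :: l', by rw [← hl']; simp⟩
          have hlen1 : ((l.filter keep ++ l') ++ l.filterMap (splitOff m.heap)).length ≤ N := by
            rw [← he]
            exact List.length_erase_le.trans hlen0
          have hF0 := fits { m.heap b with
            less := (l.filter keep ++ c :: l') ++ l.filterMap (splitOff m.heap)
            changedImage := (m.heap b).changedImage || l.any fun c => !keep c } t p hlen0
          have hs1 := spends_assign (b := b) (f := fun r => { r with less := r.less.erase c }) hF0
            (by simpa [Mem.withCounters] using (le_of_eq_of_le (congrArg _ he) hlen1))
          have hi2 := intersection_update (h := m.heap) (b := b)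
            (r := { m.heap b with
              less := (l.filter keep ++ l') ++ l.filterMap (splitOff m.heap)
              changedImage := (m.heap b).changedImage || l.any fun c => !keep c }) rfl c
          have hheap : Function.update (Function.update m.heap b { m.heap b with
              less := (l.filter keep ++ c :: l') ++ l.filterMap (splitOff m.heap)
              changedImage := (m.heap b).changedImage || l.any fun c => !keep c }) b
              { m.heap b with
              less := ((l.filter keep ++ c :: l') ++ l.filterMap (splitOff m.heap)).erase c
              changedImage := (m.heap b).changedImage || l.any fun c => !keep c } =
              Function.update m.heap b { m.heap b with
              less := (l.filter keep ++ l') ++ l.filterMap (splitOff m.heap)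
              changedImage := (m.heap b).changedImage || l.any fun c => !keep c } := by
            rw [he]; simp
          simp only [removeLess, assign, tick, Function.update_self, hheap, hi2,
            Mem.withCounters] at hs1 ⊢
          rcases hc : (m.heap c).intersection with _ | d
          · have h1 : splitOff m.heap c = none := by simp [splitOff, hc]
            simp only
            refine ⟨?_, (hs1.2.trans (spends_assign hs1.1 ?_).2).mono (by omega)⟩
            · simp [setChangedImage, assign, tick, Mem.data, Mem.withCounters, h1, h2]
            · simpa using hlen1
          · have hd : d ≠ c := by rintro rfl; exact hk hc
            have h1 : splitOff m.heap c = some d := by simp [splitOff, hc, hd]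
            have hs2 := spends_assign (b := b) (f := fun r => { r with less := r.less ++ [d] }) hs1.1
              (by simpa [h1, h2, ← add_assoc] using hl1)
            simp only
            refine ⟨?_, ((hs1.2.trans hs2.2).trans (spends_assign hs2.1 ?_).2).mono (by omega)⟩
            · simp [setChangedImage, appendLess, assign, tick, Mem.data, Mem.withCounters, h1, h2]
            · simpa [assign, tick, h1, h2, ← add_assoc] using hl1)
      m (by simp [Mem.data, Mem.withCounters, hL])
    rw [sum_map_const_add_one] at this
    have hf : f m = _ := if_neg (not_not.2 hb)
    rw [hf]
    refine ⟨this.1.trans ?_, this.2.mono (by omega)⟩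
    rw [updatedBlock, if_neg (not_not.2 hb)]
    have : (fun c => !keep c) = fun c => decide ((m.heap c).intersection ≠ some c) := by
      funext c; simp [hkeep]
    rw [this, List.drop_length, List.append_nil]

theorem orderUpdate_spec {N : ℕ} {m : Mem σ} (hF : Fits N m) (hP : m.P.Nodup)
    (hN : ∀ b, 2 * (m.heap b).less.length ≤ N) (hnd : ∀ b ∈ m.P, (m.heap b).less.Nodup) :
    (orderUpdate m).data = ({ m with
        heap := fun b => if b ∈ m.P then updatedBlock m.heap b else m.heap b } : Mem σ).data ∧
      Fits N (orderUpdate m) ∧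
      Spends (wordBound σ N) (N * (2 * N + 2) + 1) m (orderUpdate m) := by
  have fits : ∀ (l : List ℕ) t p, Fits N (({ m with heap := fun b => if b ∈ l then updatedBlock m.heap b else m.heap b } : Mem σ).withCounters t p) := by
    intro l t p
    refine ⟨hF.blocks, fun b => ?_, hF.X, hF.S⟩
    by_cases hb : b ∈ l
    · simpa [Mem.withCounters, hb] using (length_updatedBlock_less m.heap b).trans (hN b)
    · simpa [Mem.withCounters, hb] using hF.less b
  have := forAll_exact (W := wordBound σ N) m.P
    (body := fun b m =>
      if (m.heap b).intersection ≠ some b then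
        forAll (m.heap b).less (fun c m =>
          match (m.heap c).intersection with
          | none => m
          | some d => if d = c then m else appendLess b d m) m
      else
        forAll (m.heap b).less (fun c m =>
          if (m.heap c).intersection = some c then m
          else
            let m := removeLess b c m
            let m := match (m.heap c).intersection with
              | none => m
              | some d => appendLess b d m
            setChangedImage b true m) m)
    (fun l => { m with heap := fun b => if b ∈ l then updatedBlock m.heap b else m.heap b })
    (fun _ => 2 * N + 1)
    (fun l _ => (fits l m.time m.peak).words_le)
    (by
      intro l b t p hl
      have hbP : b ∈ m.P := hl.subset (by simp)
      have hbl : b ∉ l := by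
        intro h
        have := hl.sublist.nodup hP
        rw [List.nodup_append] at this
        exact this.2.2 b h b (by simp) rfl
      have hb' : (if b ∈ l then updatedBlock m.heap b else m.heap b) = m.heap b := if_neg hbl
      have := orderUpdate_body_spec b (fits l t p)
        (by simpa [Mem.withCounters, hb'] using hN b)
        (by simpa [Mem.withCounters, hb'] using hnd b hbP)
      refine ⟨this.1.trans ?_, this.2⟩
      simp only [Mem.data, Mem.withCounters]
      congr 1
      rw [updatedBlock_congr (h := m.heap) hb' (fun c => by
        by_cases hc : c ∈ l <;> simp [hc, updatedBlock_intersection])]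
      funext c
      by_cases hc : c = b
      · subst hc; simp
      · simp [hc])
    m (by simp [Mem.data, Mem.withCounters])
  rw [sum_map_const_add_one] at this
  refine ⟨this.1, ?_, this.2.mono ?_⟩
  · obtain ⟨t, p, h⟩ := Mem.exists_withCounters this.1
    have h' : orderUpdate m = _ := h
    rw [h']
    exact fits _ _ _
  · have := Nat.mul_le_mul_right (2 * N + 2) hF.blocks
    simpa [add_assoc] using this

/-! ### The procedure `resetAndMove` -/

/-- The new `pending` is left unspecified up to a permutation: correctness depends only on which
blocks remain scanned, and termination only on how many are pending. -/
theorem resetAndMove_spec {N : ℕ} {m : Mem σ} (hF : Fits N m) (hP : m.P.Nodup) :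
    ∃ pending : List ℕ,
      (resetAndMove m).data = ({ m with
        heap := fun b => if b ∈ m.P then
          { m.heap b with intersection := none, changedImage := false } else m.heap b
        scanned := m.scanned.filter fun b => !(m.heap b).changedImage
        pending := pending } : Mem σ).data ∧
      ((m.scanned.filter fun b => !(m.heap b).changedImage) ++ pending).Perm m.P ∧
      Spends (wordBound σ N) (4 * N + 1) m (resetAndMove m) := by
  set ch : ℕ → Bool := fun b => (m.heap b).changedImage with hch
  set reset : Block σ → Block σ := fun r => { r with intersection := none, changedImage := false }
    with hreset
  -- After the prefix `l` of the old `P`, the flagged blocks of `l` have left both lists and stand,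
  -- in the order of `l`, at the end of `pending`.
  set sc : List ℕ → List ℕ := fun l => m.scanned.filter fun c => !(decide (c ∈ l) && ch c) with hsc
  set pe : List ℕ → List ℕ := fun l =>
    (m.pending.filter fun c => !(decide (c ∈ l) && ch c)) ++ l.filter ch with hpe
  have hPs : m.scanned.Nodup ∧ m.pending.Nodup := by
    rw [Mem.P, List.nodup_append] at hP
    exact ⟨hP.1, hP.2.1⟩
  have hfilt : ∀ (l L : List ℕ) a, L.Nodup → ch a = true →
      (L.filter fun c => !(decide (c ∈ l) && ch c)).erase a =
        L.filter fun c => !(decide (c ∈ l ++ [a]) && ch c) := by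
    intro l L a hL ha
    rw [(hL.filter _).erase_eq_filter, List.filter_filter]
    congr 1
    funext c
    by_cases hc : c = a
    · subst hc; simp [ha]
    · simp [hc]
  have hfilt' : ∀ (l L : List ℕ) a, ch a = false →
      (L.filter fun c => !(decide (c ∈ l) && ch c)) =
        L.filter fun c => !(decide (c ∈ l ++ [a]) && ch c) := by
    intro l L a ha
    congr 1
    funext c
    by_cases hc : c = a
    · subst hc; simp [ha]
    · simp [hc]
  have hperm : ∀ l, l <+: m.P → (sc l ++ pe l).Perm m.P := by
    intro l hl
    obtain ⟨l', hl'⟩ := hl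
    have h1 : sc l ++ pe l = (m.P.filter fun c => !(decide (c ∈ l) && ch c)) ++ l.filter ch := by
      simp only [hsc, hpe, Mem.P, List.filter_append, List.append_assoc]
    have h2 : l.filter ch = m.P.filter fun c => decide (c ∈ l) && ch c := by
      rw [← hl', List.filter_append]
      rw [← hl', List.nodup_append] at hP
      have : (l'.filter fun c => decide (c ∈ l) && ch c) = [] := by
        rw [List.filter_eq_nil_iff]
        intro a ha
        have : a ∉ l := fun h => hP.2.2 a h a ha rfl
        simp [this]
      rw [this, List.append_nil]
      apply List.filter_congr
      intro x hx
      simp [hx]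
    rw [h1, h2]
    exact List.perm_append_comm.trans (List.filter_append_perm _ _)
  have fits : ∀ (l : List ℕ) (s p : List ℕ) t q, (s ++ p).length ≤ N →
      Fits N (({ m with
        heap := fun b => if b ∈ l then reset (m.heap b) else m.heap b
        scanned := s, pending := p } : Mem σ).withCounters t q) := by
    intro l s p t q hsp
    refine ⟨hsp, fun b => ?_, hF.X, hF.S⟩
    have := hF.less b
    by_cases hb : b ∈ l <;> simpa [Mem.withCounters, hb, hreset] using this
  have := forAll_exact (W := wordBound σ N) m.P
    (body := fun b m =>
      let m := setIntersection b none m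
      if (m.heap b).changedImage then
        let m := setChangedImage b false m
        tick { m with scanned := m.scanned.erase b, pending := m.pending.erase b ++ [b] }
      else m)
    (fun l => { m with
        heap := fun b => if b ∈ l then reset (m.heap b) else m.heap b
        scanned := sc l, pending := pe l })
    (fun _ => 3)
    (fun l hl => (fits l _ _ m.time m.peak ((hperm l hl).length_eq.trans_le hF.blocks)).words_le)
    (by
      intro l b t p hl
      have hl0 : l <+: m.P := (List.prefix_append _ _).trans hl
      have hbl : b ∉ l := by
        intro h
        have := hl.sublist.nodup hP
        rw [List.nodup_append] at this
        exact this.2.2 b h b (by simp) rfl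
      have hlen := (hperm l hl0).length_eq.trans_le hF.blocks
      have hs1 := spends_assign (b := b) (f := fun r => { r with intersection := none })
        (fits l _ _ t p hlen) ((fits l _ _ t p hlen).less b)
      have hb' : (if b ∈ l then reset (m.heap b) else m.heap b) = m.heap b := if_neg hbl
      by_cases hb : ch b = true
      · have hs2 := spends_assign (b := b) (f := fun r => { r with changedImage := false })
          hs1.1 (hs1.1.less b)
        have hs3 : (sc l).erase b = sc (l ++ [b]) := hfilt _ _ _ hPs.1 hb
        have hs4 : (pe l).erase b ++ [b] = pe (l ++ [b]) := by
          have hbf : b ∉ l.filter ch := by simp [hbl]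
          have : (pe l).erase b = (m.pending.filter fun c => !(decide (c ∈ l) && ch c)).erase b ++
              l.filter ch := by
            simp only [hpe]
            rw [List.erase_append]
            split_ifs with h
            · rfl
            · rw [List.erase_of_not_mem hbf, List.erase_of_not_mem h]
          rw [this, hfilt _ _ _ hPs.2 hb]
          simp [hpe, hb]
        have hs5 := fun (m' : Mem σ) h => spends_tick (W := wordBound σ N) (m := m') (m' := { m' with
          scanned := m'.scanned.erase b, pending := m'.pending.erase b ++ [b] }) h
        have hs6 := hs5 (setChangedImage b false (setIntersection b none (({ m with
          heap := fun b => if b ∈ l then reset (m.heap b) else m.heap b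
          scanned := sc l, pending := pe l } : Mem σ).withCounters t p))) (by
          refine Fits.words_le (N := N) ⟨?_, hs2.1.less, hF.X, hF.S⟩
          change ((sc l).erase b ++ ((pe l).erase b ++ [b])).length ≤ N
          rw [hs3, hs4]
          exact (hperm _ hl).length_eq.trans_le hF.blocks)
        have hheap : Function.update (Function.update
            (fun c => if c ∈ l then reset (m.heap c) else m.heap c) b
            { m.heap b with intersection := none }) b (reset (m.heap b)) =
            fun c => if c ∈ l ++ [b] then reset (m.heap c) else m.heap c := by
          funext c
          by_cases hc : c = b
          · subst hc; simp
          · simp [hc]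
        have hb2 : (m.heap b).changedImage = true := hb
        simp only [setIntersection, setChangedImage, assign, tick, Mem.withCounters, hb',
          Function.update_self, hb2, if_true] at hs1 hs2 hs6 ⊢
        have hs7 := (hs1.2.trans hs2.2).trans hs6
        refine ⟨?_, hs7⟩
        simp only [Mem.data, Mem.withCounters, hs3, hs4]
        congr 1
        rw [← hheap]
        simp [hreset, hb2]
      · have hb1 : ch b = false := by simpa using hb
        have hb2 : (m.heap b).changedImage = false := hb1
        have hheap : Function.update
            (fun c => if c ∈ l then reset (m.heap c) else m.heap c) b
            (reset (m.heap b)) =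
            fun c => if c ∈ l ++ [b] then reset (m.heap c) else m.heap c := by
          funext c
          by_cases hc : c = b
          · subst hc; simp
          · simp [hc]
        have hs3 : sc l = sc (l ++ [b]) := hfilt' _ _ _ hb1
        have hs4 : pe l = pe (l ++ [b]) := by
          simp only [hpe]
          rw [hfilt' l m.pending b hb1]
          simp [hb1]
        simp only [setIntersection, assign, tick, Mem.withCounters, hb',
          Function.update_self, hb2, Bool.false_eq_true, if_false] at hs1 ⊢
        refine ⟨?_, hs1.2.mono (by omega)⟩
        simp only [Mem.data, Mem.withCounters, ← hs3, ← hs4]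
        congr 1)
    m (by simp [Mem.data, Mem.withCounters, hsc, hpe])
  rw [sum_map_const_add_one] at this
  have hscP : sc m.P = m.scanned.filter fun b => !(m.heap b).changedImage := by
    apply List.filter_congr
    intro x hx
    have : x ∈ m.P := List.mem_append_left _ hx
    simp [this, hch]
  refine ⟨pe m.P, this.1.trans ?_, ?_, this.2.mono ?_⟩
  · simp only [hscP, hreset]
  · rw [← hscP]
    exact hperm _ List.prefix_rfl
  · have := hF.blocks
    omega

end SimAlg

namespace SimAlg

variable {σ : Type u} [Fintype σ] [DecidableEq σ]

/-! ### The elementary steps of `split` -/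

theorem newIntersection_spec {N : ℕ} {m : Mem σ} {b : ℕ} (hF : Fits N m) (hP : m.P.length + 1 ≤ N)
    (hb : b ≠ m.fresh) :
    (newIntersection b m).data = ({ m with
      heap := Function.update (Function.update m.heap b
        { m.heap b with intersection := some m.fresh }) m.fresh
        { less := (m.heap b).less, intersection := some m.fresh }
      fresh := m.fresh + 1
      pending := m.pending ++ [m.fresh] } : Mem σ).data ∧
    Spends (wordBound σ N) (2 * N + 6) m (newIntersection b m) := by
  set d := m.fresh with hd
  set m1 : Mem σ := tick { m with fresh := d + 1, heap := Function.update m.heap d {} } with hm1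
  have hF1 : Fits N ({ m with fresh := d + 1, heap := Function.update m.heap d {} } : Mem σ) := by
    refine ⟨hF.blocks, fun c => ?_, hF.X, hF.S⟩
    by_cases hc : c = d
    · subst hc; simp
    · simpa [hc] using hF.less c
  have hs1 : Spends (wordBound σ N) 1 m m1 := spends_tick hF1.words_le
  have hF1' : Fits N m1 := hF1.congr rfl rfl rfl rfl
  have hs2 := spends_assign (b := b) (f := fun r => { r with intersection := some d }) hF1'
    (hF1'.less b)
  set m2 := assign b (fun r => { r with intersection := some d }) m1 with hm2
  set m3 : Mem σ := tick { m2 with pending := m2.pending ++ [d] } with hm3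
  have hF3 : Fits N ({ m2 with pending := m2.pending ++ [d] } : Mem σ) := by
    refine ⟨?_, hs2.1.less, hs2.1.X, hs2.1.S⟩
    have h : (m2.scanned ++ (m2.pending ++ [d])).length = m.P.length + 1 := by
      simp [hm2, hm1, assign, tick, Mem.P, add_assoc]
    exact h.trans_le hP
  have hs3 : Spends (wordBound σ N) 1 m2 m3 := spends_tick hF3.words_le
  have hF3' : Fits N m3 := hF3.congr rfl rfl rfl rfl
  have hs4 := spends_assign (b := d) (f := fun r => { r with intersection := some d }) hF3'
    (hF3'.less d)
  set m4 := assign d (fun r => { r with intersection := some d }) m3 with hm4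
  have hdb : d ≠ b := hb.symm
  have hless : (m4.heap b).less = (m.heap b).less := by
    simp [hm4, hm3, hm2, hm1, assign, tick, hb]
  have hless' : (m4.heap d).less = [] := by
    simp [hm4, hm3, hm2, hm1, assign, tick, hdb]
  have hlen : ∀ l, l <+: (m4.heap b).less → l.length ≤ N := fun l hl =>
    hl.length_le.trans (hs4.1.less b)
  have fits : ∀ (l : List ℕ) t p, l.length ≤ N → Fits N (({ m4 with
      heap := Function.update m4.heap d { m4.heap d with less := l } } : Mem σ).withCounters t p) := by
    intro l t p hl
    refine ⟨hs4.1.blocks, fun c => ?_, hs4.1.X, hs4.1.S⟩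
    by_cases hc : c = d
    · subst hc; simpa [Mem.withCounters] using hl
    · simpa [Mem.withCounters, hc] using hs4.1.less c
  have hs5 := forAll_exact (W := wordBound σ N) (m4.heap b).less (body := fun c m => appendLess d c m)
    (fun l => { m4 with heap := Function.update m4.heap d { m4.heap d with less := l } })
    (fun _ => 1) (fun l hl => (fits l m4.time m4.peak (hlen l hl)).words_le)
    (by
      intro l c t p hl
      refine ⟨?_, (spends_assign (fits l t p (hlen l ((List.prefix_append _ _).trans hl))) ?_).2⟩
      · simp [appendLess, assign, tick, Mem.data, Mem.withCounters]
      · have := hlen _ hl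
        simpa [Mem.withCounters] using this)
    m4 (by
      simp only [Mem.data, Mem.withCounters]
      congr 1
      rw [← hless']
      simp)
  rw [sum_map_const_add_one] at hs5
  set m5 := forAll (m4.heap b).less (fun c m => appendLess d c m) m4
  obtain ⟨t, p, hm5⟩ := Mem.exists_withCounters hs5.1
  have hF5 : Fits N m5 := by rw [hm5]; exact fits _ _ _ (hs4.1.less b)
  have hs6 := spends_assign (b := d) (f := fun r => { r with changedImage := false }) hF5 (hF5.less d)
  have h0 : newIntersection b m = assign d (fun r => { r with changedImage := false }) m5 := rfl
  rw [h0]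
  constructor
  · rw [hm5]
    simp only [Mem.data, Mem.withCounters, assign, tick, hless, Function.update_self]
    simp [hm4, hm3, hm2, hm1, assign, tick, hb, hdb]
    funext c
    by_cases hc : c = d
    · subst hc; simp
    · simp only [Function.update_of_ne hc]
      by_cases hc' : c = b
      · subst hc'; simp
      · simp [hc, hc']
  · refine (((((hs1.trans hs2.2).trans hs3).trans hs4.2).trans hs5.2).trans hs6.2).mono ?_
    have := hs4.1.less b
    omega

theorem move_spec {N : ℕ} {m : Mem σ} (s : σ) {b d : ℕ} (hF : Fits N m) (hbd : b ≠ d) :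
    (move s b d m).data = ({ m with
      heap := Function.update (Function.update m.heap b
        { m.heap b with members := (m.heap b).members.erase s }) d
        { m.heap d with members := (m.heap d).members ++ [s] }
      block := Function.update m.block s d } : Mem σ).data ∧
    Spends (wordBound σ N) 3 m (move s b d m) := by
  have hs1 := spends_assign (b := b) (f := fun r => { r with members := r.members.erase s }) hF
    (hF.less b)
  have hs2 := spends_assign (b := d) (f := fun r => { r with members := r.members ++ [s] }) hs1.1
    (hs1.1.less d)
  refine ⟨?_, (hs1.2.trans hs2.2).trans (spends_tick (hs2.1.congr rfl rfl rfl rfl).words_le)⟩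
  simp only [move, setBlock, assign, tick, Mem.data, Mem.withCounters,
    Function.update_of_ne hbd.symm]

theorem takeBack_spec {N : ℕ} {m : Mem σ} {b d : ℕ} (hF : Fits N m) (hbd : b ≠ d) :
    (takeBack b d m).data = ({ m with
      heap := Function.update (Function.update m.heap d {}) b
        { m.heap b with members := (m.heap d).members, intersection := some b }
      block := fun s => if s ∈ (m.heap d).members then b else m.block s
      scanned := m.scanned.erase d
      pending := m.pending.erase d } : Mem σ).data ∧
    Spends (wordBound σ N) (2 * (m.heap d).members.length + 5) m (takeBack b d m) := by
  have hs1 := spends_assign (b := b) (f := fun r => { r with members := (m.heap d).members }) hF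
    (hF.less b)
  set m1 := assign b (fun r => { r with members := (m.heap d).members }) m with hm1
  have hmem : (m1.heap b).members = (m.heap d).members := by simp [hm1, assign, tick]
  have hs2 := forAll_exact (W := wordBound σ N) (m1.heap b).members
    (body := fun s m => setBlock s b m)
    (fun l => { m1 with block := fun s => if s ∈ l then b else m1.block s }) (fun _ => 1)
    (fun l _ => (hs1.1.congr rfl rfl rfl rfl).words_le)
    (by
      intro l s t p _
      refine ⟨?_, spends_tick (hs1.1.congr rfl rfl rfl rfl).words_le⟩
      simp only [setBlock, tick, Mem.data, Mem.withCounters]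
      congr 1
      funext x
      by_cases hx : x = s
      · subst hx; simp
      · simp [hx])
    m1 (by simp [Mem.data, Mem.withCounters])
  rw [sum_map_const_add_one] at hs2
  set m2 := forAll (m1.heap b).members (fun s m => setBlock s b m) m1
  obtain ⟨t, p, hm2⟩ := Mem.exists_withCounters hs2.1
  have hF2 : Fits N m2 := by rw [hm2]; exact hs1.1.congr rfl rfl rfl rfl
  set m3 : Mem σ := tick { m2 with scanned := m2.scanned.erase d, pending := m2.pending.erase d }
    with hm3
  have hF3 : Fits N ({ m2 with
      scanned := m2.scanned.erase d, pending := m2.pending.erase d } : Mem σ) := by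
    refine ⟨?_, hF2.less, hF2.X, hF2.S⟩
    refine le_trans ?_ hF2.blocks
    simp only [Mem.P, List.length_append]
    exact add_le_add List.length_erase_le List.length_erase_le
  have hs3 : Spends (wordBound σ N) 1 m2 m3 := spends_tick hF3.words_le
  have hs4 := spends_assign (m := m3) (b := d) (f := fun _ => {}) (hF3.congr rfl rfl rfl rfl)
    (by simp)
  have hs5 := spends_assign (b := b) (f := fun r => { r with intersection := some b }) hs4.1
    (hs4.1.less b)
  have h0 : takeBack b d m = assign b (fun r => { r with intersection := some b })
    (assign d (fun _ => {}) m3) := rfl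
  rw [h0]
  constructor
  · rw [hm3, hm2, hmem]
    simp [hm1, Mem.data, Mem.withCounters, assign, tick, hbd]
    funext c
    by_cases hc : c = b
    · subst hc; simp
    · by_cases hc' : c = d
      · subst hc'; simp [hc]
      · simp [hc, hc']
  · rw [hmem] at hs2
    exact ((((hs1.2.trans hs2.2).trans hs3).trans hs4.2).trans hs5.2).mono (by omega)

/-! ### The invariant of the data structure -/

/-- The memory stores the partition and the preorder `≤` of blocks that are induced by a preorder
`r` on the states. -/
structure Rep (m : Mem σ) (r : σ → σ → Prop) : Prop where
  nodup : m.P.Nodup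
  lt_fresh : ∀ b ∈ m.P, b < m.fresh
  block_mem : ∀ s, m.block s ∈ m.P
  nonempty : ∀ b ∈ m.P, ∃ s, m.block s = b
  members : ∀ b ∈ m.P, (∀ s, s ∈ (m.heap b).members ↔ m.block s = b) ∧ (m.heap b).members.Nodup
  block_eq_iff : ∀ s t, m.block s = m.block t ↔ r s t ∧ r t s
  less_nodup : ∀ b ∈ m.P, (m.heap b).less.Nodup
  mem_less : ∀ s c, c ∈ (m.heap (m.block s)).less ↔ ∃ t, m.block t = c ∧ r s t
  garbage : ∀ b ∉ m.P, m.heap b = {}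
  mark : ∀ s, m.mark s = false

/-- All the fields `intersection` are null. -/
def Unsplit (m : Mem σ) : Prop := ∀ b, (m.heap b).intersection = none

namespace Rep

variable {m : Mem σ} {r : σ → σ → Prop}

theorem of_data {m' : Mem σ} (h : Rep m r) (hm : m'.data = m.data) : Rep m' r := by
  obtain ⟨t, p, rfl⟩ := Mem.exists_withCounters hm
  exact ⟨h.1, h.2, h.3, h.4, h.5, h.6, h.7, h.8, h.9, h.10⟩

theorem less_subset (h : Rep m r) {b : ℕ} (hb : b ∈ m.P) : (m.heap b).less ⊆ m.P := by
  intro c hc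
  obtain ⟨s, rfl⟩ := h.nonempty b hb
  obtain ⟨t, rfl, _⟩ := (h.mem_less s c).1 hc
  exact h.block_mem t

/-- `Fits` asks for this bound at every address, also outside `P`; there the record is empty by
`garbage`. -/
theorem length_less_le (h : Rep m r) (b : ℕ) : (m.heap b).less.length ≤ m.P.length := by
  by_cases hb : b ∈ m.P
  · exact ((h.less_nodup b hb).subperm (h.less_subset hb)).length_le
  · simp [h.garbage b hb]

/-- Blocks are disjoint because each state points to one block. Consequently the concatenated
members of distinct blocks number at most `|Σ|`. -/
theorem nodup_flatMap (h : Rep m r) {l : List ℕ} (hl : l.Nodup) (hP : l ⊆ m.P) :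
    (l.flatMap fun c => (m.heap c).members).Nodup := by
  rw [List.nodup_flatMap]
  refine ⟨fun c hc => (h.members c (hP hc)).2, ?_⟩
  refine List.Pairwise.imp_of_mem ?_ hl
  intro a b ha hb hab s hsa hsb
  exact hab ((((h.members a (hP ha)).1 s).1 hsa).symm.trans (((h.members b (hP hb)).1 s).1 hsb))

theorem length_P_pos [Nonempty σ] (h : Rep m r) : 1 ≤ m.P.length :=
  List.length_pos_of_mem (h.block_mem (Classical.arbitrary σ))

end Rep

/-! ### The invariant of `split` -/

/-- The memory `m` has been obtained from `m0` by splitting with respect to the set `T`; the list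
`ds` consists of the new blocks.  The blocks in `E` need not contain a state of `T` yet, and the
blocks in `F` need not contain a state outside `T` any more. -/
structure SplitInv (m0 : Mem σ) (T : Set σ) (E F : Set ℕ) (ds : List ℕ) (m : Mem σ) : Prop where
  scanned : m.scanned = m0.scanned
  pending : m.pending = m0.pending ++ ds
  ds_nodup : ds.Nodup
  ds_fresh : ∀ d ∈ ds, m0.fresh ≤ d ∧ d < m.fresh
  fresh_le : m0.fresh ≤ m.fresh
  block_in : ∀ s ∈ T, (m.heap (m0.block s)).intersection = some (m.block s)
  block_out : ∀ s ∉ T, m.block s = m0.block s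
  touched : ∀ b ∈ m0.P, b ∉ E → (m.heap b).intersection ≠ none → ∃ s ∈ T, m0.block s = b
  whole : ∀ b ∈ m0.P, (m.heap b).intersection = some b → ∀ s, m0.block s = b → s ∈ T
  part : ∀ b ∈ m0.P, ∀ d, (m.heap b).intersection = some d → d ≠ b →
    d ∈ ds ∧ (m.heap d).less = (m0.heap b).less ∧ (b ∉ F → ∃ s ∉ T, m0.block s = b)
  new : ∀ d ∈ ds, (m.heap d).intersection = some d ∧ (m.heap d).changedImage = false ∧
    ∃ b ∈ m0.P, (m.heap b).intersection = some d
  inj : ∀ b ∈ m0.P, ∀ b' ∈ m0.P, ∀ d, (m.heap b).intersection = some d →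
    (m.heap b').intersection = some d → b = b'
  old : ∀ b ∈ m0.P, (m.heap b).less = (m0.heap b).less ∧
    (m.heap b).changedImage = (m0.heap b).changedImage
  members : ∀ b ∈ m.P, (∀ s, s ∈ (m.heap b).members ↔ m.block s = b) ∧ (m.heap b).members.Nodup
  garbage : ∀ b ∉ m.P, m.heap b = {}
  S : m.S = m0.S
  X : m.X = m0.X
  mark : m.mark = m0.mark

namespace SplitInv

variable {m0 m : Mem σ} {r : σ → σ → Prop} {T : Set σ} {E F : Set ℕ} {ds : List ℕ}

theorem of_data {m' : Mem σ} (h : SplitInv m0 T E F ds m) (hm : m'.data = m.data) :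
    SplitInv m0 T E F ds m' := by
  obtain ⟨t, p, rfl⟩ := Mem.exists_withCounters hm
  exact ⟨h.1, h.2, h.3, h.4, h.5, h.6, h.7, h.8, h.9, h.10, h.11, h.12, h.13, h.14, h.15, h.16, h.17,
    h.18⟩

theorem refl (hR : Rep m0 r) (hU : Unsplit m0) : SplitInv m0 ∅ ∅ ∅ [] m0 where
  scanned := rfl
  pending := by simp
  ds_nodup := List.nodup_nil
  ds_fresh := by simp
  fresh_le := le_rfl
  block_in := by simp
  block_out := by simp
  touched b _ _ h := absurd (hU b) h
  whole b _ h := by simp [hU b] at h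
  part b _ d h := by simp [hU b] at h
  new := by simp
  inj b _ b' _ d h := by simp [hU b] at h
  old _ _ := ⟨rfl, rfl⟩
  members := hR.members
  garbage := hR.garbage
  S := rfl
  X := rfl
  mark := rfl

theorem P_eq (h : SplitInv m0 T E F ds m) : m.P = m0.P ++ ds := by
  rw [Mem.P, h.scanned, h.pending, Mem.P, List.append_assoc]

theorem not_mem_ds (h : SplitInv m0 T E F ds m) (hR : Rep m0 r) {b : ℕ} (hb : b ∈ m0.P) :
    b ∉ ds := fun hd => absurd (hR.lt_fresh b hb) (h.ds_fresh b hd).1.not_gt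

theorem nodup_P (h : SplitInv m0 T E F ds m) (hR : Rep m0 r) : m.P.Nodup := by
  rw [h.P_eq, List.nodup_append]
  exact ⟨hR.nodup, h.ds_nodup, fun a ha b hb hab => h.not_mem_ds hR ha (hab ▸ hb)⟩

theorem lt_fresh (h : SplitInv m0 T E F ds m) (hR : Rep m0 r) : ∀ b ∈ m.P, b < m.fresh := by
  intro b hb
  rw [h.P_eq, List.mem_append] at hb
  exact hb.elim (fun hb => (hR.lt_fresh b hb).trans_le h.fresh_le) fun hb => (h.ds_fresh b hb).2

/-- Each new block is the target of the single `intersection` pointer of some old block, so `split`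
at most doubles the number of blocks. -/
theorem length_ds_le (h : SplitInv m0 T E F ds m) : ds.length ≤ m0.P.length := by
  have : ds ⊆ m0.P.map fun b => ((m.heap b).intersection).getD 0 := by
    intro d hd
    obtain ⟨b, hb, hbd⟩ := (h.new d hd).2.2
    exact List.mem_map.2 ⟨b, hb, by simp [hbd]⟩
  simpa using (h.ds_nodup.subperm this).length_le

theorem length_less_le (h : SplitInv m0 T E F ds m) (hR : Rep m0 r) (b : ℕ) :
    (m.heap b).less.length ≤ m0.P.length := by
  by_cases hb : b ∈ m.P
  · rw [h.P_eq, List.mem_append] at hb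
    rcases hb with hb | hb
    · rw [(h.old b hb).1]; exact hR.length_less_le b
    · obtain ⟨c, hc, hcb⟩ := (h.new b hb).2.2
      rw [(h.part c hc b hcb (fun hbc => h.not_mem_ds hR hc (hbc ▸ hb))).2.1]
      exact hR.length_less_le c
  · simp [h.garbage b hb]

/-- There are at most `2k` blocks, with lists of length at most `k`. The bound `3k` leaves room for
one more allocation and for the doubling of the lists in `orderUpdate`. -/
theorem fits (h : SplitInv m0 T E F ds m) (hR : Rep m0 r) {k : ℕ} (hk : m0.P.length ≤ k)
    (hX : m0.X.length ≤ Fintype.card σ) (hS : m0.S.length ≤ Fintype.card σ) : Fits (3 * k) m := by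
  refine ⟨?_, fun b => ?_, h.X ▸ hX, h.S ▸ hS⟩
  · rw [h.P_eq, List.length_append]
    have := h.length_ds_le
    omega
  · have := h.length_less_le hR b
    omega

/-- A null pointer shows that no state of `T` comes from `b`. So `b` certainly has a state outside
`T`, and the only defect is that its new partner is empty, which is recorded by `E = {b}`. -/
theorem newIntersection {b : ℕ} (h : SplitInv m0 T ∅ ∅ ds m) (hR : Rep m0 r) (hb : b ∈ m0.P)
    (hi : (m.heap b).intersection = none) : SplitInv m0 T {b} ∅ (ds ++ [m.fresh])
      { m with
        heap := Function.update (Function.update m.heap b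
          { m.heap b with intersection := some m.fresh }) m.fresh
          { less := (m.heap b).less, intersection := some m.fresh }
        fresh := m.fresh + 1
        pending := m.pending ++ [m.fresh] } := by
  have hold : ∀ c ∈ m.P, c ≠ m.fresh := fun c hc => (h.lt_fresh hR c hc).ne
  have hPm : ∀ c ∈ m0.P, c ∈ m.P := fun c hc => by rw [h.P_eq]; exact List.mem_append_left _ hc
  have hdm : ∀ c ∈ ds, c ∈ m.P := fun c hc => by rw [h.P_eq]; exact List.mem_append_right _ hc
  have hbf := hold b (hPm b hb)
  have hnb : ∀ c ∈ ds, c ≠ b := fun c hc hcb => h.not_mem_ds hR hb (hcb ▸ hc)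
  have hfd : m.fresh ∉ ds := fun hf => hold _ (hdm _ hf) rfl
  have hT : ∀ s ∈ T, m0.block s ≠ b := by
    intro s hs hsb
    have := h.block_in s hs
    rw [hsb, hi] at this
    simp at this
  have hgar := h.garbage m.fresh fun hf => hold _ hf rfl
  refine ⟨h.scanned, by simp [h.pending], ?_, ?_, h.fresh_le.trans (Nat.le_succ _), ?_, h.block_out,
    ?_, ?_, ?_, ?_, ?_, ?_, ?_, ?_, h.S, h.X, h.mark⟩
  · rw [List.nodup_append]
    refine ⟨h.ds_nodup, by simp, ?_⟩
    rintro a ha c hc rfl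
    rw [List.mem_singleton] at hc
    exact hfd (hc ▸ ha)
  · intro d hd
    rw [List.mem_append, List.mem_singleton] at hd
    rcases hd with hd | rfl
    · exact ⟨(h.ds_fresh d hd).1, (h.ds_fresh d hd).2.trans (Nat.lt_succ_self _)⟩
    · exact ⟨h.fresh_le, Nat.lt_succ_self _⟩
  · intro s hs
    have := hold _ (hPm _ (hR.block_mem s))
    simp [this, hT s hs, h.block_in s hs]
  · intro c hc hcb hci
    have hcb' : c ≠ b := by simpa using hcb
    have := hold _ (hPm _ hc)
    simp only [Function.update_of_ne this, Function.update_of_ne hcb'] at hci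
    exact h.touched c hc (by simp) hci
  · intro c hc hci
    have hcf := hold _ (hPm _ hc)
    by_cases hcb : c = b
    · subst hcb
      simp only [Function.update_of_ne hcf, Function.update_self, Option.some.injEq] at hci
      exact absurd hci.symm hcf
    · simp only [Function.update_of_ne hcf, Function.update_of_ne hcb] at hci
      exact h.whole c hc hci
  · intro c hc d hci hdc
    have hcf := hold _ (hPm _ hc)
    by_cases hcb : c = b
    · subst hcb
      simp only [Function.update_of_ne hcf, Function.update_self, Option.some.injEq] at hci
      subst hci
      refine ⟨by simp, by simp [(h.old c hb).1], fun _ => ?_⟩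
      obtain ⟨s, hs⟩ := hR.nonempty c hc
      exact ⟨s, fun hsT => hT s hsT hs, hs⟩
    · simp only [Function.update_of_ne hcf, Function.update_of_ne hcb] at hci
      obtain ⟨h1, h2, h3⟩ := h.part c hc d hci hdc
      refine ⟨by simp [h1], ?_, h3⟩
      simp [hold _ (hdm _ h1), hnb d h1, h2]
  · intro d hd
    rw [List.mem_append, List.mem_singleton] at hd
    rcases hd with hd | rfl
    · obtain ⟨h1, h2, c, hc, h3⟩ := h.new d hd
      have hcb : c ≠ b := by rintro rfl; simp [hi] at h3
      refine ⟨by simp [hold _ (hdm _ hd), hnb d hd, h1], by simp [hold _ (hdm _ hd), hnb d hd, h2],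
        c, hc, ?_⟩
      simp [hold _ (hPm _ hc), hcb, h3]
    · exact ⟨by simp, by simp, b, hb, by simp [hbf]⟩
  · intro c hc c' hc' d hcd hcd'
    have hcf := hold _ (hPm _ hc)
    have hcf' := hold _ (hPm _ hc')
    have key : ∀ e ∈ m0.P, (m.heap e).intersection ≠ some m.fresh := by
      intro e he hef
      exact hfd (h.part e he _ hef (hold _ (hPm _ he)).symm).1
    simp only [Function.update_of_ne hcf, Function.update_of_ne hcf'] at hcd hcd'
    by_cases hcb : c = b <;> by_cases hcb' : c' = b
    · rw [hcb, hcb']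
    · subst hcb
      simp only [Function.update_self, Option.some.injEq, Function.update_of_ne hcb'] at hcd hcd'
      exact absurd (hcd ▸ hcd') (key c' hc')
    · subst hcb'
      simp only [Function.update_self, Option.some.injEq, Function.update_of_ne hcb] at hcd hcd'
      exact absurd (hcd' ▸ hcd) (key c hc)
    · simp only [Function.update_of_ne hcb, Function.update_of_ne hcb'] at hcd hcd'
      exact h.inj c hc c' hc' d hcd hcd'
  · intro c hc
    have hcf := hold _ (hPm _ hc)
    simp only [Function.update_of_ne hcf]
    by_cases hcb : c = b
    · subst hcb; simpa using h.old c hc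
    · simpa [hcb] using h.old c hc
  · intro c hc
    have hc' : c ∈ m.P ∨ c = m.fresh := by
      simpa [Mem.P, or_assoc] using hc
    rcases hc' with hc' | rfl
    · have hcf := hold _ hc'
      simp only [Function.update_of_ne hcf]
      by_cases hcb : c = b
      · subst hcb; simpa using h.members c hc'
      · simpa [hcb] using h.members c hc'
    · refine ⟨fun s => ?_, by simp⟩
      simp only [Function.update_self, List.not_mem_nil, false_iff]
      intro hs
      by_cases hsT : s ∈ T
      · have h1 := h.block_in s hsT
        rw [hs] at h1
        exact hfd (h.part _ (hR.block_mem s) _ h1 (hold _ (hPm _ (hR.block_mem s))).symm).1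
      · exact hold _ (hPm _ (hR.block_mem s)) ((h.block_out s hsT).symm.trans hs)
  · intro c hc
    have hc' : c ∉ m.P ∧ c ≠ m.fresh := by
      simpa [Mem.P, not_or, and_assoc] using hc
    have hcb : c ≠ b := fun hcb => hc'.1 (hcb ▸ hPm b hb)
    simpa [hc'.2, hcb] using h.garbage c hc'.1

/-- The moved state makes the partner of `b` nonempty, which removes `b` from `E`, but it may have
been the last one in `b`, which puts `b` into `F`. -/
theorem move {b d : ℕ} {s : σ} (h : SplitInv m0 T {b} ∅ ds m) (hR : Rep m0 r)
    (hs : s ∉ T) (hb : m0.block s = b) (hi : (m.heap b).intersection = some d) (hd : d ≠ b) :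
    SplitInv m0 (insert s T) ∅ {b} ds
      { m with
        heap := Function.update (Function.update m.heap b
          { m.heap b with members := (m.heap b).members.erase s }) d
          { m.heap d with members := (m.heap d).members ++ [s] }
        block := Function.update m.block s d } := by
  have hbP : b ∈ m0.P := hb ▸ hR.block_mem s
  set hp := Function.update (Function.update m.heap b
          { m.heap b with members := (m.heap b).members.erase s }) d
          { m.heap d with members := (m.heap d).members ++ [s] } with hhp
  have hint : ∀ c, (hp c).intersection = (m.heap c).intersection := by
    intro c
    by_cases hc : c = d
    · subst hc; simp [hhp]
    · by_cases hc' : c = b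
      · subst hc'; simp [hhp, hc]
      · simp [hhp, hc, hc']
  have hless : ∀ c, (hp c).less = (m.heap c).less := by
    intro c
    by_cases hc : c = d
    · subst hc; simp [hhp]
    · by_cases hc' : c = b
      · subst hc'; simp [hhp, hc]
      · simp [hhp, hc, hc']
  have hch : ∀ c, (hp c).changedImage = (m.heap c).changedImage := by
    intro c
    by_cases hc : c = d
    · subst hc; simp [hhp]
    · by_cases hc' : c = b
      · subst hc'; simp [hhp, hc]
      · simp [hhp, hc, hc']
  have hsb : m.block s = b := (h.block_out s hs).trans hb
  have hds : d ∈ ds := (h.part b hbP d hi hd).1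
  have hdP : d ∈ m.P := by rw [h.P_eq]; exact List.mem_append_right _ hds
  have hbP' : b ∈ m.P := by rw [h.P_eq]; exact List.mem_append_left _ hbP
  refine ⟨h.scanned, h.pending, h.ds_nodup, h.ds_fresh, h.fresh_le, ?_, ?_, ?_, ?_, ?_, ?_, ?_, ?_,
    ?_, ?_, h.S, h.X, h.mark⟩
  · intro x hx
    simp only [hint]
    by_cases hxs : x = s
    · subst hxs
      rw [hb, hi]; simp
    · rw [Function.update_of_ne hxs]
      exact h.block_in x (hx.resolve_left hxs)
  · intro x hx
    rw [Set.mem_insert_iff, not_or] at hx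
    simp only [Function.update_of_ne hx.1]
    exact h.block_out x hx.2
  · intro c hc _ hci
    simp only [hint] at hci
    by_cases hcb : c = b
    · exact ⟨s, Or.inl rfl, hb.trans hcb.symm⟩
    · obtain ⟨x, hx, hxc⟩ := h.touched c hc (by simpa using hcb) hci
      exact ⟨x, Or.inr hx, hxc⟩
  · intro c hc hci x hx
    simp only [hint] at hci
    exact Or.inr (h.whole c hc hci x hx)
  · intro c hc e hce hec
    simp only [hint, hless] at hce ⊢
    obtain ⟨h1, h2, h3⟩ := h.part c hc e hce hec
    refine ⟨h1, h2, fun hcb => ?_⟩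
    obtain ⟨x, hx, hxc⟩ := h3 (by simp)
    refine ⟨x, ?_, hxc⟩
    rintro (rfl | hxT)
    · exact hcb (hxc.symm.trans hb)
    · exact hx hxT
  · intro e he
    simp only [hint, hch]
    exact h.new e he
  · intro c hc c' hc' e
    simp only [hint]
    exact h.inj c hc c' hc' e
  · intro c hc
    simp only [hless, hch]
    exact h.old c hc
  · intro c hc
    have hc : c ∈ m.P := hc
    obtain ⟨h1, h2⟩ := h.members c hc
    by_cases hcd : c = d
    · subst hcd
      simp only [hhp, Function.update_self, List.mem_append, List.mem_singleton]
      refine ⟨fun x => ?_, ?_⟩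
      · rw [h1]
        by_cases hxs : x = s
        · subst hxs; simp
        · simp [hxs]
      · rw [List.nodup_append]
        refine ⟨h2, by simp, ?_⟩
        rintro x hx y hy rfl
        rw [List.mem_singleton] at hy
        subst hy
        exact hd (((h1 x).1 hx).symm.trans hsb)
    · by_cases hcb : c = b
      · subst hcb
        simp only [hhp, Function.update_of_ne hcd, Function.update_self]
        refine ⟨fun x => ?_, h2.erase s⟩
        rw [h2.mem_erase_iff, h1]
        by_cases hxs : x = s
        · subst hxs; simp [hd]
        · simp [hxs]
      · simp only [hhp, Function.update_of_ne hcd, Function.update_of_ne hcb]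
        refine ⟨fun x => ?_, h2⟩
        rw [h1]
        by_cases hxs : x = s
        · subst hxs; simp [hsb, Ne.symm hcb, Ne.symm hcd]
        · simp [hxs]
  · intro c hc
    have hc : c ∉ m.P := hc
    have h1 : c ≠ d := fun hcd => hc (hcd ▸ hdP)
    have h2 : c ≠ b := fun hcb => hc (hcb ▸ hbP')
    simpa [hhp, h1, h2] using h.garbage c hc

/-- States of `T` lie in the partner of their old block. As `b` is an old block with another
partner, a state that is still in `b` is outside `T`. -/
theorem of_members_ne_nil {b d : ℕ} (h : SplitInv m0 T ∅ {b} ds m) (hR : Rep m0 r) (hb : b ∈ m0.P)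
    (hi : (m.heap b).intersection = some d) (hd : d ≠ b) (hne : (m.heap b).members ≠ []) :
    SplitInv m0 T ∅ ∅ ds m := by
  refine { h with part := fun c hc e hce hec => ?_ }
  obtain ⟨h1, h2, h3⟩ := h.part c hc e hce hec
  refine ⟨h1, h2, fun _ => ?_⟩
  by_cases hcb : c = b
  · subst hcb
    obtain ⟨s, hs⟩ := List.exists_mem_of_ne_nil _ hne
    have hsc : m.block s = c := ((h.members c (by rw [h.P_eq]; simp [hb])).1 s).1 hs
    have hsT : s ∉ T := by
      intro hsT
      have h4 := h.block_in s hsT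
      rw [hsc] at h4
      by_cases h5 : m0.block s = c
      · rw [h5, hi] at h4
        exact hd (Option.some.inj h4)
      · exact h.not_mem_ds hR hb (h.part _ (hR.block_mem s) c h4 (Ne.symm h5)).1
    exact ⟨s, hsT, (h.block_out s hsT).symm.trans hsc⟩
  · exact h3 (by simpa using hcb)

/-- States outside `T` never move, so an empty `b` had all its states in `T`; this justifies
`intersection = b`. -/
theorem takeBack {b d : ℕ} (h : SplitInv m0 T ∅ {b} ds m) (hR : Rep m0 r) (hb : b ∈ m0.P)
    (hi : (m.heap b).intersection = some d) (hd : d ≠ b) (hnil : (m.heap b).members = []) :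
    SplitInv m0 T ∅ ∅ (ds.erase d)
      { m with
        heap := Function.update (Function.update m.heap d {}) b
          { m.heap b with members := (m.heap d).members, intersection := some b }
        block := fun s => if s ∈ (m.heap d).members then b else m.block s
        scanned := m.scanned.erase d
        pending := m.pending.erase d } := by
  have hds : d ∈ ds := (h.part b hb d hi hd).1
  have hP0 : ∀ c ∈ m0.P, c ≠ d := fun c hc hcd => h.not_mem_ds hR hc (hcd ▸ hds)
  have hdP : d ∈ m.P := by rw [h.P_eq]; exact List.mem_append_right _ hds
  have hbP : b ∈ m.P := by rw [h.P_eq]; exact List.mem_append_left _ hb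
  have hmd := (h.members d hdP).1
  set hp := Function.update (Function.update m.heap d {}) b
          { m.heap b with members := (m.heap d).members, intersection := some b } with hhp
  have hpb : hp b = { m.heap b with members := (m.heap d).members, intersection := some b } := by
    simp [hhp]
  have hpo : ∀ c, c ≠ b → c ≠ d → hp c = m.heap c := fun c h1 h2 => by simp [hhp, h1, h2]
  have hde : ∀ e, e ∈ ds.erase d ↔ e ≠ d ∧ e ∈ ds := fun e => h.ds_nodup.mem_erase_iff
  have hnb : ∀ e ∈ ds, e ≠ b := fun e he heb => h.not_mem_ds hR hb (heb ▸ he)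
  have hsc : m.scanned.erase d = m0.scanned := by
    rw [h.scanned, List.erase_of_not_mem]
    exact fun hm => hP0 d (List.mem_append_left _ hm) rfl
  have hpe : m.pending.erase d = m0.pending ++ ds.erase d := by
    rw [h.pending, List.erase_append_right]
    exact fun hm => hP0 d (List.mem_append_right _ hm) rfl
  have hbl : ∀ s, m.block s ≠ b := by
    intro s hs
    have := ((h.members b hbP).1 s).2 hs
    simp [hnil] at this
  refine ⟨hsc, hpe, h.ds_nodup.erase d, ?_, h.fresh_le, ?_, ?_, ?_, ?_, ?_, ?_, ?_, ?_, ?_, ?_, h.S,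
    h.X, h.mark⟩
  · exact fun e he => h.ds_fresh e ((hde e).1 he).2
  · intro s hs
    have h1 := h.block_in s hs
    by_cases h0 : m0.block s = b
    · rw [h0, hi] at h1
      have : s ∈ (m.heap d).members := (hmd s).2 (Option.some.inj h1).symm
      simp [h0, hpb, this]
    · have : s ∉ (m.heap d).members := by
        intro hsd
        rw [(hmd s).1 hsd] at h1
        exact h0 (h.inj _ (hR.block_mem s) _ hb d h1 hi)
      simp only [hpo _ h0 (hP0 _ (hR.block_mem s)), this, if_false, h1]
  · intro s hs
    have h1 := h.block_out s hs
    have : s ∉ (m.heap d).members := by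
      intro hsd
      exact hP0 _ (hR.block_mem s) (h1.symm.trans ((hmd s).1 hsd))
    simp only [this, if_false, h1]
  · intro c hc _ hci
    by_cases hcb : c = b
    · subst hcb
      exact h.touched c hc (by simp) (by simp [hi])
    · simp only [hpo c hcb (hP0 c hc)] at hci
      exact h.touched c hc (by simp) hci
  · intro c hc hci s hs
    by_cases hcb : c = b
    · by_contra hsT
      exact hbl s ((h.block_out s hsT).trans (hs.trans hcb))
    · simp only [hpo c hcb (hP0 c hc)] at hci
      exact h.whole c hc hci s hs
  · intro c hc e hce hec
    have hcb : c ≠ b := by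
      rintro rfl
      simp only [hpb, Option.some.injEq] at hce
      exact hec hce.symm
    simp only [hpo c hcb (hP0 c hc)] at hce
    obtain ⟨h1, h2, h3⟩ := h.part c hc e hce hec
    have hed : e ≠ d := by
      rintro rfl
      exact hcb (h.inj c hc b hb e hce hi)
    refine ⟨(hde e).2 ⟨hed, h1⟩, ?_, fun _ => h3 (by simpa using hcb)⟩
    simp only [hpo e (hnb e h1) hed, h2]
  · intro e he
    obtain ⟨hed, he⟩ := (hde e).1 he
    obtain ⟨h1, h2, c, hc, h3⟩ := h.new e he
    have hcb : c ≠ b := by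
      rintro rfl
      rw [hi] at h3
      exact hed (Option.some.inj h3).symm
    simp only [hpo e (hnb e he) hed]
    exact ⟨h1, h2, c, hc, by rw [hpo c hcb (hP0 c hc)]; exact h3⟩
  · intro c hc c' hc' e hce hce'
    by_cases hcb : c = b <;> by_cases hcb' : c' = b
    · rw [hcb, hcb']
    · subst hcb
      simp only [hpb, hpo c' hcb' (hP0 c' hc'), Option.some.injEq] at hce hce'
      subst hce
      exact absurd (h.part c' hc' c hce' (Ne.symm hcb')).1 (h.not_mem_ds hR hb)
    · subst hcb'
      simp only [hpb, hpo c hcb (hP0 c hc), Option.some.injEq] at hce hce'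
      subst hce'
      exact absurd (h.part c hc c' hce (Ne.symm hcb)).1 (h.not_mem_ds hR hb)
    · simp only [hpo c hcb (hP0 c hc), hpo c' hcb' (hP0 c' hc')] at hce hce'
      exact h.inj c hc c' hc' e hce hce'
  · intro c hc
    by_cases hcb : c = b
    · subst hcb; simpa [hpb] using h.old c hc
    · simpa [hpo c hcb (hP0 c hc)] using h.old c hc
  · intro c hc
    have hc' : c ∈ m.P ∧ c ≠ d := by
      have : c ∈ m0.P ++ ds.erase d := by
        have h1 : c ∈ m.scanned.erase d ++ m.pending.erase d := hc
        rwa [hsc, hpe, ← List.append_assoc] at h1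
      rw [List.mem_append] at this
      rw [h.P_eq, List.mem_append]
      rcases this with h1 | h1
      · exact ⟨Or.inl h1, hP0 c h1⟩
      · exact ⟨Or.inr ((hde c).1 h1).2, ((hde c).1 h1).1⟩
    by_cases hcb : c = b
    · subst hcb
      simp only [hpb]
      refine ⟨fun s => ?_, (h.members d hdP).2⟩
      by_cases hs : s ∈ (m.heap d).members
      · simp [hs]
      · simp [hs, hbl s]
    · simp only [hpo c hcb hc'.2]
      refine ⟨fun s => ?_, (h.members c hc'.1).2⟩
      rw [(h.members c hc'.1).1 s]
      by_cases hs : s ∈ (m.heap d).members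
      · simp [hs, (hmd s).1 hs, Ne.symm hcb, Ne.symm hc'.2]
      · simp [hs]
  · intro c hc
    have hc0 : c ∉ m0.P ++ ds.erase d := by
      have h1 : c ∉ m.scanned.erase d ++ m.pending.erase d := hc
      rwa [hsc, hpe, ← List.append_assoc] at h1
    rw [List.mem_append, not_or] at hc0
    have hcb : c ≠ b := fun hcb => hc0.1 (hcb ▸ hb)
    by_cases hcd : c = d
    · subst hcd; simp [hhp, hcb]
    · simp only [hpo c hcb hcd]
      apply h.garbage
      rw [h.P_eq, List.mem_append, not_or]
      exact ⟨hc0.1, fun h1 => hc0.2 ((hde c).2 ⟨hcd, h1⟩)⟩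

end SplitInv

end SimAlg

/-! ### Amortized analysis of `split`, and the combined effect of `split` and `orderUpdate` -/

namespace SimAlg

variable {σ : Type u} [Fintype σ] [DecidableEq σ]

/-- The time that `split` may still have to spend on a block `b` with `n` states. -/
def splitWeight (A n b : ℕ) : Option ℕ → ℕ
  | none => A + (2 * n + 5)
  | some d => if d = b then 0 else 2 * n + 5

theorem sum_map_add_le {l : List ℕ} {b : ℕ} (hb : b ∈ l) {f g : ℕ → ℕ} {δ : ℕ}
    (h : ∀ c ∈ l, g c ≤ f c) (hδ : g b + δ ≤ f b) : (l.map g).sum + δ ≤ (l.map f).sum := by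
  induction l with
  | nil => simp at hb
  | cons a l ih =>
    simp only [List.map_cons, List.sum_cons]
    have hle : (l.map g).sum ≤ (l.map f).sum :=
      List.sum_le_sum fun c hc => h c (List.mem_cons_of_mem _ hc)
    rcases List.mem_cons.1 hb with rfl | hb
    · omega
    · have := ih hb fun c hc => h c (List.mem_cons_of_mem _ hc)
      have := h a List.mem_cons_self
      omega

/-- The body of the loop of `split`. -/
def splitStep (s : σ) (m : Mem σ) : Mem σ :=
  let b := m.block s
  let m := if (m.heap b).intersection = none then newIntersection b m else m
  let d := (m.heap b).intersection.getD b
  let m := move s b d m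
  if (m.heap b).members = [] then takeBack b d m else m

/-- The time that `split` may still have to spend on the blocks. -/
def splitPotential (A : ℕ) (m0 m : Mem σ) : ℕ :=
  (m0.P.map fun b =>
    splitWeight A (m0.heap b).members.length b (m.heap b).intersection).sum

namespace SplitInv

variable {m0 m : Mem σ} {r : σ → σ → Prop} {T : Set σ} {E F : Set ℕ} {ds : List ℕ}

/-- The constant `2 * (3 * k) + 6` is the cost of `newIntersection` when lists have length at most
`3k`, and `2 * n + 5` that of `takeBack` on `n` states. Creating the partner uses up the first share
of the weight and leaves the second. -/
theorem exists_intersection {k b : ℕ} (h : SplitInv m0 T ∅ ∅ ds m) (hR : Rep m0 r)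
    (hk : m0.P.length ≤ k) (hk' : 1 ≤ k) (hX : m0.X.length ≤ Fintype.card σ)
    (hS : m0.S.length ≤ Fintype.card σ) (hb : b ∈ m0.P) (hib : (m.heap b).intersection ≠ some b) :
    ∃ m' : Mem σ, (if (m.heap b).intersection = none then SimAlg.newIntersection b m else m) = m' ∧
      ∃ ds' d, SplitInv m0 T {b} ∅ ds' m' ∧ (m'.heap b).intersection = some d ∧ d ≠ b ∧
        m'.block = m.block ∧
        (∀ c ∈ m0.P, c ≠ b → (m'.heap c).intersection = (m.heap c).intersection) ∧
        ∃ t, Spends (wordBound σ (3 * k)) t m m' ∧ ∀ n,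
          t + (2 * n + 5) ≤ splitWeight (2 * (3 * k) + 6) n b (m.heap b).intersection := by
  refine ⟨_, rfl, ?_⟩
  rcases hi : (m.heap b).intersection with _ | d
  · have hPm : ∀ c ∈ m0.P, c ∈ m.P := fun c hc => by rw [h.P_eq]; exact List.mem_append_left _ hc
    have hf : ∀ c ∈ m0.P, c ≠ m.fresh := fun c hc => (h.lt_fresh hR c (hPm c hc)).ne
    have hlen : m.P.length + 1 ≤ 3 * k := by
      rw [h.P_eq, List.length_append]
      have := h.length_ds_le
      omega
    obtain ⟨h1, h2⟩ := newIntersection_spec (h.fits hR hk hX hS) hlen (hf b hb)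
    have h3 := (h.newIntersection hR hb hi).of_data h1
    obtain ⟨t, p, h4⟩ := Mem.exists_withCounters h1
    refine ⟨_, m.fresh, h3, ?_, (hf b hb).symm, ?_, ?_, _, h2, fun n => ?_⟩
    · rw [if_pos rfl, h4]; simp [Mem.withCounters, hf b hb]
    · rw [if_pos rfl, h4]; rfl
    · intro c hc hcb
      rw [if_pos rfl, h4]; simp [Mem.withCounters, hf c hc, hcb]
    · simp [splitWeight]
  · have hd : d ≠ b := fun hd => hib (by rw [hi, hd])
    refine ⟨ds, d, { h with touched := fun c hc _ => h.touched c hc (by simp) }, ?_, hd, rfl,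
      fun _ _ _ => rfl, 0, Spends.refl _ _, fun n => ?_⟩
    · simpa using hi
    · simp [splitWeight, hd]

/-- Each state pays three units for its move; creation and taking back are paid by the block. After
`takeBack` the weight of the block is zero, but then all its states have been treated and it is not
visited again. -/
theorem step {k : ℕ} {s : σ} (h : SplitInv m0 T ∅ ∅ ds m) (hR : Rep m0 r)
    (hk : m0.P.length ≤ k) (hk' : 1 ≤ k) (hX : m0.X.length ≤ Fintype.card σ)
    (hS : m0.S.length ≤ Fintype.card σ) (hs : s ∉ T) :
    (∃ ds', SplitInv m0 (insert s T) ∅ ∅ ds' (splitStep s m)) ∧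
      ∃ t, Spends (wordBound σ (3 * k)) t m (splitStep s m) ∧
        t + splitPotential (2 * (3 * k) + 6) m0 (splitStep s m) ≤
          splitPotential (2 * (3 * k) + 6) m0 m + 3 := by
  set b := m0.block s with hb
  have hbP : b ∈ m0.P := hR.block_mem s
  have hsb : m.block s = b := h.block_out s hs
  obtain ⟨m1, hm1, ds1, d, h1, hi1, hd, hbl1, hint1, t1, hs1, hw1⟩ :=
    h.exists_intersection hR hk hk' hX hS hbP fun hi => hs (h.whole b hbP hi s hb.symm)
  have hdP : ∀ c ∈ m0.P, c ≠ d := fun c hc hcd =>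
    h1.not_mem_ds hR hc (hcd ▸ (h1.part b hbP d hi1 hd).1)
  obtain ⟨h2, hs2⟩ := move_spec s (h1.fits hR hk hX hS) hd.symm
  set m2 := SimAlg.move s b d m1 with hm2
  have h3 := (h1.move hR hs hb.symm hi1 hd).of_data h2
  obtain ⟨t, p, h4⟩ := Mem.exists_withCounters h2
  have hint2 : ∀ c ∈ m0.P, (m2.heap c).intersection = (m1.heap c).intersection := by
    intro c hc
    rw [h4]
    by_cases hcb : c = b
    · simp [Mem.withCounters, hcb, hd.symm]
    · simp [Mem.withCounters, hdP c hc, hcb]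
  have hstep : splitStep s m =
      if (m2.heap b).members = [] then SimAlg.takeBack b d m2 else m2 := by
    have : splitStep s m = (fun m1 : Mem σ =>
      (fun m2 : Mem σ => if (m2.heap b).members = [] then
          SimAlg.takeBack b ((m1.heap b).intersection.getD b) m2 else m2)
        (SimAlg.move s b ((m1.heap b).intersection.getD b) m1))
        (if (m.heap b).intersection = none then SimAlg.newIntersection b m else m) := by
      unfold splitStep
      rw [hsb]
    rw [this, hm1]
    simp only [hi1, Option.getD_some]
    rfl
  have hi2 : (m2.heap b).intersection = some d := by rw [hint2 b hbP, hi1]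
  by_cases hnil : (m2.heap b).members = []
  · rw [if_pos hnil] at hstep
    have hF2 := h3.fits hR hk hX hS
    obtain ⟨h5, hs5⟩ := takeBack_spec hF2 hd.symm
    have h6 := (h3.takeBack hR hbP hi2 hd hnil).of_data h5
    rw [hstep]
    refine ⟨⟨_, h6⟩, _, (hs1.trans hs2).trans hs5, ?_⟩
    obtain ⟨t', p', h7⟩ := Mem.exists_withCounters h5
    -- All the states in `d` come from `b`, so the weight, computed from the initial size of `b`,
    -- covers this loop.
    have hlen : (m2.heap d).members.length ≤ (m0.heap b).members.length := by
      have hd2 : d ∈ m2.P := by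
        rw [h3.P_eq]; exact List.mem_append_right _ (h3.part b hbP d hi2 hd).1
      obtain ⟨hmd, hnd⟩ := h3.members d hd2
      refine (hnd.subperm ?_).length_le
      intro x hx
      rw [(hR.members b hbP).1 x]
      have hx' := (hmd x).1 hx
      by_cases hxT : x ∈ insert s T
      · exact h3.inj _ (hR.block_mem x) b hbP d (by rw [h3.block_in x hxT, hx']) hi2
      · exact absurd ((h3.block_out x hxT).symm.trans hx') (hdP _ (hR.block_mem x))
    have hsum : splitPotential (2 * (3 * k) + 6) m0 (SimAlg.takeBack b d m2) +
        (t1 + (2 * (m0.heap b).members.length + 5)) ≤ splitPotential (2 * (3 * k) + 6) m0 m := by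
      refine sum_map_add_le hbP (fun c hc => ?_) ?_
      · by_cases hcb : c = b
        · subst hcb
          rw [h7]
          simp [Mem.withCounters, splitWeight]
        · rw [h7]
          simp only [Mem.withCounters, Function.update_of_ne hcb, Function.update_of_ne (hdP c hc)]
          rw [hint2 c hc, hint1 c hc hcb]
      · have := hw1 (m0.heap b).members.length
        refine le_trans (le_of_eq ?_) this
        rw [h7]
        simp [Mem.withCounters, splitWeight]
    omega
  · rw [if_neg hnil] at hstep
    rw [hstep]
    refine ⟨⟨_, h3.of_members_ne_nil hR hbP hi2 hd hnil⟩, _, hs1.trans hs2, ?_⟩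
    have hsum : splitPotential (2 * (3 * k) + 6) m0 m2 + t1 ≤
        splitPotential (2 * (3 * k) + 6) m0 m := by
      refine sum_map_add_le hbP (fun c hc => ?_) ?_
      · by_cases hcb : c = b
        · rw [hcb, hi2]
          have := hw1 (m0.heap b).members.length
          rw [splitWeight, if_neg hd]
          omega
        · rw [hint2 c hc, hint1 c hc hcb]
      · have := hw1 (m0.heap b).members.length
        rw [hi2, splitWeight, if_neg hd]
        omega
    omega

end SplitInv

theorem split_spec {m : Mem σ} {r : σ → σ → Prop} {k : ℕ} (hR : Rep m r) (hU : Unsplit m)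
    (hk : m.P.length ≤ k) (hk' : 1 ≤ k) (hX : m.X.length ≤ Fintype.card σ) (hS : m.S.Nodup) :
    (∃ ds, SplitInv m {s | s ∈ m.S} ∅ ∅ ds (split m)) ∧
      Spends (wordBound σ (3 * k)) (6 * Fintype.card σ + k * (6 * k + 11) + 1) m (split m) := by
  have hS' : m.S.length ≤ Fintype.card σ := hS.length_le_card
  have := forAll_rule (body := splitStep) (W := wordBound σ (3 * k))
    (fun l m' => ∃ l', l' ++ l = m.S ∧ ∃ ds, SplitInv m {s | s ∈ l'} ∅ ∅ ds m')
    (fun l m' => 4 * l.length + splitPotential (2 * (3 * k) + 6) m m')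
    (fun l m' ⟨l', h, ds, h'⟩ => ⟨l', h, ds, h'.of_data rfl⟩) (fun _ _ => rfl)
    (fun l m' ⟨l', h, ds, h'⟩ => (h'.fits hR hk hX hS').words_le)
    (by
      rintro s l m' ⟨l', h, ds, h'⟩
      have hs : s ∉ l' := by
        intro hs
        rw [← h, List.nodup_append] at hS
        exact hS.2.2 s hs s (by simp) rfl
      obtain ⟨⟨ds', h1⟩, t, h2, h3⟩ := h'.step hR hk hk' hX hS' hs
      refine ⟨⟨l' ++ [s], by simpa using h, ds', ?_⟩, t, h2, ?_⟩
      · have : {x | x ∈ l' ++ [s]} = insert s {x | x ∈ l'} := by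
          ext x; simp [or_comm]
        rw [this]
        exact h1
      · simp only [List.length_cons]
        omega)
    m.S m ⟨[], by simp, [], by simpa using SplitInv.refl hR hU⟩
  obtain ⟨⟨l', h1, h2⟩, h3⟩ := this
  rw [List.append_nil] at h1
  subst h1
  refine ⟨h2, h3.mono ?_⟩
  -- At the start every block carries its full weight. The terms `2 * n` add up to at most `2 |Σ|`
  -- by disjointness; with four units per state of `S` this gives `6 |Σ|`.
  have h4 : splitPotential (2 * (3 * k) + 6) m m =
      2 * (m.P.flatMap fun c => (m.heap c).members).length + m.P.length * (6 * k + 11) := by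
    unfold splitPotential
    simp only [hU _, splitWeight]
    generalize m.P = l
    induction l with
    | nil => simp
    | cons a l ih =>
      simp only [List.map_cons, List.sum_cons, ih, List.flatMap_cons, List.length_append,
        List.length_cons]
      ring
  have h5 := (hR.nodup_flatMap hR.nodup (List.Subset.refl _)).length_le_card
  have h6 := Nat.mul_le_mul_right (6 * k + 11) hk
  rw [h4]
  omega

/-! ### Splitting with respect to a set and updating the order -/

/-- The preorder after splitting with respect to `S`. -/
def splitRel (r : σ → σ → Prop) (S : Set σ) (s t : σ) : Prop := r s t ∧ (s ∈ S → t ∈ S)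

/-- The state of the memory `m'` after `split` and `orderUpdate` have been applied to `m`. -/
structure Updated (m : Mem σ) (r : σ → σ → Prop) (m' : Mem σ) : Prop where
  rep : Rep m' (splitRel r {s | s ∈ m.S})
  scanned : m'.scanned = m.scanned
  pending : ∃ ds, m'.pending = m.pending ++ ds
  block_eq : ∀ s, m'.block s ∈ m.P → m.block s = m'.block s
  changed : ∀ s, (m'.heap (m'.block s)).changedImage = true →
    (m'.block s ∈ m.P ∧ (m.heap (m'.block s)).changedImage = true) ∨
      (s ∈ m.S ∧ ∃ t ∉ m.S, r s t)
  of_split : ∀ s ∈ m.S, (∃ t ∉ m.S, r s t) → (m'.heap (m'.block s)).changedImage = true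
  S : m'.S = m.S
  X : m'.X = m.X

/-- After `split`, the `intersection` fields tell on which side of `S` each block lies. A block
outside `S` must then see both parts of every block above it, and a block inside `S` only the inner
parts; this is `splitRel`. Transitivity of `r` makes the choice of states in the blocks irrelevant.
-/
theorem orderUpdate_split_spec {m : Mem σ} {r : σ → σ → Prop} {k : ℕ} (hR : Rep m r)
    (hU : Unsplit m) (hk : m.P.length ≤ k) (hk' : 1 ≤ k) (hX : m.X.length ≤ Fintype.card σ)
    (hS : m.S.Nodup) (htrans : ∀ s t u, r s t → r t u → r s u) :
    Updated m r (orderUpdate (split m)) ∧ Fits (3 * k) (orderUpdate (split m)) ∧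
      Spends (wordBound σ (3 * k)) (6 * Fintype.card σ + k * (24 * k + 17) + 2) m
        (orderUpdate (split m)) := by
  have hS' : m.S.length ≤ Fintype.card σ := hS.length_le_card
  obtain ⟨⟨ds, h⟩, hs1⟩ := split_spec hR hU hk hk' hX hS
  set m1 := split m
  have hP1 : ∀ c ∈ m.P, c ∈ m1.P := fun c hc => by rw [h.P_eq]; exact List.mem_append_left _ hc
  have hlessP : ∀ s, (m.heap (m.block s)).less ⊆ m.P := fun s => hR.less_subset (hR.block_mem s)
  have hin : ∀ s ∈ m.S, (m1.heap (m.block s)).intersection = some (m1.block s) := h.block_in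
  have hout : ∀ s ∉ m.S, m1.block s = m.block s := h.block_out
  have hwhole : ∀ s t, m.block s = m.block t →
      (m1.heap (m.block s)).intersection = some (m.block s) → t ∈ m.S :=
    fun s t hst hi => h.whole _ (hR.block_mem s) hi t hst.symm
  -- the blocks inside and outside of `S`
  have hself : ∀ s ∈ m.S, (m1.heap (m1.block s)).intersection = some (m1.block s) := by
    intro s hs
    have h1 := hin s hs
    by_cases h2 : m1.block s = m.block s
    · rw [← h2] at h1; exact h1
    · exact (h.new _ (h.part _ (hR.block_mem s) _ h1 h2).1).1
  have hnself : ∀ s ∉ m.S, (m1.heap (m1.block s)).intersection ≠ some (m1.block s) := by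
    intro s hs hi
    rw [hout s hs] at hi
    exact hs (hwhole s s rfl hi)
  have hless1 : ∀ s, (m1.heap (m1.block s)).less = (m.heap (m.block s)).less := by
    intro s
    by_cases hs : s ∈ m.S
    · by_cases h2 : m1.block s = m.block s
      · rw [h2]; exact (h.old _ (hR.block_mem s)).1
      · exact (h.part _ (hR.block_mem s) _ (hin s hs) h2).2.1
    · rw [hout s hs]; exact (h.old _ (hR.block_mem s)).1
  have hblock1P : ∀ s, m1.block s ∈ m1.P := by
    intro s
    by_cases hs : s ∈ m.S
    · by_cases h2 : m1.block s = m.block s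
      · rw [h2]; exact hP1 _ (hR.block_mem s)
      · rw [h.P_eq]
        exact List.mem_append_right _ (h.part _ (hR.block_mem s) _ (hin s hs) h2).1
    · rw [hout s hs]; exact hP1 _ (hR.block_mem s)
  have hne1 : ∀ b ∈ m1.P, ∃ s, m1.block s = b := by
    intro b hb
    rw [h.P_eq, List.mem_append] at hb
    rcases hb with hb | hb
    · obtain ⟨s, rfl⟩ := hR.nonempty b hb
      rcases hi : (m1.heap (m.block s)).intersection with _ | d
      · have hs : s ∉ m.S := fun hs => by rw [hin s hs] at hi; simp at hi
        exact ⟨s, hout s hs⟩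
      · by_cases hd : d = m.block s
        · subst hd
          have hs := hwhole s s rfl hi
          rw [hin s hs] at hi
          exact ⟨s, Option.some.inj hi⟩
        · obtain ⟨t, ht, hts⟩ := (h.part _ hb d hi hd).2.2 (by simp)
          exact ⟨t, (hout t ht).trans hts⟩
    · obtain ⟨c, hc, hcb⟩ := (h.new b hb).2.2
      obtain ⟨s, hs, hsc⟩ := h.touched c hc (by simp) (by simp [hcb])
      have := hin s hs
      rw [hsc, hcb] at this
      exact ⟨s, (Option.some.inj this).symm⟩
  have hnd1 : ∀ b ∈ m1.P, (m1.heap b).less.Nodup := by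
    intro b hb
    obtain ⟨s, rfl⟩ := hne1 b hb
    rw [hless1]
    exact hR.less_nodup _ (hR.block_mem s)
  have hF1 := h.fits hR hk hX hS'
  have hlen1 : ∀ b, 2 * (m1.heap b).less.length ≤ 3 * k := by
    intro b
    have := h.length_less_le hR b
    omega
  obtain ⟨h2, hF2, hs2⟩ := orderUpdate_spec hF1 (h.nodup_P hR) hlen1 hnd1
  set m2 := orderUpdate m1
  obtain ⟨t, p, hm2⟩ := Mem.exists_withCounters h2
  have hb2 : m2.block = m1.block := by rw [hm2]; rfl
  have hP2 : m2.P = m1.P := by rw [hm2]; rfl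
  have hh2 : ∀ b ∈ m1.P, m2.heap b = updatedBlock m1.heap b := by
    intro b hb
    rw [hm2]
    simp [Mem.withCounters, hb]
  have hsplitOff : ∀ c ∈ m.P, ∀ d, splitOff m1.heap c = some d → d ∈ ds := by
    intro c hc d hcd
    rw [splitOff_eq_some] at hcd
    exact (h.part c hc d hcd.1 hcd.2).1
  have hblock1 : ∀ s t, m1.block s = m1.block t ↔
      m.block s = m.block t ∧ (s ∈ m.S ↔ t ∈ m.S) := by
    have key : ∀ s t, s ∈ m.S → t ∉ m.S → m1.block s ≠ m1.block t := by
      intro s t hs ht hst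
      exact hnself t ht (hst ▸ hself s hs)
    intro s t
    by_cases hs : s ∈ m.S <;> by_cases ht : t ∈ m.S
    · constructor
      · intro hst
        refine ⟨h.inj _ (hR.block_mem s) _ (hR.block_mem t) _ (hin s hs) ?_, by simp [hs, ht]⟩
        rw [hst]; exact hin t ht
      · rintro ⟨hst, _⟩
        have h1 := hin s hs
        rw [hst, hin t ht] at h1
        exact (Option.some.inj h1).symm
    · simp [hs, ht, key s t hs ht]
    · simp [hs, ht, (key t s ht hs).symm]
    · simp [hs, ht, hout s hs, hout t ht]
  have hmem2 : ∀ s c, c ∈ (m2.heap (m1.block s)).less ↔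
      ∃ t, m1.block t = c ∧ splitRel r {s | s ∈ m.S} s t := by
    intro s c
    rw [hh2 _ (hblock1P s)]
    by_cases hs : s ∈ m.S
    · rw [updatedBlock, if_neg (not_not.2 (hself s hs)), hless1]
      have : c ∈ ((m.heap (m.block s)).less.filter fun c => (m1.heap c).intersection = some c) ++
          (m.heap (m.block s)).less.filterMap (splitOff m1.heap) ↔
          ∃ e ∈ (m.heap (m.block s)).less, (m1.heap e).intersection = some c := by
        simp only [List.mem_append, List.mem_filter, decide_eq_true_eq, List.mem_filterMap,
          splitOff_eq_some]
        constructor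
        · rintro (h1 | ⟨e, h1, h2, _⟩)
          · exact ⟨c, h1⟩
          · exact ⟨e, h1, h2⟩
        · rintro ⟨e, h1, h2⟩
          by_cases hce : c = e
          · subst hce; exact Or.inl ⟨h1, h2⟩
          · exact Or.inr ⟨e, h1, h2, hce⟩
      rw [this]
      constructor
      -- The state `t'` that witnesses `e ∈ less` may lie outside `S`. It is exchanged for a state
      -- `t ∈ S` of the same old block, which exists because `e` was touched.
      · rintro ⟨e, he, hec⟩
        obtain ⟨t', rfl, hst'⟩ := (hR.mem_less s e).1 he
        obtain ⟨t, ht, htt'⟩ := h.touched _ (hR.block_mem t') (by simp) (by simp [hec])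
        have h1 := hin t ht
        rw [htt', hec] at h1
        exact ⟨t, (Option.some.inj h1).symm,
          htrans _ _ _ hst' ((hR.block_eq_iff t t').1 htt').2, fun _ => ht⟩
      · rintro ⟨t, rfl, hst, ht⟩
        exact ⟨m.block t, (hR.mem_less s _).2 ⟨t, rfl, hst⟩, hin t (ht hs)⟩
    · rw [updatedBlock, if_pos (hnself s hs), hless1]
      simp only [List.mem_append, List.mem_filterMap, splitOff_eq_some]
      constructor
      · rintro (hc | ⟨e, he, hec, _⟩)
        · obtain ⟨t', rfl, hst'⟩ := (hR.mem_less s c).1 hc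
          obtain ⟨t, ht⟩ := hne1 _ (hP1 _ (hR.block_mem t'))
          have htt' : m.block t = m.block t' := by
            by_cases htS : t ∈ m.S
            · by_contra hne
              have h3 := hin t htS
              rw [ht] at h3
              exact h.not_mem_ds hR (hR.block_mem t')
                (h.part _ (hR.block_mem t) _ h3 (Ne.symm hne)).1
            · rw [← hout t htS, ht]
          exact ⟨t, ht, htrans _ _ _ hst' ((hR.block_eq_iff t t').1 htt').2, fun h => absurd h hs⟩
        · obtain ⟨t', rfl, hst'⟩ := (hR.mem_less s e).1 he
          obtain ⟨t, ht, htt'⟩ := h.touched _ (hR.block_mem t') (by simp) (by simp [hec])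
          have h1 := hin t ht
          rw [htt', hec] at h1
          exact ⟨t, (Option.some.inj h1).symm,
            htrans _ _ _ hst' ((hR.block_eq_iff t t').1 htt').2, fun h => absurd h hs⟩
      · rintro ⟨t, rfl, hst, _⟩
        have he : m.block t ∈ (m.heap (m.block s)).less := (hR.mem_less s _).2 ⟨t, rfl, hst⟩
        by_cases ht : t ∈ m.S
        · by_cases h3 : m1.block t = m.block t
          · rw [h3]; exact Or.inl he
          · exact Or.inr ⟨_, he, hin t ht, h3⟩
        · rw [hout t ht]; exact Or.inl he
  -- The flag is set iff some block above is not contained in `S`, i.e. iff a pair starting in the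
  -- block is deleted.
  have hflag : ∀ s ∈ m.S, ((m1.heap (m1.block s)).less.any fun c =>
      decide ((m1.heap c).intersection ≠ some c)) = true ↔ ∃ t ∉ m.S, r s t := by
    intro s hs
    rw [hless1]
    simp only [List.any_eq_true, decide_eq_true_eq]
    constructor
    · rintro ⟨c, hc, hic⟩
      obtain ⟨t', rfl, hst'⟩ := (hR.mem_less s c).1 hc
      rcases hi : (m1.heap (m.block t')).intersection with _ | d
      · exact ⟨t', fun ht => by rw [hin t' ht] at hi; simp at hi, hst'⟩
      · have hd : d ≠ m.block t' := fun hd => hic (by rw [hi, hd])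
        obtain ⟨t, ht, htt'⟩ := (h.part _ (hR.block_mem t') d hi hd).2.2 (by simp)
        exact ⟨t, ht, htrans _ _ _ hst' ((hR.block_eq_iff t t').1 htt').2⟩
    · rintro ⟨t, ht, hst⟩
      exact ⟨m.block t, (hR.mem_less s _).2 ⟨t, rfl, hst⟩, fun hi => ht (hwhole t t rfl hi)⟩
  have hch1 : ∀ b ∈ m1.P, (m1.heap b).changedImage = true →
      b ∈ m.P ∧ (m.heap b).changedImage = true := by
    intro b hb hc
    rw [h.P_eq, List.mem_append] at hb
    rcases hb with hb | hb
    · exact ⟨hb, (h.old b hb).2 ▸ hc⟩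
    · rw [(h.new b hb).2.1] at hc
      simp at hc
  refine ⟨⟨⟨?_, ?_, ?_, ?_, ?_, ?_, ?_, ?_, ?_, ?_⟩, ?_, ⟨ds, ?_⟩, ?_, ?_, ?_, ?_, ?_⟩, hF2,
    (hs1.trans hs2).mono (by ring_nf; omega)⟩
  · rw [hP2]; exact h.nodup_P hR
  · rw [hP2]
    have : m2.fresh = m1.fresh := by rw [hm2]; rfl
    rw [this]
    exact h.lt_fresh hR
  · rw [hP2, hb2]; exact hblock1P
  · rw [hP2, hb2]; exact hne1
  · rw [hP2, hb2]
    intro b hb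
    rw [hh2 b hb, updatedBlock_members]
    exact h.members b hb
  · intro s t
    rw [hb2, hblock1, hR.block_eq_iff]
    simp only [splitRel, Set.mem_ofPred_eq]
    tauto
  · rw [hP2]
    intro b hb
    rw [hh2 b hb]
    have hnd := hnd1 b hb
    have hsub : (m1.heap b).less ⊆ m.P := by
      obtain ⟨s, rfl⟩ := hne1 b hb
      rw [hless1]; exact hlessP s
    have hfm : ((m1.heap b).less.filterMap (splitOff m1.heap)).Nodup := by
      rw [List.Nodup, List.pairwise_filterMap]
      refine List.Pairwise.imp_of_mem ?_ hnd
      rintro c c' hc hc' hcc' d hd e he rfl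
      rw [splitOff_eq_some] at hd he
      exact hcc' (h.inj c (hsub hc) c' (hsub hc') d hd.1 he.1)
    -- Before the update the lists contain only old blocks, whereas the parts split off are new.
    have hdisj : ∀ l : List ℕ, l ⊆ (m1.heap b).less →
        ∀ c ∈ l, ∀ d ∈ (m1.heap b).less.filterMap (splitOff m1.heap), c ≠ d := by
      rintro l hl c hc d hd rfl
      obtain ⟨e, he, hed⟩ := List.mem_filterMap.1 hd
      exact h.not_mem_ds hR (hsub (hl hc)) (hsplitOff e (hsub he) _ hed)
    unfold updatedBlock
    split_ifs
    · exact List.nodup_append.2 ⟨hnd, hfm, hdisj _ (List.Subset.refl _)⟩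
    · exact List.nodup_append.2 ⟨hnd.filter _, hfm, hdisj _ (List.filter_sublist).subset⟩
  · rw [hb2]; exact hmem2
  · rw [hP2]
    intro b hb
    rw [← h.garbage b hb, hm2]
    simp [Mem.withCounters, hb]
  · intro s
    have : m2.mark = m1.mark := by rw [hm2]; rfl
    rw [this, h.mark]
    exact hR.mark s
  · rw [hm2]; exact h.scanned
  · rw [hm2]; exact h.pending
  · intro s hs
    rw [hb2] at hs ⊢
    by_cases hsS : s ∈ m.S
    · by_contra hne
      exact h.not_mem_ds hR hs (h.part _ (hR.block_mem s) _ (hin s hsS) (Ne.symm hne)).1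
    · exact (hout s hsS).symm
  · intro s hs
    rw [hb2, hh2 _ (hblock1P s)] at hs
    rw [hb2]
    by_cases hsS : s ∈ m.S
    · rw [updatedBlock, if_neg (not_not.2 (hself s hsS))] at hs
      simp only [Bool.or_eq_true] at hs
      exact hs.imp (hch1 _ (hblock1P s)) fun h1 => ⟨hsS, (hflag s hsS).1 h1⟩
    · rw [updatedBlock, if_pos (hnself s hsS)] at hs
      exact Or.inl (hch1 _ (hblock1P s) hs)
  · intro s hsS hs
    rw [hb2, hh2 _ (hblock1P s), updatedBlock, if_neg (not_not.2 (hself s hsS))]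
    simp only [Bool.or_eq_true]
    exact Or.inr ((hflag s hsS).2 hs)
  · rw [hm2]; exact h.S
  · rw [hm2]; exact h.X

end SimAlg

/-! ### Rearranged memories and the bound on the number of blocks -/

namespace SimAlg

variable {σ : Type u} [Fintype σ] [DecidableEq σ] {AP : Type v} {K : Kripke σ AP}

namespace Rep

variable {m m' : Mem σ} {r : σ → σ → Prop}

theorem congr (h : Rep m r) (hblock : m'.block = m.block) (hmark : m'.mark = m.mark)
    (hfresh : m'.fresh = m.fresh) (hP : m'.P.Perm m.P)
    (hmem : ∀ b, (m'.heap b).members = (m.heap b).members)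
    (hless : ∀ b, (m'.heap b).less = (m.heap b).less) (hg : ∀ b ∉ m.P, m'.heap b = m.heap b) :
    Rep m' r where
  nodup := hP.nodup_iff.2 h.nodup
  lt_fresh b hb := hfresh ▸ h.lt_fresh b (hP.mem_iff.1 hb)
  block_mem s := hP.mem_iff.2 (hblock ▸ h.block_mem s)
  nonempty b hb := hblock ▸ h.nonempty b (hP.mem_iff.1 hb)
  members b hb := by rw [hmem, hblock]; exact h.members b (hP.mem_iff.1 hb)
  block_eq_iff := hblock ▸ h.block_eq_iff
  less_nodup b hb := hless b ▸ h.less_nodup b (hP.mem_iff.1 hb)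
  mem_less s c := by rw [hless, hblock]; exact h.mem_less s c
  garbage b hb := by
    have hb' : b ∉ m.P := fun h => hb (hP.mem_iff.2 h)
    rw [hg b hb', h.garbage b hb']
  mark := hmark ▸ h.mark

theorem fits (h : Rep m r) {k : ℕ} (hk : m.P.length ≤ k) (hX : m.X.length ≤ Fintype.card σ)
    (hS : m.S.length ≤ Fintype.card σ) : Fits (3 * k) m := by
  refine ⟨by omega, fun b => ?_, hX, hS⟩
  have := h.length_less_le b
  omega

/-- Simulation equivalent states share a block, so the classes of representatives of distinct blocks
are distinct. -/
theorem length_P_le [Nonempty σ] (h : Rep m r) (hr : ∀ s t, K.Sim s t → r s t) :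
    m.P.length ≤ K.Psim.ncard := by
  have h1 := h.nonempty
  choose! f hf using h1
  have h2 : m.P.length = (Set.ncard {b | b ∈ m.P}) := by
    rw [← List.toFinset_card_of_nodup h.nodup, ← Set.ncard_coe_finset]
    congr 1
    ext b
    simp
  rw [h2]
  refine Set.ncard_le_ncard_of_injOn (fun b => {x | K.simSetoid x (f b)}) (fun b _ => ⟨f b, rfl⟩)
    ?_ (Set.toFinite _)
  intro b hb c hc hbc
  have h3 : f b ∈ {x | K.simSetoid x (f c)} := by
    have : f b ∈ {x | K.simSetoid x (f b)} := K.simSetoid.refl (f b)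
    exact (Set.ext_iff.1 hbc (f b)).1 this
  have h4 := K.simSetoid_iff.1 h3
  rw [← hf b hb, ← hf c hc]
  exact (h.block_eq_iff _ _).2 ⟨hr _ _ h4.1, hr _ _ h4.2⟩

end Rep

/-! ### Initialization -/

theorem resetIntersections_split_spec {m : Mem σ} {r : σ → σ → Prop} {k : ℕ} (hR : Rep m r)
    (hU : Unsplit m) (hk : m.P.length ≤ k) (hk' : 1 ≤ k) (hX : m.X.length ≤ Fintype.card σ)
    (hS : m.S.Nodup) (htrans : ∀ s t u, r s t → r t u → r s u) :
    let m' := resetIntersections (orderUpdate (split m))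
    Rep m' (splitRel r {s | s ∈ m.S}) ∧ Unsplit m' ∧ m'.scanned = m.scanned ∧ m'.S = m.S ∧
      m'.X = m.X ∧
      Spends (wordBound σ (3 * k)) (6 * Fintype.card σ + k * (24 * k + 23) + 3) m m' := by
  obtain ⟨h1, h2, h3⟩ := orderUpdate_split_spec hR hU hk hk' hX hS htrans
  obtain ⟨h4, h5⟩ := resetIntersections_spec h2
  intro m'
  obtain ⟨t, p, h6⟩ := Mem.exists_withCounters h4
  change m' = _ at h6
  have h7 : Rep m' (splitRel r {s | s ∈ m.S}) := by
    refine h1.rep.congr ?_ ?_ ?_ ?_ ?_ ?_ ?_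
    · rw [h6]; rfl
    · rw [h6]; rfl
    · rw [h6]; rfl
    · rw [h6]; rfl
    · intro b
      rw [h6]
      by_cases hb : b ∈ (orderUpdate (split m)).P <;> simp [Mem.withCounters, hb]
    · intro b
      rw [h6]
      by_cases hb : b ∈ (orderUpdate (split m)).P <;> simp [Mem.withCounters, hb]
    · intro b hb
      rw [h6]
      simp [Mem.withCounters, hb]
  refine ⟨h7, fun b => ?_, ?_, ?_, ?_, (h3.trans h5).mono (by ring_nf; omega)⟩
  · by_cases hb : b ∈ (orderUpdate (split m)).P
    · rw [h6]; simp [Mem.withCounters, hb]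
    · rw [h7.garbage b]
      rw [h6]; exact hb
  · rw [h6]; exact h1.scanned
  · rw [h6]; exact h1.S
  · rw [h6]; exact h1.X

theorem appendS_spec {N : ℕ} {m : Mem σ} {a : List σ} (hF : Fits N m) (hS : m.S = [])
    (ha : a.Nodup) :
    (forAll a (fun s m => appendS s m) m).data = ({ m with S := a } : Mem σ).data ∧
      Spends (wordBound σ N) (2 * Fintype.card σ + 1) m (forAll a (fun s m => appendS s m) m) := by
  have hlen := ha.length_le_card
  have fits : ∀ l, l <+: a → ∀ t p,
      Fits N (({ m with S := l } : Mem σ).withCounters t p) := fun l hl t p =>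
    ⟨hF.blocks, hF.less, hF.X, hl.length_le.trans hlen⟩
  have := forAll_exact (W := wordBound σ N) a (body := fun s m => appendS s m)
    (fun l => { m with S := l }) (fun _ => 1) (fun l hl => (fits l hl m.time m.peak).words_le)
    (fun l s t p hl => ⟨rfl, spends_tick (fits _ hl t p).words_le⟩) m (by rw [← hS])
  rw [sum_map_const_add_one] at this
  exact ⟨this.1, this.2.mono (by omega)⟩

namespace Input

variable (I : Input K)

theorem label_eq_iff (s t : σ) : K.label s = K.label t ↔ ∀ a ∈ I.atoms, (s ∈ a ↔ t ∈ a) := by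
  constructor
  · intro h a ha
    obtain ⟨p, hp⟩ := (I.mem_atoms _).1 ⟨a, ha, rfl⟩
    have key : ∀ x, x ∈ a ↔ p ∈ K.label x := fun x => Set.ext_iff.1 hp x
    rw [key, key, h]
  · intro h
    ext p
    obtain ⟨a, ha, hap⟩ := (I.mem_atoms _).2 ⟨p, rfl⟩
    have key : ∀ x, x ∈ a ↔ p ∈ K.label x := fun x => Set.ext_iff.1 hap x
    rw [← key, ← key, h a ha]

/-- The memory in which the algorithm starts. -/
def init : Mem σ :=
  { block := fun _ => 0, mark := fun _ => false,
    heap := fun b => if b = 0 then { members := I.states, less := [0] } else {},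
    fresh := 1, scanned := [], pending := [0], X := [], S := [], time := 0, peak := 0 }

theorem rep_init [Nonempty σ] : Rep I.init (fun _ _ => True) where
  nodup := by simp [init, Mem.P]
  lt_fresh := by simp [init, Mem.P]
  block_mem := by simp [init, Mem.P]
  nonempty := by simp [init, Mem.P]
  members := by simp [init, Mem.P, I.mem_states, I.states_nodup]
  block_eq_iff := by simp [init]
  less_nodup := by simp [init, Mem.P]
  mem_less s c := by simp [init, eq_comm]
  garbage := by simp +contextual [init, Mem.P]
  mark := by simp [init]

/-- After some atoms have been treated, the stored relation is agreement on them. It contains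
equality of labels, hence `Sim`, so the bound `k` on the blocks already holds here. Nothing is
claimed about the flags `changedImage`, which this phase may leave set. -/
theorem setup_spec [Nonempty σ] {k : ℕ} (hk : K.Psim.ncard = k) :
    Rep I.setup (fun s t => K.label s = K.label t) ∧ Unsplit I.setup ∧ I.setup.scanned = [] ∧
      I.setup.S = [] ∧ I.setup.X = [] ∧
      Spends (wordBound σ (3 * k)) (3 * Fintype.card σ + 2 +
        I.atoms.length * (20 * Fintype.card σ + k * (48 * k + 46) + 13)) I.init I.setup := by
  have hlen : ∀ (m : Mem σ) (r : σ → σ → Prop), Rep m r → (∀ s t, K.label s = K.label t → r s t) →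
      m.P.length ≤ k := fun m r h hr => hk ▸ h.length_P_le fun s t hst => hr s t hst.label_eq
  have hk' : 1 ≤ k := I.rep_init.length_P_pos.trans (hlen _ _ I.rep_init fun _ _ _ => trivial)
  have hF0 : Fits (3 * k) I.init :=
    I.rep_init.fits (hlen _ _ I.rep_init fun _ _ _ => trivial) (by simp [init]) (by simp [init])
  obtain ⟨h1, h1'⟩ := forAll_exact (W := wordBound σ (3 * k)) I.states
    -- The loop writes values that are already there, so the data stay constant and only time
    -- passes.
    (body := fun s m => setMark s false (setBlock s 0 m)) (fun _ => I.init) (fun _ => 2)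
    (fun _ _ => hF0.words_le)
    (by
      intro l s t p _
      have h2 : Function.update I.init.block s 0 = I.init.block := by
        funext x; simp [init, Function.update_apply]
      have h3 : Function.update I.init.mark s false = I.init.mark := by
        funext x; simp [init, Function.update_apply]
      refine ⟨?_, (spends_tick ?_).trans (spends_tick ?_)⟩
      · simp only [setMark, setBlock, tick, Mem.data, Mem.withCounters, h2, h3]
      · exact (hF0.congr rfl rfl rfl rfl).words_le
      · exact (hF0.congr rfl rfl rfl rfl).words_le)
    I.init rfl
  rw [sum_map_const_add_one] at h1'
  have h2 := forAll_rule (W := wordBound σ (3 * k))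
    (body := fun a m =>
      let m := forAll a (fun s m => appendS s m) m
      let m := resetIntersections (orderUpdate (split m))
      let m := complementS I.states m
      let m := resetIntersections (orderUpdate (split m))
      clearS m)
    (fun l m => ∃ l', l' ++ l = I.atoms ∧ Rep m (fun s t => ∀ a ∈ l', (s ∈ a ↔ t ∈ a)) ∧
      Unsplit m ∧ m.scanned = [] ∧ m.S = [] ∧ m.X = [])
    (fun l _ => l.length * (20 * Fintype.card σ + k * (48 * k + 46) + 13))
    (fun l m ⟨l', h, hR, hU, h3⟩ => ⟨l', h, hR.of_data rfl, hU, h3⟩) (fun _ _ => rfl)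
    (by
      rintro l m ⟨l', h, hR, hU, h3, h4, h5⟩
      refine (hR.fits (hlen m _ hR ?_) (by simp [h5]) (by simp [h4])).words_le
      intro s t hst a ha
      exact (I.label_eq_iff s t).1 hst a (h ▸ List.mem_append_left _ ha))
    (by
      rintro a l m ⟨l', h, hR, hU, h3, h4, h5⟩
      have haI : a ∈ I.atoms := h ▸ List.mem_append_right _ List.mem_cons_self
      have ha := I.atoms_nodup a haI
      have hr : ∀ s t, K.label s = K.label t → ∀ a ∈ l', (s ∈ a ↔ t ∈ a) := fun s t hst a ha =>
        (I.label_eq_iff s t).1 hst a (h ▸ List.mem_append_left _ ha)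
      have hF := hR.fits (hlen m _ hR hr) (by simp [h5]) (by simp [h4])
      obtain ⟨h6, h6'⟩ := appendS_spec hF h4 ha
      set m1 := forAll a (fun s m => appendS s m) m
      obtain ⟨t, p, h7⟩ := Mem.exists_withCounters h6
      have hS1 : m1.S = a := by rw [h7]; rfl
      have hX1 : m1.X = [] := by rw [h7]; exact h5
      have hsc1 : m1.scanned = [] := by rw [h7]; exact h3
      have hU1 : Unsplit m1 := by rw [h7]; exact hU
      have hR1 : Rep m1 (fun s t => ∀ a ∈ l', (s ∈ a ↔ t ∈ a)) := by
        refine hR.congr ?_ ?_ ?_ ?_ ?_ ?_ ?_ <;> rw [h7] <;> try rfl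
        all_goals exact fun _ => by intros; rfl
      obtain ⟨hR2, hU2, hsc2, hS2, hX2, hs2⟩ := resetIntersections_split_spec hR1 hU1
        (hlen m1 _ hR1 hr) hk' (by simp [hX1]) (by rwa [hS1])
        (fun s t u hst htu a ha => (hst a ha).trans (htu a ha))
      set m2 := resetIntersections (orderUpdate (split m1))
      rw [hS1] at hR2 hS2
      rw [hX1] at hX2
      rw [hsc1] at hsc2
      have hr2 : ∀ s t, K.label s = K.label t →
          splitRel (fun s t => ∀ a ∈ l', (s ∈ a ↔ t ∈ a)) {s | s ∈ a} s t := fun s t hst =>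
        ⟨hr s t hst, ((I.label_eq_iff s t).1 hst a haI).1⟩
      obtain ⟨h8, h8'⟩ := complementS_spec (hR2.fits (hlen m2 _ hR2 hr2) (by simp [hX2])
        (by rw [hS2]; exact ha.length_le_card)) hR2.mark I.states_nodup I.mem_states
      set m3 := complementS I.states m2
      obtain ⟨t', p', h9⟩ := Mem.exists_withCounters h8
      have hS3 : m3.S = I.states.filter (· ∉ a) := by rw [h9, ← hS2]; rfl
      have hX3 : m3.X = [] := by rw [h9]; exact hX2
      have hsc3 : m3.scanned = [] := by rw [h9]; exact hsc2
      have hU3 : Unsplit m3 := by rw [h9]; exact hU2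
      have hR3 : Rep m3 (splitRel (fun s t => ∀ a ∈ l', (s ∈ a ↔ t ∈ a)) {s | s ∈ a}) := by
        refine hR2.congr ?_ ?_ ?_ ?_ ?_ ?_ ?_ <;> rw [h9] <;> try rfl
        all_goals exact fun _ => by intros; rfl
      obtain ⟨hR4, hU4, hsc4, hS4, hX4, hs4⟩ := resetIntersections_split_spec hR3 hU3
        (hlen m3 _ hR3 hr2) hk' (by simp [hX3]) (by rw [hS3]; exact I.states_nodup.filter _)
        (fun s t u hst htu => ⟨fun a ha => (hst.1 a ha).trans (htu.1 a ha),
          fun hs => htu.2 (hst.2 hs)⟩)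
      set m4 := resetIntersections (orderUpdate (split m3))
      rw [hS3] at hR4
      rw [hX3] at hX4
      rw [hsc3] at hsc4
      -- Splitting by `a` only gives the implication from `s ∈ a` to `t ∈ a`; the complement
      -- supplies the converse.
      have hrel : splitRel (splitRel (fun s t => ∀ a ∈ l', (s ∈ a ↔ t ∈ a)) {s | s ∈ a})
          {s | s ∈ I.states.filter (· ∉ a)} = fun s t => ∀ x ∈ l' ++ [a], (s ∈ x ↔ t ∈ x) := by
        funext s t
        simp only [splitRel, Set.mem_ofPred_eq, List.mem_filter, I.mem_states, true_and,
          decide_eq_true_eq, eq_iff_iff, List.mem_append, List.mem_singleton]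
        constructor
        · rintro ⟨⟨h1, h2⟩, h3⟩ x (hx | rfl)
          · exact h1 x hx
          · tauto
        · intro h1
          have := h1 a (Or.inr rfl)
          exact ⟨⟨fun x hx => h1 x (Or.inl hx), this.1⟩, fun hs ht => hs (this.2 ht)⟩
      rw [hrel] at hR4
      have hr4 : ∀ s t, K.label s = K.label t → ∀ x ∈ l' ++ [a], (s ∈ x ↔ t ∈ x) :=
        fun s t hst x hx => (I.label_eq_iff s t).1 hst x (by
          rw [← h]
          simp only [List.mem_append, List.mem_cons, List.not_mem_nil, or_false] at hx ⊢
          tauto)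
      have hF4 := hR4.fits (hlen m4 _ hR4 hr4) (by simp [hX4])
        (by rw [hS4, hS3]; exact (I.states_nodup.filter _).length_le_card)
      refine ⟨⟨l' ++ [a], by simpa using h, ?_, hU4, hsc4, rfl, hX4⟩, _,
        (((h6'.trans hs2).trans h8').trans hs4).trans (spends_tick ?_), ?_⟩
      · refine hR4.congr rfl rfl rfl (List.Perm.refl _) (fun _ => rfl) (fun _ => rfl)
          fun _ _ => rfl
      · exact Fits.words_le (N := 3 * k) ⟨hF4.blocks, hF4.less, hF4.X, by simp⟩
      · simp only [List.length_cons]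
        ring_nf
        omega)
    I.atoms (forAll I.states (fun s m => setMark s false (setBlock s 0 m)) I.init)
    ⟨[], rfl, by simpa using I.rep_init.of_data h1, by
      obtain ⟨t, p, h3⟩ := Mem.exists_withCounters h1
      rw [h3]
      refine ⟨fun b => ?_, rfl, rfl, rfl⟩
      by_cases hb : b = 0 <;> simp [Mem.withCounters, init, hb]⟩
  obtain ⟨⟨l', h3, h4, h5, h6, h7, h8⟩, h9⟩ := h2
  rw [List.append_nil] at h3
  subst h3
  have hrel : (fun s t => K.label s = K.label t) = fun s t => ∀ a ∈ I.atoms, (s ∈ a ↔ t ∈ a) := by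
    funext s t
    exact propext (I.label_eq_iff s t)
  rw [hrel]
  refine ⟨h4, h5, h6, h7, h8, (h1'.trans h9).mono ?_⟩
  have := I.states_nodup.length_le_card
  omega

end Input

end SimAlg

namespace SimAlg

variable {σ : Type u} [Fintype σ] [DecidableEq σ] {AP : Type v} {K : Kripke σ AP}

/-! ### The main loop -/

theorem Rep.states_eq {m : Mem σ} {r : σ → σ → Prop} (h : Rep m r) {b : ℕ} (hb : b ∈ m.P) :
    m.states b = {s | m.block s = b} := by
  ext s
  exact (h.members b hb).1 s

theorem Rep.cl_states {m : Mem σ} {A : AbsDom σ} (h : Rep m A.rel) (s : σ) :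
    A.cl (m.states (m.block s)) = A.cl {s} := by
  rw [h.states_eq (h.block_mem s)]
  exact A.cl_eq_of_pr_class rfl fun t ht => ((h.block_eq_iff t s).1 ht).2

theorem Rep.represents {m : Mem σ} {A : AbsDom σ} (h : Rep m A.rel) : Represents m A where
  nodup := h.nodup
  blocks := by
    have hst : ∀ s, m.states (m.block s) = {t | A.pr t s} := by
      intro s
      rw [h.states_eq (h.block_mem s)]
      ext t
      exact (h.block_eq_iff t s).trans A.pr_iff.symm
    refine ⟨?_, ?_, ?_⟩
    · intro b hb
      obtain ⟨s, rfl⟩ := h.nonempty b hb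
      exact ⟨s, hst s⟩
    · intro b hb c hc hbc
      obtain ⟨s, rfl⟩ := h.nonempty b hb
      have : s ∈ m.states (m.block s) := (h.members _ hb).1 s |>.2 rfl
      rw [hbc, h.states_eq hc] at this
      exact this
    · rintro _ ⟨s, rfl⟩
      exact ⟨m.block s, h.block_mem s, hst s⟩
  members_nodup b hb := (h.members b hb).2
  block_eq b hb s := ((h.members b hb).1 s).symm
  less_nodup := h.less_nodup
  mem_less b hb c := by
    obtain ⟨s, rfl⟩ := h.nonempty b hb
    rw [h.mem_less, h.cl_states]
    constructor
    · rintro ⟨t, rfl, hst⟩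
      rw [h.cl_states]
      exact ⟨h.block_mem t, A.rel_iff.1 hst⟩
    · rintro ⟨hc, hcl⟩
      obtain ⟨t, rfl⟩ := h.nonempty c hc
      rw [h.cl_states] at hcl
      exact ⟨t, rfl, A.rel_iff.2 hcl⟩

/-- The invariant of the main loop. -/
structure LoopInv (K : Kripke σ AP) (m : Mem σ) (A : DisjDom σ) : Prop where
  rep : Rep m A.1.rel
  unsplit : Unsplit m
  S : m.S = []
  X : m.X = []
  sim : ∀ s t, K.Sim s t → A.1.rel s t
  le_initDom : A ≤ K.initDom
  complete : ∀ s, m.block s ∈ m.scanned → K.pre (A.1.cl {s}) ∈ A.1.img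

/-- The pairs of simulation equivalence classes that are related by `r`. -/
def relatedPairs (K : Kripke σ AP) (r : σ → σ → Prop) :
    Set (Quotient K.simSetoid × Quotient K.simSetoid) := {p | r p.1.out p.2.out}

theorem ncard_relatedPairs_le (r : σ → σ → Prop) :
    (relatedPairs K r).ncard ≤ K.Psim.ncard ^ 2 := by
  have h1 : Nat.card (Quotient K.simSetoid) = K.Psim.ncard :=
    (Nat.card_congr (Setoid.quotientEquivClasses K.simSetoid)).trans (Nat.card_coe_set_eq _)
  have h2 := Set.ncard_le_card (relatedPairs K r)
  rwa [Nat.card_prod, h1, ← sq] at h2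

/-- The number of blocks in `P` whose flag `changedImage` is set. -/
def numChanged (m : Mem σ) : ℕ := (m.P.filter fun b => (m.heap b).changedImage).length

/-- The potential of the main loop, which bounds the number of blocks still to be scanned. -/
noncomputable def loopPotential (K : Kripke σ AP) (m : Mem σ) (r : σ → σ → Prop) : ℕ :=
  m.pending.length + numChanged m + (K.Psim.ncard - m.P.length) + (relatedPairs K r).ncard

/-- Every newly set flag is charged to a pair of simulation classes that ceases to be related. -/
theorem Updated.numChanged_le {m m' : Mem σ} {A : DisjDom σ} (h : Updated m A.1.rel m')
    (hsim : ∀ s t, K.Sim s t → A.1.rel s t)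
    (hsim' : ∀ s t, K.Sim s t → splitRel A.1.rel {s | s ∈ m.S} s t) :
    numChanged m' + (relatedPairs K (splitRel A.1.rel {s | s ∈ m.S})).ncard ≤
      numChanged m + (relatedPairs K A.1.rel).ncard := by
  set r' := splitRel A.1.rel {s | s ∈ m.S} with hr'
  set old : ℕ → Bool := fun b => decide (b ∈ m.P) && (m.heap b).changedImage with hold
  set L := m'.P.filter fun b => (m'.heap b).changedImage with hL
  have hLnd : L.Nodup := h.rep.nodup.filter _
  have h1 : (L.filter old).length ≤ numChanged m := by
    refine ((hLnd.filter _).subperm ?_).length_le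
    intro b hb
    have := (List.mem_filter.1 hb).2
    simpa [hold] using this
  have hsub : relatedPairs K r' ⊆ relatedPairs K A.1.rel := fun p hp => hp.1
  have h2 : (L.filter fun b => !old b).length + (relatedPairs K r').ncard ≤
      (relatedPairs K A.1.rel).ncard := by
    rw [← Set.ncard_sdiff_add_ncard_of_subset hsub (Set.toFinite _)]
    refine Nat.add_le_add_right ?_ _
    have key : ∀ b ∈ L.filter fun b => !old b, ∃ p : σ × σ, m'.block p.1 = b ∧ p.1 ∈ m.S ∧
        p.2 ∉ m.S ∧ A.1.rel p.1 p.2 := by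
      intro b hb
      rw [List.mem_filter, hL, List.mem_filter] at hb
      obtain ⟨⟨hbP, hbc⟩, hbo⟩ := hb
      obtain ⟨s, rfl⟩ := h.rep.nonempty b hbP
      rcases h.changed s hbc with h3 | ⟨hs, t, ht, hst⟩
      · simp [hold, h3.1, h3.2] at hbo
      · exact ⟨(s, t), rfl, hs, ht, hst⟩
    have h3 : (L.filter fun b => !old b).length = {b | b ∈ L.filter fun b => !old b}.ncard := by
      rw [← List.toFinset_card_of_nodup (hLnd.filter _), ← Set.ncard_coe_finset]
      congr 1
      ext b
      simp
    rw [h3]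
    rcases isEmpty_or_nonempty σ with he | hne
    · have : {b | b ∈ L.filter fun b => !old b} = ∅ := by
        ext b
        simp only [Set.mem_ofPred_eq, Set.mem_empty_iff_false, iff_false]
        intro hb
        exact he.elim (key b hb).choose.1
      rw [this, Set.ncard_empty]
      exact Nat.zero_le _
    choose! f hf using key
    have hout : ∀ s, K.Sim (Quotient.out (s := K.simSetoid) ⟦s⟧) s ∧
        K.Sim s (Quotient.out (s := K.simSetoid) ⟦s⟧) := fun s =>
      K.simSetoid_iff.1 (Quotient.mk_out (s := K.simSetoid) s)
    -- A newly flagged block is sent to the classes of a deleted pair that starts in it. The first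
    -- class determines the block. The pair of representatives is also deleted, because both the old
    -- relation and membership in `S` (for related states) are compatible with `Sim`.
    refine Set.ncard_le_ncard_of_injOn
      (fun b => ((⟦(f b).1⟧ : Quotient K.simSetoid), (⟦(f b).2⟧ : Quotient K.simSetoid))) ?_ ?_
      (Set.toFinite _)
    · intro b hb
      obtain ⟨_, h4, h5, h6⟩ := hf b hb
      refine ⟨A.1.rel_trans (hsim _ _ (hout _).1) (A.1.rel_trans h6 (hsim _ _ (hout _).2)), ?_⟩
      intro h7
      have h8 : (f b).1 ∈ {s | s ∈ m.S} := h4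
      exact h5 ((hsim' _ _ (hout (f b).2).1).2 (h7.2 ((hsim' _ _ (hout (f b).1).2).2 h8)))
    · intro b hb c hc hbc
      have h4 : K.simSetoid (f b).1 (f c).1 := Quotient.exact (Prod.ext_iff.1 hbc).1
      rw [← (hf b hb).1, ← (hf c hc).1]
      exact (h.rep.block_eq_iff _ _).2 ⟨hsim' _ _ h4.1, hsim' _ _ h4.2⟩
  have h3 := List.length_eq_length_filter_add (l := L) old
  have h4 : numChanged m' = L.length := rfl
  omega

/-- The items of the predecessor lists, each paired with the state owning the list, are distinct
transitions. -/
theorem sum_length_pre_le (I : Input K) {X : List σ} (hX : X.Nodup) :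
    (X.map fun s => (I.pre s).length).sum ≤ K.numTrans := by
  have h1 : (X.map fun s => (I.pre s).length).sum =
      (X.flatMap fun s => (I.pre s).map fun t => (t, s)).length := by
    simp [List.length_flatMap]
  have h2 : (X.flatMap fun s => (I.pre s).map fun t => (t, s)).Nodup := by
    rw [List.nodup_flatMap]
    refine ⟨fun s _ => (I.pre_nodup s).map fun a b hab => (Prod.ext_iff.1 hab).1, ?_⟩
    refine List.Pairwise.imp_of_mem ?_ hX
    intro a b _ _ hab p hpa hpb
    obtain ⟨x, _, rfl⟩ := List.mem_map.1 hpa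
    obtain ⟨y, _, hy⟩ := List.mem_map.1 hpb
    exact hab (Prod.ext_iff.1 hy).2.symm
  rw [h1, ← List.toFinset_card_of_nodup h2, ← Set.ncard_coe_finset, Kripke.numTrans]
  refine Set.ncard_le_ncard ?_ (Set.toFinite _)
  rintro ⟨t, s⟩ hp
  simp only [List.coe_toFinset, List.mem_flatMap, List.mem_map, Set.mem_ofPred_eq, Prod.mk.injEq]
    at hp ⊢
  obtain ⟨s', _, t', ht, rfl, rfl⟩ := hp
  exact (I.mem_pre _ _).1 ht

theorem card_le_numTrans (K : Kripke σ AP) : Fintype.card σ ≤ K.numTrans := by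
  choose f hf using K.total
  have h1 : Fintype.card σ = (Set.univ : Set σ).ncard := by
    rw [Set.ncard_univ, Nat.card_eq_fintype_card]
  rw [h1]
  exact Set.ncard_le_ncard_of_injOn (fun s => (s, f s)) (fun s _ => hf s)
    (fun s _ t _ hst => (Prod.ext_iff.1 hst).1) (Set.toFinite _)

/-- The domain that is represented after the block `b` has been scanned. -/
def nextDom (K : Kripke σ AP) (m : Mem σ) (b : ℕ) (A : DisjDom σ) : DisjDom σ :=
  K.refinePre (A.1.cl (m.states b)) A

namespace Input

variable (I : Input K)

-- In the potential, a new block is paid for by the decrease of `k - |P|` and a newly flagged one by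
-- a lost pair of classes. The summand `numChanged` accounts for flags that are set before the scan,
-- as can happen after the initialization.
set_option maxHeartbeats 1600000 in
theorem body_spec [Nonempty σ] {m : Mem σ} {A : DisjDom σ} (h : LoopInv K m A) {k b : ℕ}
    {rest : List ℕ} (hk : K.Psim.ncard = k) (hb : m.pending = b :: rest) :
    LoopInv K (I.body b m) (nextDom K m b A) ∧
      loopPotential K (I.body b m) (nextDom K m b A).1.rel + 1 ≤ loopPotential K m A.1.rel ∧
      Spends (wordBound σ (3 * k)) (12 * Fintype.card σ + 3 * K.numTrans + k * (24 * k + 35) + 9) m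
        (I.body b m) := by
  have hbP : b ∈ m.P := by simp [Mem.P, hb]
  have hPk : m.P.length ≤ k := hk ▸ h.rep.length_P_le h.sim
  have hk' : 1 ≤ k := h.rep.length_P_pos.trans hPk
  -- scanning starts
  set m1 : Mem σ := tick { m with scanned := m.scanned ++ [b], pending := m.pending.tail } with hm1
  have hP1 : m1.P = m.P := by simp [hm1, tick, Mem.P, hb]
  have hR1 : Rep m1 A.1.rel :=
    h.rep.congr rfl rfl rfl (by rw [hP1]) (fun _ => rfl) (fun _ => rfl) fun _ _ => rfl
  have hF1 : Fits (3 * k) m1 := hR1.fits (hP1 ▸ hPk) (by simp [hm1, tick, h.X])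
    (by simp [hm1, tick, h.S])
  have hs1 : Spends (wordBound σ (3 * k)) 1 m m1 :=
    spends_tick (hF1.congr rfl rfl rfl rfl).words_le
  -- the image of the block
  set Y : List σ := (m.heap b).less.flatMap fun c => (m.heap c).members with hY
  have hYnd : Y.Nodup := h.rep.nodup_flatMap (h.rep.less_nodup b hbP) (h.rep.less_subset hbP)
  have hYcl : ∀ s, s ∈ Y ↔ s ∈ A.1.cl (m.states b) := by
    intro s
    obtain ⟨s0, rfl⟩ := h.rep.nonempty b hbP
    rw [h.rep.cl_states, hY, List.mem_flatMap]
    constructor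
    · rintro ⟨c, hc, hsc⟩
      have hcP := h.rep.less_subset hbP hc
      obtain ⟨t, rfl, hst⟩ := (h.rep.mem_less _ _).1 hc
      have hts := ((h.rep.members _ hcP).1 s).1 hsc
      exact A.1.rel_trans hst ((h.rep.block_eq_iff s t).1 hts).2
    · intro hs
      exact ⟨m.block s, (h.rep.mem_less _ _).2 ⟨s, rfl, hs⟩,
        ((h.rep.members _ (h.rep.block_mem s)).1 s).2 rfl⟩
  have hX1 : m1.X = [] := h.X
  obtain ⟨h2, hs2⟩ := image_spec (N := 3 * k) b hF1 (by
    rw [hX1, List.nil_append]; exact hYnd.length_le_card)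
  set m2 := image b m1
  obtain ⟨t2, p2, he2⟩ := Mem.exists_withCounters h2
  have hX2 : m2.X = Y := by rw [he2]; change m1.X ++ Y = Y; rw [hX1, List.nil_append]
  have hF2 : Fits (3 * k) m2 := by
    have h1 : m2.X.length ≤ Fintype.card σ := hX2 ▸ hYnd.length_le_card
    rw [he2] at h1 ⊢
    exact ⟨hF1.blocks, hF1.less, h1, hF1.S⟩
  -- its predecessors
  obtain ⟨h3, hs3⟩ := preImage_spec (pre := I.pre) hF2 (by rw [he2]; exact h.S)
    (fun s => by rw [he2]; exact h.rep.mark s) (hX2 ▸ sum_length_pre_le I hYnd)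
  set m3 := preImage I.pre m2
  obtain ⟨t3, p3, he3⟩ := Mem.exists_withCounters h3
  have hP3 : m3.P = m.P := by rw [← hP1, he3, he2]; rfl
  have hheap3 : m3.heap = m.heap := by rw [he3, he2]; rfl
  have hblock3 : m3.block = m.block := by rw [he3, he2]; rfl
  have hS3 : m3.S = appendNew [] (Y.flatMap I.pre) := by rw [← hX2, he3]; rfl
  have hX3 : m3.X = [] := by rw [he3]; rfl
  have hsc3 : m3.scanned = m.scanned ++ [b] := by rw [he3, he2]; rfl
  have hpe3 : m3.pending = rest := by
    rw [he3, he2]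
    change m.pending.tail = rest
    rw [hb]; rfl
  have hR3 : Rep m3 A.1.rel := by
    refine h.rep.congr hblock3 ?_ ?_ (by rw [hP3]) (fun c => by rw [hheap3])
      (fun c => by rw [hheap3]) fun c _ => by rw [hheap3]
    · rw [he3, he2]; rfl
    · rw [he3, he2]; rfl
  have hU3 : Unsplit m3 := fun c => by rw [hheap3]; exact h.unsplit c
  have hSset : {s | s ∈ m3.S} = K.pre (A.1.cl (m.states b)) := by
    ext s
    rw [Set.mem_ofPred_eq, hS3, mem_appendNew]
    simp only [List.not_mem_nil, false_or, List.mem_flatMap, I.mem_pre, hYcl]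
    rfl
  -- the refinement
  obtain ⟨h4, hF4, hs4⟩ := orderUpdate_split_spec hR3 hU3 (hP3 ▸ hPk) hk' (by simp [hX3])
    (by rw [hS3]; exact nodup_appendNew List.nodup_nil _) (fun _ _ _ => A.1.rel_trans)
  set m4 := orderUpdate (split m3)
  have hrel : splitRel A.1.rel {s | s ∈ m3.S} = (nextDom K m b A).1.rel := by
    funext s t
    rw [hSset]
    exact propext (K.rel_refinePre _ A s t).symm
  have hsim' : ∀ s t, K.Sim s t → (nextDom K m b A).1.rel s t := fun s t =>
    Kripke.Sim.rel_refinePre K (A.1.cl_mem_img _) h.sim s t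
  have hcount := h4.numChanged_le h.sim (by rw [hrel]; exact hsim')
  rw [hrel] at hcount
  have hR4 := h4.rep
  rw [hrel] at hR4
  have hPk4 : m4.P.length ≤ k := hk ▸ hR4.length_P_le hsim'
  set m5 := clearS m4 with hm5
  have hF5 : Fits (3 * k) m5 := ⟨hF4.blocks, hF4.less, hF4.X, by simp [hm5, clearS, tick]⟩
  have hs5 : Spends (wordBound σ (3 * k)) 1 m4 m5 :=
    spends_tick (hF5.congr rfl rfl rfl rfl).words_le
  obtain ⟨pe, h6, hperm, hs6⟩ := resetAndMove_spec hF5 hR4.nodup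
  have hbody : I.body b m = resetAndMove m5 := rfl
  rw [hbody]
  set m6 := resetAndMove m5
  obtain ⟨t6, p6, he6⟩ := Mem.exists_withCounters h6
  have hheap6 : ∀ c, m6.heap c = if c ∈ m4.P then
      { m4.heap c with intersection := none, changedImage := false } else m4.heap c := by
    intro c
    rw [he6]; rfl
  have hsc6 : m6.scanned = m4.scanned.filter fun c => !(m4.heap c).changedImage := by rw [he6]; rfl
  have hpe6 : m6.pending = pe := by rw [he6]; rfl
  have hP6 : m6.P.Perm m4.P := by
    rw [Mem.P, hsc6, hpe6]
    exact hperm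
  have hR6 : Rep m6 (nextDom K m b A).1.rel := by
    refine hR4.congr ?_ ?_ ?_ hP6 (fun c => ?_) (fun c => ?_) fun c hc => ?_
    · rw [he6]; rfl
    · rw [he6]; rfl
    · rw [he6]; rfl
    · rw [hheap6]; split_ifs <;> rfl
    · rw [hheap6]; split_ifs <;> rfl
    · rw [hheap6, if_neg hc]
  have hflag6 : ∀ c ∈ m6.P,
      (m6.heap c).intersection = none ∧ (m6.heap c).changedImage = false := by
    intro c hc
    rw [hheap6, if_pos (hP6.mem_iff.1 hc)]
    exact ⟨rfl, rfl⟩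
  have hblock6 : m6.block = m4.block := by rw [he6]; rfl
  obtain ⟨ds, hds⟩ := h4.pending
  rw [hpe3] at hds
  refine ⟨⟨hR6, fun c => ?_, ?_, ?_, hsim', ?_, ?_⟩, ?_, ?_⟩
  · by_cases hc : c ∈ m6.P
    · exact (hflag6 c hc).1
    · rw [hR6.garbage c hc]
  · rw [he6]; rfl
  · rw [he6]; exact h4.X.trans hX3
  · exact (K.refinePre_le _ A).trans h.le_initDom
  · intro s hs
    rw [hblock6, hsc6, List.mem_filter, h4.scanned, hsc3, List.mem_append, List.mem_singleton] at hs
    obtain ⟨hs1, hs2⟩ := hs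
    have hs2 : (m4.heap (m4.block s)).changedImage = false := by simpa using hs2
    -- New blocks are appended to `pending`, so a scanned block is an old one and its states were in
    -- it before.
    have hsP : m4.block s ∈ m3.P := by
      rw [hP3]
      rcases hs1 with hs1 | hs1
      · exact List.mem_append_left _ hs1
      · rw [hs1]; exact hbP
    have hsb := h4.block_eq s hsP
    rw [hblock3] at hsb
    -- A block that is not flagged has lost no pair, so the closure of its states is unchanged.
    have hcl : (nextDom K m b A).1.cl {s} = A.1.cl {s} := by
      ext t
      change (nextDom K m b A).1.rel s t ↔ A.1.rel s t
      rw [← hrel]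
      refine ⟨fun h => h.1, fun hst => ⟨hst, fun hsS => ?_⟩⟩
      by_contra htS
      rw [h4.of_split s hsS ⟨t, htS, hst⟩] at hs2
      simp at hs2
    rw [hcl]
    -- For blocks scanned earlier the fixed set survives the refinement; for `b` itself it is the
    -- very set that the refinement adds.
    rcases hs1 with hs1 | hs1
    · exact K.img_subset_refinePre _ A (h.complete s (hsb ▸ hs1))
    · rw [← h.rep.cl_states, hsb, hs1]
      exact K.pre_mem_refinePre _ A
  -- The new `pending` has `rest`, the new blocks, and the flagged blocks of the scanned part.
  -- Flagged blocks that were still pending change only their position. The gain of one is the block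
  -- `b`.
  · have h7 : numChanged m6 = 0 := by
      rw [numChanged, List.length_eq_zero_iff, List.filter_eq_nil_iff]
      intro c hc
      simp [(hflag6 c hc).2]
    have h8 : numChanged m3 = numChanged m := by rw [numChanged, hP3, hheap3]; rfl
    have h9 := hP6.length_eq
    have h10 : m4.P.length = m.P.length + ds.length := by
      rw [Mem.P, h4.scanned, hds, hsc3]
      simp [Mem.P, hb]
      omega
    have h11 : m4.P.length = m4.scanned.length + rest.length + ds.length := by
      rw [Mem.P, hds]; simp [add_assoc]
    have h12 : m6.P.length = m6.scanned.length + m6.pending.length := by rw [Mem.P]; simp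
    have h13 := List.length_eq_length_filter_add (l := m4.scanned)
      fun c => (m4.heap c).changedImage
    have h14 : (m4.scanned.filter fun c => (m4.heap c).changedImage).length ≤ numChanged m4 :=
      ((List.sublist_append_left _ _).filter _).length_le
    have h15 : m6.scanned.length =
      (m4.scanned.filter fun c => !(m4.heap c).changedImage).length := by rw [hsc6]
    have h16 : m.pending.length = rest.length + 1 := by rw [hb]; rfl
    unfold loopPotential
    rw [hk]
    omega
  · refine (((((hs1.trans hs2).trans hs3).trans hs4).trans hs5).trans hs6).mono ?_
    ring_nf
    omega

/-- The domains that are represented by the memories of a run. -/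
def dom (K : Kripke σ AP) (I : Input K) : ℕ → DisjDom σ
  | 0 => K.initDom
  | i + 1 =>
    match (I.run i).pending with
    | [] => dom K I i
    | b :: _ => nextDom K (I.run i) b (dom K I i)

theorem run_succ (i : ℕ) : I.run (i + 1) = I.loopStep (I.run i) :=
  Function.iterate_succ_apply' _ _ _

theorem loopInv_run [Nonempty σ] (i : ℕ) : LoopInv K (I.run i) (dom K I i) := by
  induction i with
  | zero =>
    obtain ⟨h1, h2, h3, h4, h5, _⟩ := I.setup_spec rfl
    have hrel : K.initDom.1.rel = fun s t => K.label s = K.label t := by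
      funext s t
      exact propext (K.rel_initDom s t)
    refine ⟨?_, h2, h4, h5, fun s t hst => (K.rel_initDom s t).2 hst.label_eq, le_rfl, ?_⟩
    · change Rep I.setup K.initDom.1.rel
      rw [hrel]; exact h1
    · intro s hs
      change I.setup.block s ∈ I.setup.scanned at hs
      simp [h3] at hs
  | succ i ih =>
    rw [run_succ, loopStep, dom]
    rcases hp : (I.run i).pending with _ | ⟨b, rest⟩
    · exact ih
    · exact (I.body_spec ih rfl hp).1

theorem loopPotential_run [Nonempty σ] {i : ℕ} (h : (I.run i).pending ≠ []) :
    loopPotential K (I.run (i + 1)) (dom K I (i + 1)).1.rel + 1 ≤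
      loopPotential K (I.run i) (dom K I i).1.rel := by
  rw [run_succ, loopStep, dom]
  rcases hp : (I.run i).pending with _ | ⟨b, rest⟩
  · exact absurd hp h
  · exact (I.body_spec (I.loopInv_run i) rfl hp).2.1

theorem spends_run [Nonempty σ] {k : ℕ} (hk : K.Psim.ncard = k) (i : ℕ) :
    Spends (wordBound σ (3 * k)) (3 * Fintype.card σ + 2 +
      I.atoms.length * (20 * Fintype.card σ + k * (48 * k + 46) + 13) +
      i * (12 * Fintype.card σ + 3 * K.numTrans + k * (24 * k + 35) + 9)) I.init (I.run i) := by
  induction i with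
  | zero => exact (I.setup_spec hk).2.2.2.2.2.mono (by omega)
  | succ i ih =>
    have : Spends (wordBound σ (3 * k))
        (12 * Fintype.card σ + 3 * K.numTrans + k * (24 * k + 35) + 9) (I.run i)
        (I.run (i + 1)) := by
      rw [run_succ, loopStep]
      rcases hp : (I.run i).pending with _ | ⟨b, rest⟩
      · exact (Spends.refl _ _).mono (Nat.zero_le _)
      · exact (I.body_spec (I.loopInv_run i) hk hp).2.2
    exact (ih.trans this).mono (by ring_nf; omega)

/-- The pending and the flagged blocks number at most `|P|` each; with `k - |P|` this makes at most
`k + |P| ≤ 2k`, and the related pairs add `k²`. -/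
theorem loopPotential_zero_le [Nonempty σ] {k : ℕ} (hk : K.Psim.ncard = k) :
    loopPotential K (I.run 0) (dom K I 0).1.rel ≤ 2 * k + k ^ 2 := by
  have h := I.loopInv_run 0
  have h1 := h.rep.length_P_le h.sim
  have h2 : numChanged (I.run 0) ≤ (I.run 0).P.length := List.length_filter_le _ _
  have h3 := ncard_relatedPairs_le (K := K) (dom K I 0).1.rel
  have h4 : (I.run 0).pending.length ≤ (I.run 0).P.length := by simp [Mem.P]
  unfold loopPotential
  rw [hk] at *
  omega

theorem exists_haltsAt [Nonempty σ] {k : ℕ} (hk : K.Psim.ncard = k) :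
    ∃ n, I.HaltsAt n ∧ n ≤ 2 * k + k ^ 2 := by
  have key : ∀ i, (∀ j < i, (I.run j).pending ≠ []) →
      loopPotential K (I.run i) (dom K I i).1.rel + i ≤
        loopPotential K (I.run 0) (dom K I 0).1.rel := by
    intro i
    induction i with
    | zero => exact fun _ => le_rfl
    | succ i ih =>
      intro h
      have h1 := ih fun j hj => h j (by omega)
      have h2 := I.loopPotential_run (h i (by omega))
      omega
  have h0 := I.loopPotential_zero_le hk
  have hex : ∃ n, (I.run n).pending = [] := by
    by_contra hne
    push Not at hne
    have := key (2 * k + k ^ 2 + 1) fun j _ => hne j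
    omega
  classical
  refine ⟨Nat.find hex, ⟨fun i hi => Nat.find_min hex hi, Nat.find_spec hex⟩, ?_⟩
  have := key (Nat.find hex) fun i hi => Nat.find_min hex hi
  omega

end Input

end SimAlg

/-- There is a universal constant `C` such that on every finite Kripke structure the algorithm
halts, computes simulation equivalence, executes GPT for `{pre}` on the disjunctive abstract
domains, and respects the bounds on time and space. -/
theorem theorem5p4 :
    ∃ C : ℕ, ∀ (σ : Type u) (AP : Type v) [Fintype σ] [DecidableEq σ] [Nonempty σ]
      (K : Kripke σ AP) (I : SimAlg.Input K),
      ∃ n : ℕ, I.HaltsAt n ∧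
        -- the algorithm computes simulation equivalence
        (I.run n).partition = K.Psim ∧
        ((∀ s s', K.label s' ⊆ K.label s → K.label s' = K.label s) →
          (I.run n).partition = K.PsimIncl) ∧
        -- it is an instance of GPT on disjunctive domains, represented by posets of blocks
        (∃ A : ℕ → DisjDom σ,
          A 0 = K.initDom ∧
          (∀ i ≤ n, SimAlg.Represents (I.run i) (A i).1) ∧
          (∀ i < n, ∀ b, (I.run i).pending.head? = some b →
            ∀ S : Fin 1 → Set σ, S = (fun _ => (A i).1.cl ((I.run i).states b)) →
            (S ∈ (disjGI σ).refiners K.preFun (A i) ∧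
                A (i + 1) = (disjGI σ).refine K.preFun S (A i)) ∨
              (S ∉ (disjGI σ).refiners K.preFun (A i) ∧ A (i + 1) = A i)) ∧
          (disjGI σ).GPTOutput {K.preFun} K.initDom (A n)) ∧
        -- space
        (I.run n).peak ≤ C * (Fintype.card σ + K.Psim.ncard ^ 2) ∧
        -- time
        (I.run n).time ≤
          C * ((I.atoms.length + K.Psim.ncard ^ 2) * (K.Psim.ncard ^ 2 + K.numTrans)) ∧
        (I.atoms.length ≤ K.Psim.ncard ^ 2 →
          (I.run n).time ≤ C * (K.Psim.ncard ^ 2 * (K.Psim.ncard ^ 2 + K.numTrans))) := by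
  -- The time bound holds with 300; the factor two is needed for the last clause, where `|Atoms| +
  -- k² ≤ 2k²`.
  refine ⟨600, fun σ AP _ _ _ K I => ?_⟩
  set k := K.Psim.ncard with hk
  set E := K.numTrans with hE
  obtain ⟨n, hn, hnle⟩ := I.exists_haltsAt hk.symm
  have hinv := I.loopInv_run
  -- When nothing is pending, every state lies in a scanned block.
  have hcomplete : K.PreComplete (SimAlg.Input.dom K I n) := by
    intro s
    refine (hinv n).complete s ?_
    have h1 := (hinv n).rep.block_mem s
    rw [SimAlg.Mem.P, hn.2, List.append_nil] at h1
    exact h1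
  have hpart : (I.run n).partition = K.Psim := by
    rw [← hcomplete.classes_eq (hinv n).le_initDom (hinv n).sim,
      ← (hinv n).rep.represents.blocks.image_eq]
    ext B
    exact ⟨fun ⟨b, hb, h⟩ => ⟨b, hb, h.symm⟩, fun ⟨b, hb, h⟩ => ⟨b, hb, h.symm⟩⟩
  have hk1 : 1 ≤ k :=
    (hinv 0).rep.length_P_pos.trans ((hinv 0).rep.length_P_le (hinv 0).sim)
  have hcard : Fintype.card σ ≤ E := SimAlg.card_le_numTrans K
  have hspend := I.spends_run hk.symm n
  have hkk : k ≤ k ^ 2 := by nlinarith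
  have htime : (I.run n).time ≤ 300 * ((I.atoms.length + k ^ 2) * (k ^ 2 + E)) := by
    have h1 : (I.run n).time ≤ 0 + _ := hspend.1
    rw [zero_add] at h1
    have h2 : 3 * Fintype.card σ + 2 ≤ 3 * (k ^ 2 + E) := by omega
    have h3 : 20 * Fintype.card σ + k * (48 * k + 46) + 13 ≤ 107 * (k ^ 2 + E) := by
      have : k * (48 * k + 46) = 48 * k ^ 2 + 46 * k := by ring
      omega
    have h4 : 12 * Fintype.card σ + 3 * E + k * (24 * k + 35) + 9 ≤ 68 * (k ^ 2 + E) := by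
      have : k * (24 * k + 35) = 24 * k ^ 2 + 35 * k := by ring
      omega
    -- As `k ≥ 1`, all lower order terms are absorbed in `k²`.
    have h5 : n ≤ 3 * k ^ 2 := by omega
    have h6 := Nat.mul_le_mul_left I.atoms.length h3
    have h7 := Nat.mul_le_mul h5 h4
    have h8 : k ^ 2 + E ≤ k ^ 2 * (k ^ 2 + E) := Nat.le_mul_of_pos_left _ (by omega)
    nlinarith [Nat.zero_le (I.atoms.length * (k ^ 2 + E))]
  refine ⟨n, hn, hpart, fun hl => hpart.trans (K.PsimIncl_eq hl).symm,
    ⟨SimAlg.Input.dom K I, rfl, fun i _ => (hinv i).rep.represents, ?_, ?_, ?_⟩, ?_, ?_, ?_⟩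
  · rintro i hi b hb S rfl
    have hnext : SimAlg.Input.dom K I (i + 1) =
        SimAlg.nextDom K (I.run i) b (SimAlg.Input.dom K I i) := by
      rw [SimAlg.Input.dom]
      rcases hp : (I.run i).pending with _ | ⟨c, rest⟩
      · simp [hp] at hb
      · simp only [hp, List.head?_cons, Option.some.injEq] at hb
        rw [hb]
    rw [hnext]
    by_cases href : (fun _ => (SimAlg.Input.dom K I i).1.cl ((I.run i).states b)) ∈
        (disjGI σ).refiners K.preFun (SimAlg.Input.dom K I i)
    · exact Or.inl ⟨href, rfl⟩
    -- The refinement lies below the current domain, so if it is not strictly below, it is equal to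
    -- it.
    · refine Or.inr ⟨href, ?_⟩
      by_contra hne
      exact href ⟨fun _ => AbsDom.cl_mem_img _ _, lt_of_le_of_ne (K.refinePre_le _ _) hne⟩
  · have hsteps : ∀ i ≤ n, Relation.ReflTransGen ((disjGI σ).GPTStep {K.preFun}) K.initDom
        (SimAlg.Input.dom K I i) := by
      intro i
      induction i with
      | zero => exact fun _ => Relation.ReflTransGen.refl
      | succ i ih =>
        intro hi
        have h1 := ih (by omega)
        rw [SimAlg.Input.dom]
        rcases hp : (I.run i).pending with _ | ⟨b, rest⟩
        · exact h1
        -- A scan that leaves the domain unchanged contributes no step to the run of GPT.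
        · by_cases hne : SimAlg.nextDom K (I.run i) b (SimAlg.Input.dom K I i) =
            SimAlg.Input.dom K I i
          · simp only [hne]
            exact h1
          · exact h1.tail ⟨K.preFun, rfl, _, ⟨fun _ => AbsDom.cl_mem_img _ _,
              lt_of_le_of_ne (K.refinePre_le _ _) hne⟩, rfl⟩
    exact hsteps n le_rfl
  · rintro f rfl
    exact hcomplete.refiners_eq_empty
  · have h1 : (I.run n).peak ≤ max 0 _ := hspend.2
    rw [Nat.zero_max, SimAlg.wordBound] at h1
    have h2 : 3 * k * (7 + 3 * (3 * k)) = 21 * k + 27 * k ^ 2 := by ring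
    omega
  · exact htime.trans (Nat.mul_le_mul_right _ (by norm_num))
  · intro hle
    refine htime.trans ?_
    have h1 : (I.atoms.length + k ^ 2) * (k ^ 2 + E) ≤ (2 * k ^ 2) * (k ^ 2 + E) :=
      Nat.mul_le_mul_right _ (by omega)
    calc 300 * ((I.atoms.length + k ^ 2) * (k ^ 2 + E)) ≤ 300 * ((2 * k ^ 2) * (k ^ 2 + E)) :=
          Nat.mul_le_mul_left _ h1
      _ = 600 * (k ^ 2 * (k ^ 2 + E)) := by ring
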